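/- **Setting.** Let $p,T,\Delta F,r$ (pressure, temperature, free energy increment, reaction rate) be real-analytic functions of $(v,S,\lambda)$ on an open set $U\subset\mathbb R^3$, with $T>0$ and, at the points of $U$ with $\lambda=0$, $r=r_v=r_S=0$ and $r_\lambda<0$. Put $\Phi=-r\,\Delta F/T$ and $c_0^2=-v^2p_v$. Let $(v,u,S,\lambda)(x)$, $x\ge 0$, be the reaction zone of a steady strong detonation profile of type D, i.e. real-analytic functions on $[0,\infty)$ with $v>0$, $(v,S,\lambda)\in U$, satisfying $$uv'-vu'=0,\qquad uu'+v\,p(v,S,\lambda)'=0,\qquad uS'=\Phi,\qquad u\lambda'=r,$$ with $(v,S,\lambda)(x)\to(v_\infty,S_\infty,0)\in U$ as $x\to\infty$, with constants such that $0<C_1\le\kappa:=u/c_0\le C_2<1$ and $0<C_3\le u\le C_4$ on $[0,\infty)$, and with $(c_0^2-u^2)'<0$ on $[0,\infty)$. Put $\eta=1-\kappa^2$, $m=u/v$. Consider for $\theta:[0,\infty)\to\mathbb C^5$, $h>0$, $\Re\zeta\ge 0$, the system $$h\,\theta_x=(\Phi_0(x,\zeta)+h\Phi_1(x))\,\theta,\qquad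 \Phi_0=\{A_x^{-1}(\zeta I+iA_y)\}^t,\quad \Phi_1=\{A_x^{-1}B\}^t, \tag{1}$$ $$A_x=\begin{pmatrix}u&-v&0&0&0\\ -c_0^2/v&u&0&vp_S&vp_\lambda\\0&0&u&0&0\\0&0&0&u&0\\0&0&0&0&u\end{pmatrix},\quad A_y=\begin{pmatrix}0&0&-v&0&0\\0&0&0&0&0\\-c_0^2/v&0&0&vp_S&vp_\lambda\\0&0&0&0&0\\0&0&0&0&0\end{pmatrix},$$ $$B=\begin{pmatrix}-u'&v'&0&0&0\\p'-v(c_0^2/v^2)'&u'&0&vp_S'&vp_\lambda'\\0&0&0&0&0\\-\Phi_v&S'&0&-\Phi_S&-\Phi_\lambda\\-r_v&\lambda'&0&-r_S&-r_\lambda\end{pmatrix},$$ where everything is evaluated along the profile and $'=d/dx$. Let $$T_1(x,\zeta)=\Big(\frac{ms}{\kappa u},\ \frac{\zeta}{u},\ -i,\ -\frac{\kappa p_S s}{um},\ -\frac{\kappa p_\lambda s}{um}\Big)^t,\qquad s=\sqrt{\zeta^2+c_0^2\eta},$$ be the eigenvector of $\Phi_0(x,\zeta)$ for the eigenvalue $\mu_1=-\kappa(\kappa\zeta+s)/(\eta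 u)$; the root is the branch analytic off the segment $[-ic_0\sqrt\eta,\,ic_0\sqrt\eta]$ that is positive for $\zeta>0$. For $\Re\zeta>0$ a *decaying solution* is a nontrivial solution of (1) that decays exponentially as $x\to\infty$. For $\Re\zeta=0$ it is a nontrivial bounded solution of (1) that is the pointwise limit, as $z\to\zeta$ with $\Re z>0$, of decaying solutions for the parameters $(z,h)$. **Proposition k1 (large $|\zeta|$).** There are constants $M>0$ and $C>0$ such that for all $\zeta$ with $|\zeta|\ge M$, $\Re\zeta\ge0$, and all $0<h\le1$: a decaying solution exists and is unique up to a nonzero constant factor, and, suitably normalized by such a factor, the decaying solution $\theta(x,\zeta,h)$ satisfies $$|\theta(0,\zeta,h)-T_1(0,\zeta)|\le C\,\frac{h}{|\zeta|}\,|T_1(0,\zeta)| .$$ The constants $M$ and $C$ depend only on the functions $p,T,\Delta F,r$ and the profile, not on $(\zeta,h)$. -/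

import Mathlib

open Set Filter Topology

noncomputable section

namespace ZND

/-- A thermodynamic state `(v, S, lam)`: specific volume, entropy, mass fraction of reactant. -/
abbrev State := ℝ × ℝ × ℝ

/-- Partial derivative in the specific volume `v`. -/
def dv (f : State → ℝ) (q : State) : ℝ := fderiv ℝ f q (1, 0, 0)

/-- Partial derivative in the entropy `S`. -/
def dS (f : State → ℝ) (q : State) : ℝ := fderiv ℝ f q (0, 1, 0)

/-- Partial derivative in the reactant mass fraction `lam`. -/
def dlam (f : State → ℝ) (q : State) : ℝ := fderiv ℝ f q (0, 0, 1)

/-- The functions of `(v, S, lam)` entering the ZND system, real analytic on an open set `dom` of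
states: pressure, temperature, free energy increment and reaction rate, with the assumptions on the
rate at `lam = 0`. -/
structure Model where
  dom : Set State
  isOpen_dom : IsOpen dom
  p : State → ℝ
  T : State → ℝ
  dF : State → ℝ
  r : State → ℝ
  analytic_p : AnalyticOnNhd ℝ p dom
  analytic_T : AnalyticOnNhd ℝ T dom
  analytic_dF : AnalyticOnNhd ℝ dF dom
  analytic_r : AnalyticOnNhd ℝ r dom
  T_pos : ∀ q ∈ dom, 0 < T q
  r_zero : ∀ v S : ℝ, (v, S, (0 : ℝ)) ∈ dom → r (v, S, 0) = 0
  dlam_r_neg : ∀ v S : ℝ, (v, S, (0 : ℝ)) ∈ dom → dlam r (v, S, 0) < 0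
  dv_r_zero : ∀ v S : ℝ, (v, S, (0 : ℝ)) ∈ dom → dv r (v, S, 0) = 0
  dS_r_zero : ∀ v S : ℝ, (v, S, (0 : ℝ)) ∈ dom → dS r (v, S, 0) = 0

/-- The source term `- r ΔF / T` of the entropy equation. -/
def Model.entropySource (Z : Model) (q : State) : ℝ := -Z.r q * Z.dF q / Z.T q

/-- The square of the (frozen) sound speed, `c₀² = - v² p_v`. -/
def Model.soundSq (Z : Model) (q : State) : ℝ := -q.1 ^ 2 * dv Z.p q

/-- The sound speed `c₀`. -/
def Model.sound (Z : Model) (q : State) : ℝ := Real.sqrt (Z.soundSq q)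

/-- The derivative of a function on the reaction zone `[0, ∞)`, one-sided at `0`. -/
def dx (f : ℝ → ℝ) (x : ℝ) : ℝ := derivWithin f (Ici 0) x

/-- The reaction zone `x ≥ 0` of a steady planar strong detonation profile
`(v, u, 0, 0, S, lam)` of type D. -/
structure Profile (Z : Model) where
  v : ℝ → ℝ
  u : ℝ → ℝ
  S : ℝ → ℝ
  lam : ℝ → ℝ
  analytic_v : AnalyticOn ℝ v (Ici 0)
  analytic_u : AnalyticOn ℝ u (Ici 0)
  analytic_S : AnalyticOn ℝ S (Ici 0)
  analytic_lam : AnalyticOn ℝ lam (Ici 0)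
  v_pos : ∀ x, 0 ≤ x → 0 < v x
  mem_dom : ∀ x, 0 ≤ x → (v x, S x, lam x) ∈ Z.dom
  /-- the steady one-dimensional ZND equations -/
  mass : ∀ x, 0 ≤ x → u x * dx v x - v x * dx u x = 0
  momentum : ∀ x, 0 ≤ x →
    u x * dx u x + v x * dx (fun y => Z.p (v y, S y, lam y)) x = 0
  entropy : ∀ x, 0 ≤ x → u x * dx S x = Z.entropySource (v x, S x, lam x)
  reaction : ∀ x, 0 ≤ x → u x * dx lam x = Z.r (v x, S x, lam x)
  /-- the end state at `+∞`, where the reactant is consumed -/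
  vInf : ℝ
  SInf : ℝ
  inf_mem_dom : (vInf, SInf, (0 : ℝ)) ∈ Z.dom
  tendsto_inf : Tendsto (fun x => (v x, S x, lam x)) atTop (𝓝 (vInf, SInf, (0 : ℝ)))
  /-- the flow is uniformly subsonic, with velocity bounded and bounded away from zero -/
  subsonic : ∃ C₁ C₂ : ℝ, 0 < C₁ ∧ C₂ < 1 ∧
    ∀ x, 0 ≤ x → C₁ ≤ u x / Z.sound (v x, S x, lam x) ∧
      u x / Z.sound (v x, S x, lam x) ≤ C₂
  u_bounds : ∃ C₃ C₄ : ℝ, 0 < C₃ ∧ ∀ x, 0 ≤ x → C₃ ≤ u x ∧ u x ≤ C₄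
  /-- type D: `c₀² - u²` is decreasing -/
  typeD : ∀ x, 0 ≤ x → dx (fun y => Z.soundSq (v y, S y, lam y) - u y ^ 2) x < 0

/-- Vectors of `ℂ⁵`, with the Euclidean norm. -/
abbrev C5 := EuclideanSpace ℂ (Fin 5)

namespace Profile

variable {Z : Model} (P : Profile Z)

/-- The thermodynamic state of the profile at `x`. -/
def q (x : ℝ) : State := (P.v x, P.S x, P.lam x)

/-- `c₀²` along the profile. -/
def cSq (x : ℝ) : ℝ := Z.soundSq (P.q x)

/-- The Mach number `κ = u / c₀`. -/
def kappa (x : ℝ) : ℝ := P.u x / Z.sound (P.q x)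

/-- `η = 1 - κ²`. -/
def eta (x : ℝ) : ℝ := 1 - P.kappa x ^ 2

/-- The mass flux `m = u / v`. -/
def massFlux (x : ℝ) : ℝ := P.u x / P.v x

/-- Derivative along the profile of a function of the state. -/
def along (f : State → ℝ) (x : ℝ) : ℝ := dx (fun y => f (P.q y)) x

/-- The coefficient `A_x` of the linearized system; its entry `φ_v` is `v p_v = - c₀² / v`. -/
def Ax (x : ℝ) : Matrix (Fin 5) (Fin 5) ℝ :=
  !![P.u x, -P.v x, 0, 0, 0;
     -P.cSq x / P.v x, P.u x, 0, P.v x * dS Z.p (P.q x), P.v x * dlam Z.p (P.q x);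
     0, 0, P.u x, 0, 0;
     0, 0, 0, P.u x, 0;
     0, 0, 0, 0, P.u x]

/-- The coefficient `A_y` of the linearized system. -/
def Ay (x : ℝ) : Matrix (Fin 5) (Fin 5) ℝ :=
  !![0, 0, -P.v x, 0, 0;
     0, 0, 0, 0, 0;
     -P.cSq x / P.v x, 0, 0, P.v x * dS Z.p (P.q x), P.v x * dlam Z.p (P.q x);
     0, 0, 0, 0, 0;
     0, 0, 0, 0, 0]

/-- The zeroth order coefficient `B` of the linearized system. -/
def B (x : ℝ) : Matrix (Fin 5) (Fin 5) ℝ :=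
  !![-dx P.u x, dx P.v x, 0, 0, 0;
     P.along Z.p x - P.v x * dx (fun y => P.cSq y / P.v y ^ 2) x, dx P.u x, 0,
       P.v x * P.along (dS Z.p) x, P.v x * P.along (dlam Z.p) x;
     0, 0, 0, 0, 0;
     -dv Z.entropySource (P.q x), dx P.S x, 0,
       -dS Z.entropySource (P.q x), -dlam Z.entropySource (P.q x);
     -dv Z.r (P.q x), dx P.lam x, 0, -dS Z.r (P.q x), -dlam Z.r (P.q x)]

/-- A real matrix read as a complex one. -/
def cplx (M : Matrix (Fin 5) (Fin 5) ℝ) : Matrix (Fin 5) (Fin 5) ℂ :=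
  M.map (fun t : ℝ => (t : ℂ))

/-- `Φ₀(x, ζ) = (A_x⁻¹ (ζ I + i A_y))ᵗ`. -/
def Phi0 (x : ℝ) (ζ : ℂ) : Matrix (Fin 5) (Fin 5) ℂ :=
  ((cplx (P.Ax x))⁻¹ *
    (ζ • (1 : Matrix (Fin 5) (Fin 5) ℂ) + Complex.I • cplx (P.Ay x))).transpose

/-- `Φ₁(x) = (A_x⁻¹ B)ᵗ`. -/
def Phi1 (x : ℝ) : Matrix (Fin 5) (Fin 5) ℂ :=
  ((cplx (P.Ax x))⁻¹ * cplx (P.B x)).transpose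

/-- `s = √(ζ² + c₀² η)` for `Re ζ ≥ 0`: the branch with `s = |s|` where the radicand is positive,
analytic off the segment `[-i c₀ √η, i c₀ √η]`.  It is the principal root, except on the part
`ζ = -i|ζ|`, `ζ² + c₀² η < 0` of the imaginary axis, where `s = -i|s|`. -/
def s (x : ℝ) (ζ : ℂ) : ℂ :=
  open Classical in
  if ζ.re = 0 ∧ ζ.im < 0 ∧ (ζ ^ 2 + ((P.cSq x * P.eta x : ℝ) : ℂ)).re < 0 then
    -(ζ ^ 2 + ((P.cSq x * P.eta x : ℝ) : ℂ)) ^ (1 / 2 : ℂ)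
  else (ζ ^ 2 + ((P.cSq x * P.eta x : ℝ) : ℂ)) ^ (1 / 2 : ℂ)

/-- The eigenvector `T₁` of `Φ₀` for the eigenvalue `μ₁ = -κ (κ ζ + s) / (η u)`. -/
def T1 (x : ℝ) (ζ : ℂ) : C5 :=
  WithLp.toLp 2
    ![(P.massFlux x : ℂ) * P.s x ζ / ((P.kappa x : ℂ) * (P.u x : ℂ)),
      ζ / (P.u x : ℂ),
      -Complex.I,
      -((P.kappa x : ℂ) * (dS Z.p (P.q x) : ℂ) * P.s x ζ) / ((P.u x : ℂ) * (P.massFlux x : ℂ)),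
      -((P.kappa x : ℂ) * (dlam Z.p (P.q x) : ℂ) * P.s x ζ) / ((P.u x : ℂ) * (P.massFlux x : ℂ))]

/-- `θ` is a nontrivial solution on `[0, ∞)` of `h θ_x = (Φ₀(x, ζ) + h Φ₁(x)) θ`. -/
def IsSolution (ζ : ℂ) (h : ℝ) (θ : ℝ → C5) : Prop :=
  (∀ x, 0 ≤ x → HasDerivWithinAt θ
    (WithLp.toLp 2 ((((1 / h : ℝ) : ℂ) • P.Phi0 x ζ + P.Phi1 x).mulVec (θ x).ofLp)) (Ici 0) x) ∧
  ∃ x, 0 ≤ x ∧ θ x ≠ 0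

/-- A nontrivial solution that decays exponentially as `x → ∞`. -/
def DecaysExp (ζ : ℂ) (h : ℝ) (θ : ℝ → C5) : Prop :=
  P.IsSolution ζ h θ ∧
    ∃ C a : ℝ, 0 < a ∧ ∀ x, 0 ≤ x → ‖θ x‖ ≤ C * Real.exp (-a * x)

/-- `θ` is a decaying solution at `(ζ, h)`, `Re ζ ≥ 0`.  For `Re ζ > 0` it decays exponentially.
For `Re ζ = 0` it is bounded and is the limit of decaying solutions as `ζ` is approached from the
open right half-plane (on the axis boundedness alone can leave a space of solutions of dimension
more than one). -/
def IsDecaying (ζ : ℂ) (h : ℝ) (θ : ℝ → C5) : Prop :=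
  (0 < ζ.re ∧ P.DecaysExp ζ h θ) ∨
  (ζ.re = 0 ∧ P.IsSolution ζ h θ ∧ (∃ C : ℝ, ∀ x, 0 ≤ x → ‖θ x‖ ≤ C) ∧
    ∃ Θ : ℂ → ℝ → C5,
      (∀ᶠ z in 𝓝[{z : ℂ | 0 < z.re}] ζ, P.DecaysExp z h (Θ z)) ∧
      ∀ x, 0 ≤ x → Tendsto (fun z => Θ z x) (𝓝[{z : ℂ | 0 < z.re}] ζ) (𝓝 (θ x)))

end Profile

end ZND

end

/-! Put `ω = 1/ζ` and `ε = h/ζ`. For `|ζ| ≥ 1/ρ` and `0 < h ≤ 1` both lie in a small disc, and (1)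
becomes `θ' = (ε⁻¹ Φ₀/ζ + Φ₁) θ`, where `Φ₀/ζ` and its eigenvectors are analytic in the state and in
`ω`, up to and including `ω = 0`. Large `|ζ|` and small `h` are thus treated together as a singular
perturbation in `ε`, with constants coming from compactness: the closure of the trajectory in state
space is compact, and so is its product with the two discs.

The eigenvalues of `Φ₀/ζ` are one decaying acoustic one, one growing acoustic one and `1/u` three
times. The perturbation `Φ₁` does not tend to `0`; since `r`, `r_v`, `r_S` vanish at `λ = 0`, its
limit has only its last row nonzero. A shear, built from that row and composed with the left
eigenvectors, diagonalizes `Φ₀/h` plus this limit exactly (`symL_mul_system`). The last eigenvalue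
is shifted by the positive number `-r_λ/u` at the end state, and that positivity permits the
division by which the shear removes couplings inside the triple eigenvalue. The profile is an
integral curve of a vector field with factor `r`, and `r_λ < 0` makes `r` decay exponentially
(`exists_rate_decay`); hence what remains in the diagonalized system decays exponentially in `x`,
uniformly in `ω` and `ε`.

For a system `w' = ε⁻¹ diag(μ) w + R w` of this kind, `exists_dominant_solution` builds the solution
following the mode of least growth. After division by that mode's exponential, all remaining rates
have nonnegative real part, so an integral equation from `+∞` can be solved with a bound that does
not see the size of the rates (`exists_bounded_solution`). A first-order corrector, available
because the eigenvalue gaps are invertible, shows that the solution at `x = 0` is within `O(|ε|)` of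
a unit vector. Transforming back and multiplying by `ζ` gives `|θ(0) - T₁(0)| ≤ C h`, which is the
claim because `|T₁(0)| ≥ |ζ|/u(0)`.

That the acoustic mode really is the least growing one follows from `Re s ≥ Re ζ`
(`re_le_re_of_sq_eq`). For `Re ζ > 0` all other modes grow strictly, so bounded solutions form a
line (`exists_smul_of_bounded`). The construction is uniform and continuous in `ζ` on the closed
half-plane, so the solutions extend to `Re ζ = 0`, and both existence and uniqueness there are
obtained by passing to the limit. -/

noncomputable section

/-! ### Scalar equations integrated from infinity. -/

section Volterra

open MeasureTheory

variable {X : Type*} [TopologicalSpace X]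

/-- The bounded solution of the scalar equation `w' = lam w + f` when `0 ≤ lam.re`, extended to the
left of `0` by a constant. -/
def backwardSolution (lam f : ℝ → X → ℂ) (p : ℝ × X) : ℂ :=
  -∫ t in Ioi (0 : ℝ),
    Complex.exp (-∫ s in (max p.1 0)..(max p.1 0 + t), lam s p.2) * f (max p.1 0 + t) p.2

/-- The majorant of the kernel of `backwardSolution`. -/
def kernelMajorant (a g x t : ℝ) : ℝ :=
  Real.exp (g / a * (Real.exp (-a * (x + t)) - Real.exp (-a * x)))

lemma hasDerivAt_kernelMajorant {a g : ℝ} (ha : 0 < a) (x t : ℝ) :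
    HasDerivAt (fun t => -kernelMajorant a g x t)
      (kernelMajorant a g x t * (g * Real.exp (-a * (x + t)))) t := by
  have h1 : HasDerivAt (fun t : ℝ => -a * (x + t)) (-a) t := by
    simpa using ((hasDerivAt_id t).const_add x).const_mul (-a)
  have h2 := (((h1.exp.sub_const (Real.exp (-a * x))).const_mul (g / a)).exp).neg
  refine h2.congr_deriv ?_
  unfold kernelMajorant
  field_simp

lemma tendsto_kernelMajorant {a g : ℝ} (ha : 0 < a) (x : ℝ) :
    Tendsto (fun t => -kernelMajorant a g x t) atTop
      (𝓝 (-Real.exp (g / a * (0 - Real.exp (-a * x))))) := by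
  have h1 : Tendsto (fun t : ℝ => Real.exp (-a * (x + t))) atTop (𝓝 0) := by
    refine Real.tendsto_exp_atBot.comp ?_
    exact (tendsto_atTop_add_const_left _ x tendsto_id).const_mul_atTop_of_neg (by linarith)
  exact ((Real.continuous_exp.tendsto _).comp ((h1.sub_const _).const_mul _)).neg

lemma integrableOn_kernelMajorant {a g : ℝ} (ha : 0 < a) (hg : 0 ≤ g) (x : ℝ) :
    IntegrableOn (fun t => kernelMajorant a g x t * (g * Real.exp (-a * (x + t)))) (Ioi 0) := by
  refine integrableOn_Ioi_deriv_of_nonneg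
    (hasDerivAt_kernelMajorant ha x 0).continuousAt.continuousWithinAt
    (fun t _ => hasDerivAt_kernelMajorant ha x t) (fun t _ => ?_) (tendsto_kernelMajorant ha x)
  unfold kernelMajorant; positivity

/-- The integrand is an exact derivative: the damping rate in the kernel is the same function `g
e^{-ax}` that bounds the source. The bound is therefore `1` for every `g` and `a`, and the operator
norms below do not depend on them. -/
lemma integral_kernelMajorant_le {a g : ℝ} (ha : 0 < a) (hg : 0 ≤ g) (x : ℝ) :
    ∫ t in Ioi (0 : ℝ), kernelMajorant a g x t * (g * Real.exp (-a * (x + t))) ≤ 1 := by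
  rw [integral_Ioi_of_hasDerivAt_of_nonneg
    (hasDerivAt_kernelMajorant ha x 0).continuousAt.continuousWithinAt
    (fun t _ => hasDerivAt_kernelMajorant ha x t) (fun t _ => by unfold kernelMajorant; positivity)
    (tendsto_kernelMajorant ha x)]
  have : kernelMajorant a g x 0 = 1 := by simp [kernelMajorant]
  rw [this]
  have := Real.exp_pos (g / a * (0 - Real.exp (-a * x)))
  linarith

/-- Only a lower bound on the real part enters; the oscillation and the size of `l`, which blow up
like `1/ε` in the application, play no role. -/
lemma norm_exp_integral_le_kernelMajorant {a g : ℝ} (ha : 0 < a) {l : ℝ → ℂ} (hl : Continuous l)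
    (hre : ∀ x, 0 ≤ x → g * Real.exp (-a * x) ≤ (l x).re) {x t : ℝ} (hx : 0 ≤ x) (ht : 0 ≤ t) :
    ‖Complex.exp (-∫ s in x..(x + t), l s)‖ ≤ kernelMajorant a g x t := by
  rw [Complex.norm_exp, kernelMajorant]
  gcongr
  have hprim : ∀ s : ℝ, HasDerivAt (fun s => -(g / a) * Real.exp (-a * s))
      (g * Real.exp (-a * s)) s := fun s => by
    have h1 : HasDerivAt (fun t : ℝ => -a * t) (-a) s := by
      simpa using (hasDerivAt_id s).const_mul (-a)
    refine (h1.exp.const_mul _).congr_deriv ?_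
    field_simp
  have hint : ∫ s in x..(x + t), g * Real.exp (-a * s)
      = -(g / a) * Real.exp (-a * (x + t)) - -(g / a) * Real.exp (-a * x) :=
    intervalIntegral.integral_eq_sub_of_hasDerivAt (fun s _ => hprim s)
      (Continuous.intervalIntegrable (by fun_prop) _ _)
  have hre' : (∫ s in x..(x + t), l s).re = ∫ s in x..(x + t), (l s).re := by
    have := ContinuousLinearMap.intervalIntegral_comp_comm Complex.reCLM
      (hl.intervalIntegrable (μ := volume) x (x + t))
    simpa using this.symm
  have hmono : ∫ s in x..(x + t), g * Real.exp (-a * s) ≤ ∫ s in x..(x + t), (l s).re := by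
    refine intervalIntegral.integral_mono_on (by linarith)
      (Continuous.intervalIntegrable (by fun_prop) _ _)
      ((Complex.continuous_re.comp hl).intervalIntegrable _ _) fun s hs => hre s (hx.trans hs.1)
  rw [Complex.neg_re, hre']
  rw [hint] at hmono
  linarith

variable {a g b : ℝ} {lam f : ℝ → X → ℂ}

lemma norm_integrand_backwardSolution_le (ha : 0 < a) (hlam : Continuous (Function.uncurry lam))
    (hre : ∀ x π, 0 ≤ x → g * Real.exp (-a * x) ≤ (lam x π).re)
    (hfb : ∀ x π, 0 ≤ x → ‖f x π‖ ≤ b * (g * Real.exp (-a * x)))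
    {x t : ℝ} (hx : 0 ≤ x) (ht : 0 ≤ t) (π : X) :
    ‖Complex.exp (-∫ s in x..(x + t), lam s π) * f (x + t) π‖ ≤
      b * (kernelMajorant a g x t * (g * Real.exp (-a * (x + t)))) := by
  rw [norm_mul]
  have hl : Continuous fun s => lam s π := hlam.comp (by fun_prop : Continuous fun s => (s, π))
  have h1 := norm_exp_integral_le_kernelMajorant ha hl (fun x => hre x π) hx ht
  have h2 := hfb (x + t) π (by linarith)
  have h3 : 0 ≤ kernelMajorant a g x t := (norm_nonneg _).trans h1
  calc _ ≤ kernelMajorant a g x t * (b * (g * Real.exp (-a * (x + t)))) :=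
        mul_le_mul h1 h2 (norm_nonneg _) h3
    _ = _ := by ring

lemma norm_backwardSolution_le (ha : 0 < a) (hg : 0 ≤ g) (hb : 0 ≤ b)
    (hlam : Continuous (Function.uncurry lam))
    (hre : ∀ x π, 0 ≤ x → g * Real.exp (-a * x) ≤ (lam x π).re)
    (hfb : ∀ x π, 0 ≤ x → ‖f x π‖ ≤ b * (g * Real.exp (-a * x))) (p : ℝ × X) :
    ‖backwardSolution lam f p‖ ≤ b := by
  rw [backwardSolution, norm_neg]
  refine (norm_integral_le_of_norm_le
    ((integrableOn_kernelMajorant ha hg (max p.1 0)).const_mul b) ?_).trans ?_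
  · filter_upwards [ae_restrict_mem measurableSet_Ioi] with t ht
    exact norm_integrand_backwardSolution_le ha hlam hre hfb (le_max_right _ _) (le_of_lt ht) p.2
  · rw [integral_const_mul]
    have := integral_kernelMajorant_le ha hg (max p.1 0)
    nlinarith

lemma continuous_integral_uncurry (hlam : Continuous (Function.uncurry lam)) {Y : Type*}
    [TopologicalSpace Y] {c d : Y → ℝ} {q : Y → X} (hc : Continuous c) (hd : Continuous d)
    (hq : Continuous q) : Continuous fun y => ∫ s in (c y)..(d y), lam s (q y) := by
  have h0 : Continuous (Function.uncurry fun (y : Y) (s : ℝ) => lam s (q y)) :=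
    hlam.comp (by fun_prop : Continuous fun z : Y × ℝ => (z.2, q z.1))
  have hi : ∀ y α β, IntervalIntegrable (fun s => lam s (q y)) volume α β := fun y α β =>
    (hlam.comp (by fun_prop : Continuous fun s : ℝ => (s, q y))).intervalIntegrable _ _
  have h1 := intervalIntegral.continuous_parametric_intervalIntegral_of_continuous
    (μ := volume) (a₀ := 0) h0 hc
  have h2 := intervalIntegral.continuous_parametric_intervalIntegral_of_continuous
    (μ := volume) (a₀ := 0) h0 hd
  refine (h2.sub h1).congr fun y => ?_
  exact intervalIntegral.integral_interval_sub_left (hi _ _ _) (hi _ _ _)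

lemma continuous_backwardSolution [FirstCountableTopology X] (ha : 0 < a) (hg : 0 ≤ g) (hb : 0 ≤ b)
    (hlam : Continuous (Function.uncurry lam)) (hf : Continuous (Function.uncurry f))
    (hre : ∀ x π, 0 ≤ x → g * Real.exp (-a * x) ≤ (lam x π).re)
    (hfb : ∀ x π, 0 ≤ x → ‖f x π‖ ≤ b * (g * Real.exp (-a * x))) :
    Continuous (backwardSolution lam f) := by
  have hjoint : Continuous fun z : (ℝ × X) × ℝ =>
      Complex.exp (-∫ s in (max z.1.1 0)..(max z.1.1 0 + z.2), lam s z.1.2) *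
        f (max z.1.1 0 + z.2) z.1.2 := by
    refine (Complex.continuous_exp.comp
      (continuous_integral_uncurry hlam (by fun_prop) (by fun_prop) (by fun_prop)).neg).mul
      (hf.comp (by fun_prop : Continuous fun z : (ℝ × X) × ℝ => (max z.1.1 0 + z.2, z.1.2)))
  -- A majorant independent of the base point is needed here: the kernel is bounded by `1` and the
  -- shift by `max p.1 0 ≥ 0` only improves the decay of the source.
  refine (continuous_of_dominated (bound := fun t => b * (g * Real.exp (-a * t)))
    (fun p => ?_) (fun p => ?_) ?_ ?_).neg
  · exact (hjoint.comp (by fun_prop : Continuous fun t : ℝ => (p, t))).aestronglyMeasurable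
  · filter_upwards [ae_restrict_mem measurableSet_Ioi] with t ht
    have ht' : 0 ≤ t := le_of_lt ht
    have hx : 0 ≤ max p.1 0 := le_max_right _ _
    refine (norm_integrand_backwardSolution_le ha hlam hre hfb hx ht' p.2).trans ?_
    have hk : kernelMajorant a g (max p.1 0) t ≤ 1 := by
      refine Real.exp_le_one_iff.2 ?_
      refine mul_nonpos_of_nonneg_of_nonpos (by positivity) (sub_nonpos.2 ?_)
      exact Real.exp_le_exp.2 (by nlinarith)
    have he : Real.exp (-a * (max p.1 0 + t)) ≤ Real.exp (-a * t) :=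
      Real.exp_le_exp.2 (by nlinarith)
    have hk0 : 0 ≤ kernelMajorant a g (max p.1 0) t := (Real.exp_pos _).le
    refine mul_le_mul_of_nonneg_left ?_ hb
    calc _ ≤ 1 * (g * Real.exp (-a * t)) :=
          mul_le_mul hk (mul_le_mul_of_nonneg_left he hg) (by positivity) zero_le_one
      _ = _ := one_mul _
  · exact ((exp_neg_integrableOn_Ioi 0 ha).const_mul g).const_mul b
  · exact Eventually.of_forall fun t => hjoint.comp (by fun_prop : Continuous fun p => (p, t))

lemma hasDerivWithinAt_backwardSolution (ha : 0 < a) (hg : 0 ≤ g)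
    (hlam : Continuous (Function.uncurry lam)) (hf : Continuous (Function.uncurry f))
    (hre : ∀ x π, 0 ≤ x → g * Real.exp (-a * x) ≤ (lam x π).re)
    (hfb : ∀ x π, 0 ≤ x → ‖f x π‖ ≤ b * (g * Real.exp (-a * x))) {x : ℝ} (hx : 0 ≤ x) (π : X) :
    HasDerivWithinAt (fun y => backwardSolution lam f (y, π))
      (lam x π * backwardSolution lam f (x, π) + f x π) (Ici 0) x := by
  set A : ℝ → ℂ := fun y => ∫ s in (0 : ℝ)..y, lam s π with hA
  have hl : Continuous fun s => lam s π := hlam.comp (by fun_prop : Continuous fun s => (s, π))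
  have hfc : Continuous fun s => f s π := hf.comp (by fun_prop : Continuous fun s => (s, π))
  have hAd : ∀ y, HasDerivAt A (lam y π) y := fun y => by
    exact intervalIntegral.integral_hasDerivAt_right (hl.intervalIntegrable _ _)
      hl.stronglyMeasurable.stronglyMeasurableAtFilter hl.continuousAt
  have hAc : Continuous A := continuous_iff_continuousAt.2 fun y => (hAd y).continuousAt
  set φ : ℝ → ℂ := fun y => Complex.exp (-A y) * f y π with hφ
  have hφc : Continuous φ := by fun_prop
  have hsub : ∀ y t, ∫ s in y..(y + t), lam s π = A (y + t) - A y := fun y t =>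
    (intervalIntegral.integral_interval_sub_left (hl.intervalIntegrable _ _)
      (hl.intervalIntegrable _ _)).symm
  have hker : ∀ y t, Complex.exp (-∫ s in y..(y + t), lam s π) * f (y + t) π
      = Complex.exp (A y) * φ (y + t) := fun y t => by
    rw [hsub, hφ, ← mul_assoc, ← Complex.exp_add]; ring_nf
  have hφi : IntegrableOn φ (Ioi 0) := by
    have h1 := (integrableOn_kernelMajorant ha hg 0).const_mul b
    refine Integrable.mono' h1 hφc.aestronglyMeasurable ?_
    filter_upwards [ae_restrict_mem measurableSet_Ioi] with t ht
    have h2 := norm_integrand_backwardSolution_le ha hlam hre hfb le_rfl (le_of_lt ht) π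
    rw [hker 0 t] at h2
    have hA0 : A 0 = 0 := by simp [hA]
    simpa [hA0] using h2
  -- With a primitive `A` of `lam` the kernel factors, so the tail integral becomes a fixed integral
  -- minus one over `[0, y]`, which the fundamental theorem of calculus differentiates.
  have hform : ∀ y, 0 ≤ y → backwardSolution lam f (y, π)
      = -(Complex.exp (A y) * ((∫ t in Ioi (0 : ℝ), φ t) - ∫ t in (0 : ℝ)..y, φ t)) := by
    intro y hy
    simp only [backwardSolution, max_eq_left hy]
    simp_rw [hker]
    rw [integral_const_mul]
    have hshift : ∫ t in Ioi (0 : ℝ), φ (y + t) = ∫ t in Ioi y, φ t := by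
      have := (measurePreserving_add_left volume y).setIntegral_preimage_emb
        (measurableEmbedding_addLeft y) φ (Ioi y)
      rw [← this]
      congr 2
      ext t; simp
    rw [hshift, ← intervalIntegral.integral_interval_add_Ioi hφi
      (hφi.mono_set (Ioi_subset_Ioi hy))]
    ring_nf
  have hφd : HasDerivAt (fun y => ∫ t in (0 : ℝ)..y, φ t) (φ x) x :=
    intervalIntegral.integral_hasDerivAt_right (hφc.intervalIntegrable _ _)
      hφc.stronglyMeasurable.stronglyMeasurableAtFilter hφc.continuousAt
  have hd := (((hAd x).cexp).mul (hφd.const_sub (∫ t in Ioi (0 : ℝ), φ t))).neg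
  have hd' := hd.hasDerivWithinAt (s := Ici 0)
  refine (hd'.congr (fun y hy => hform y hy) (hform x hx)).congr_deriv ?_
  rw [hform x hx, hφ]
  have : Complex.exp (A x) * Complex.exp (-A x) = 1 := by
    rw [← Complex.exp_add]; simp
  linear_combination (f x π) * this

end Volterra

/-! ### Bounded solutions of systems by contraction. -/

section VolterraSystem

open MeasureTheory

variable {X : Type*} [TopologicalSpace X] {ι : Type*} [Fintype ι]

lemma integrable_backwardSolution {a g b : ℝ} {lam f : ℝ → X → ℂ} (ha : 0 < a) (hg : 0 ≤ g)
    (hlam : Continuous (Function.uncurry lam)) (hf : Continuous (Function.uncurry f))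
    (hre : ∀ x π, 0 ≤ x → g * Real.exp (-a * x) ≤ (lam x π).re)
    (hfb : ∀ x π, 0 ≤ x → ‖f x π‖ ≤ b * (g * Real.exp (-a * x))) (p : ℝ × X) :
    IntegrableOn (fun t => Complex.exp (-∫ s in (max p.1 0)..(max p.1 0 + t), lam s p.2) *
      f (max p.1 0 + t) p.2) (Ioi 0) := by
  refine Integrable.mono' ((integrableOn_kernelMajorant ha hg (max p.1 0)).const_mul b) ?_ ?_
  · refine Continuous.aestronglyMeasurable ?_
    exact (Complex.continuous_exp.comp (continuous_integral_uncurry hlam (by fun_prop)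
      (by fun_prop) (by fun_prop)).neg).mul
      (hf.comp (by fun_prop : Continuous fun t : ℝ => (max p.1 0 + t, p.2)))
  · filter_upwards [ae_restrict_mem measurableSet_Ioi] with t ht
    exact norm_integrand_backwardSolution_le ha hlam hre hfb (le_max_right _ _) (le_of_lt ht) p.2

lemma backwardSolution_sub {a g b c : ℝ} {lam f f' : ℝ → X → ℂ} (ha : 0 < a) (hg : 0 ≤ g)
    (hlam : Continuous (Function.uncurry lam)) (hf : Continuous (Function.uncurry f))
    (hf' : Continuous (Function.uncurry f'))
    (hre : ∀ x π, 0 ≤ x → g * Real.exp (-a * x) ≤ (lam x π).re)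
    (hfb : ∀ x π, 0 ≤ x → ‖f x π‖ ≤ b * (g * Real.exp (-a * x)))
    (hfb' : ∀ x π, 0 ≤ x → ‖f' x π‖ ≤ c * (g * Real.exp (-a * x))) (p : ℝ × X) :
    backwardSolution lam f p - backwardSolution lam f' p
      = backwardSolution lam (fun x π => f x π - f' x π) p := by
  simp only [backwardSolution, mul_sub]
  rw [integral_sub (integrable_backwardSolution ha hg hlam hf hre hfb p)
    (integrable_backwardSolution ha hg hlam hf' hre hfb' p)]
  ring

/-- The bounded solution of `w' = diag(lam) w + R w + ρ` when the real parts of the `lam i`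
dominate the perturbation. -/
theorem exists_bounded_solution_of_dominated [FirstCountableTopology X] {a g : ℝ} (ha : 0 < a)
    (hg : 0 ≤ g) {lam : ι → ℝ → X → ℂ} {R : ι → ι → ℝ → X → ℂ} {ρ : ι → ℝ → X → ℂ}
    (hlam : ∀ i, Continuous (Function.uncurry (lam i)))
    (hR : ∀ i j, Continuous (Function.uncurry (R i j)))
    (hρ : ∀ i, Continuous (Function.uncurry (ρ i)))
    (hre : ∀ i x π, 0 ≤ x → g * Real.exp (-a * x) ≤ (lam i x π).re)
    (hRb : ∀ i x π, 0 ≤ x → ∑ j, ‖R i j x π‖ ≤ 1 / 2 * (g * Real.exp (-a * x)))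
    (hρb : ∀ i x π, 0 ≤ x → ‖ρ i x π‖ ≤ 1 / 2 * (g * Real.exp (-a * x))) :
    ∃ w : ℝ × X → ι → ℂ, Continuous w ∧ (∀ p, ‖w p‖ ≤ 1) ∧
      ∀ i π x, 0 ≤ x → HasDerivWithinAt (fun y => w (y, π) i)
        (lam i x π * w (x, π) i + (∑ j, R i j x π * w (x, π) j + ρ i x π)) (Ici 0) x := by
  set F : BoundedContinuousFunction (ℝ × X) (ι → ℂ) → ι → ℝ → X → ℂ :=
    fun w i x π => ∑ j, R i j x π * w (x, π) j + ρ i x π with hF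
  have hFc : ∀ w i, Continuous (Function.uncurry (F w i)) := fun w i => by
    refine Continuous.add (continuous_finsetSum _ fun j _ => ?_) (hρ i)
    exact (hR i j).mul ((continuous_apply j).comp w.continuous)
  have hsum : ∀ (u : ι → ℂ) (i x π), 0 ≤ x →
      ‖∑ j, R i j x π * u j‖ ≤ ‖u‖ / 2 * (g * Real.exp (-a * x)) := by
    intro u i x π hx
    calc ‖∑ j, R i j x π * u j‖ ≤ ∑ j, ‖R i j x π‖ * ‖u‖ :=
          norm_sum_le_of_le _ fun j _ => by
            rw [norm_mul]
            exact mul_le_mul_of_nonneg_left (norm_le_pi_norm u j) (norm_nonneg _)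
      _ = (∑ j, ‖R i j x π‖) * ‖u‖ := by rw [Finset.sum_mul]
      _ ≤ (1 / 2 * (g * Real.exp (-a * x))) * ‖u‖ :=
          mul_le_mul_of_nonneg_right (hRb i x π hx) (norm_nonneg _)
      _ = _ := by ring
  have hFb : ∀ w i x π, 0 ≤ x → ‖F w i x π‖ ≤ ((‖w‖ + 1) / 2) * (g * Real.exp (-a * x)) := by
    intro w i x π hx
    refine (norm_add_le _ _).trans ?_
    have h1 := hsum (w (x, π)) i x π hx
    have h2 := hρb i x π hx
    have h3 := w.norm_coe_le_norm (x, π)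
    have h4 : 0 ≤ g * Real.exp (-a * x) := by positivity
    nlinarith
  have hb : ∀ w : BoundedContinuousFunction (ℝ × X) (ι → ℂ), 0 ≤ (‖w‖ + 1) / 2 := fun w => by
    positivity
  have hTb : ∀ w p, ‖(fun i => backwardSolution (lam i) (F w i) p)‖ ≤ (‖w‖ + 1) / 2 := fun w p =>
    (pi_norm_le_iff_of_nonneg (hb w)).2 fun i =>
      norm_backwardSolution_le ha hg (hb w) (hlam i) (hre i) (hFb w i) p
  -- The fixed point is taken among bounded continuous functions of position and parameter jointly,
  -- so continuity in the parameter comes with existence.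
  let T : BoundedContinuousFunction (ℝ × X) (ι → ℂ) → BoundedContinuousFunction (ℝ × X) (ι → ℂ) :=
    fun w => BoundedContinuousFunction.ofNormedAddCommGroup
      (fun p i => backwardSolution (lam i) (F w i) p)
      (continuous_pi fun i => continuous_backwardSolution ha hg (hb w) (hlam i) (hFc w i) (hre i)
        (hFb w i)) ((‖w‖ + 1) / 2) (hTb w)
  have hT : ContractingWith (1 / 2) T := by
    refine ⟨by norm_num [← NNReal.coe_lt_coe], LipschitzWith.of_dist_le_mul fun w w' => ?_⟩
    refine (BoundedContinuousFunction.dist_le (by positivity)).2 fun p => ?_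
    rw [dist_eq_norm]
    refine (pi_norm_le_iff_of_nonneg (by positivity)).2 fun i => ?_
    change ‖backwardSolution (lam i) (F w i) p - backwardSolution (lam i) (F w' i) p‖ ≤ _
    rw [backwardSolution_sub ha hg (hlam i) (hFc w i) (hFc w' i) (hre i) (hFb w i) (hFb w' i)]
    refine norm_backwardSolution_le ha hg (by positivity) (hlam i) (hre i) (fun x π hx => ?_) p
    have : F w i x π - F w' i x π = ∑ j, R i j x π * (w - w') (x, π) j := by
      simp only [hF, add_sub_add_right_eq_sub, ← Finset.sum_sub_distrib, ← mul_sub]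
      rfl
    rw [this]
    refine (hsum _ i x π hx).trans ?_
    have h3 := (w - w').norm_coe_le_norm (x, π)
    rw [dist_eq_norm]
    refine mul_le_mul_of_nonneg_right ?_ (by positivity)
    push_cast; linarith
  obtain ⟨w, hw⟩ : ∃ w, T w = w := ⟨_, hT.fixedPoint_isFixedPt⟩
  have hwi : ∀ p i, w p i = backwardSolution (lam i) (F w i) p := fun p i =>
    congrFun (congrArg (fun v : BoundedContinuousFunction (ℝ × X) (ι → ℂ) => v p) hw.symm) i
  refine ⟨w, w.continuous, fun p => ?_, fun i π x hx => ?_⟩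
  -- Half of the bound comes from `R` and half from `ρ`, so the norm of a fixed point is at most
  -- `1`.
  · have h1 : ‖w‖ ≤ (‖w‖ + 1) / 2 := by
      conv_lhs => rw [← hw]
      exact (BoundedContinuousFunction.norm_le (hb w)).2 fun p => hTb w p
    exact (w.norm_coe_le_norm p).trans (by linarith)
  · have h := hasDerivWithinAt_backwardSolution ha hg (hlam i) (hFc w i) (hre i) (hFb w i) hx π
    have heq : (fun y => w (y, π) i) = fun y => backwardSolution (lam i) (F w i) (y, π) :=
      funext fun y => hwi (y, π) i
    rw [heq, hwi (x, π) i]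
    exact h

/-- The bounded solution of `w' = diag(lam) w + R w + ρ` when the `lam i` have nonnegative real
parts and the perturbation decays exponentially; the bound does not depend on `lam`. -/
theorem exists_bounded_solution [FirstCountableTopology X] {a C : ℝ} (ha : 0 < a) (hC : 0 ≤ C)
    {lam : ι → ℝ → X → ℂ} {R : ι → ι → ℝ → X → ℂ} {ρ : ι → ℝ → X → ℂ}
    (hlam : ∀ i, Continuous (Function.uncurry (lam i)))
    (hR : ∀ i j, Continuous (Function.uncurry (R i j)))
    (hρ : ∀ i, Continuous (Function.uncurry (ρ i)))
    (hre : ∀ i x π, 0 ≤ x → 0 ≤ (lam i x π).re)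
    (hRb : ∀ i j x π, 0 ≤ x → ‖R i j x π‖ ≤ C * Real.exp (-a * x))
    (hρb : ∀ i x π, 0 ≤ x → ‖ρ i x π‖ ≤ C * Real.exp (-a * x)) :
    ∃ w : ℝ × X → ι → ℂ, Continuous w ∧
      (∀ x π, 0 ≤ x → ‖w (x, π)‖ ≤ Real.exp (2 * (Fintype.card ι + 1) * C / a)) ∧
      ∀ i π x, 0 ≤ x → HasDerivWithinAt (fun y => w (y, π) i)
        (lam i x π * w (x, π) i + (∑ j, R i j x π * w (x, π) j + ρ i x π)) (Ici 0) x := by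
  -- The weight `e^G` with `G' = -g e^{-ax}` trades boundedness for damping: the function divided by
  -- `e^G` has rates increased by `g e^{-ax}`, so they dominate `R` and `ρ`. The factor `2 (card +
  -- 1)` makes each row sum of `R`, and `ρ`, at most half of this increase. As `0 ≤ G ≤ g / a`,
  -- undoing the weight costs at most `e^{g/a}`.
  set g : ℝ := 2 * (Fintype.card ι + 1) * C with hg
  have hg0 : 0 ≤ g := by positivity
  set G : ℝ → ℝ := fun x => g / a * Real.exp (-a * x) with hG
  have hG0 : ∀ x, 0 ≤ G x := fun x => by positivity
  have hGc : Continuous G := by fun_prop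
  have hGd : ∀ x, HasDerivAt G (-(g * Real.exp (-a * x))) x := fun x => by
    have h1 : HasDerivAt (fun t : ℝ => -a * t) (-a) x := by
      simpa using (hasDerivAt_id x).const_mul (-a)
    refine (h1.exp.const_mul _).congr_deriv ?_
    field_simp
  obtain ⟨w, hwc, hw1, hwd⟩ := exists_bounded_solution_of_dominated ha hg0
    (lam := fun i x π => lam i x π + (g * Real.exp (-a * x) : ℝ)) (R := R)
    (ρ := fun i x π => ρ i x π * (Real.exp (-G x) : ℝ)) (X := X)
    (fun i => (hlam i).add (Complex.continuous_ofReal.comp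
      (by fun_prop : Continuous fun p : ℝ × X => g * Real.exp (-a * p.1)))) hR
    (fun i => (hρ i).mul (Complex.continuous_ofReal.comp
      (by fun_prop : Continuous fun p : ℝ × X => Real.exp (-G p.1))))
    (fun i x π hx => by
      simp only [Complex.add_re, Complex.ofReal_re]
      linarith [hre i x π hx])
    (fun i x π hx => by
      refine (Finset.sum_le_sum fun j _ => hRb i j x π hx).trans ?_
      have : 0 ≤ C * Real.exp (-a * x) := by positivity
      simp only [Finset.sum_const, Finset.card_univ, nsmul_eq_mul, hg]
      nlinarith)
    (fun i x π hx => by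
      have h1 : Real.exp (-G x) ≤ 1 := Real.exp_le_one_iff.2 (by linarith [hG0 x])
      have h2 := hρb i x π hx
      have h3 : 0 ≤ C * Real.exp (-a * x) := by positivity
      have h4 : (0 : ℝ) ≤ Fintype.card ι := Nat.cast_nonneg _
      rw [norm_mul, Complex.norm_real, Real.norm_of_nonneg (Real.exp_pos _).le]
      calc ‖ρ i x π‖ * Real.exp (-G x) ≤ ‖ρ i x π‖ * 1 :=
            mul_le_mul_of_nonneg_left h1 (norm_nonneg _)
        _ ≤ _ := by rw [hg]; nlinarith [mul_nonneg h4 h3])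
  refine ⟨fun p => ((Real.exp (G p.1) : ℝ) : ℂ) • w p, ?_, fun x π hx => ?_, fun i π x hx => ?_⟩
  · exact (Complex.continuous_ofReal.comp (by fun_prop)).smul hwc
  · rw [norm_smul, Complex.norm_real, Real.norm_of_nonneg (Real.exp_pos _).le]
    have h1 : G x ≤ g / a := by
      have : Real.exp (-a * x) ≤ 1 := Real.exp_le_one_iff.2 (by nlinarith)
      calc G x ≤ g / a * 1 := mul_le_mul_of_nonneg_left this (by positivity)
        _ = _ := mul_one _
    calc _ ≤ Real.exp (g / a) * 1 :=
          mul_le_mul (Real.exp_le_exp.2 h1) (hw1 _) (norm_nonneg _) (Real.exp_pos _).le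
      _ = _ := mul_one _
  · have h1 : HasDerivWithinAt (fun y => ((Real.exp (G y) : ℝ) : ℂ))
        ((Real.exp (G x) * -(g * Real.exp (-a * x)) : ℝ) : ℂ) (Ici 0) x :=
      (hGd x).exp.ofReal_comp.hasDerivWithinAt
    refine (h1.mul (hwd i π x hx)).congr_deriv ?_
    have h2 : ((Real.exp (G x) : ℝ) : ℂ) * ((Real.exp (-G x) : ℝ) : ℂ) = 1 := by
      rw [← Complex.ofReal_mul, ← Real.exp_add]; simp
    have h3 : ∑ j, R i j x π * (((Real.exp (G x) : ℝ) : ℂ) * w (x, π) j)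
        = ((Real.exp (G x) : ℝ) : ℂ) * ∑ j, R i j x π * w (x, π) j := by
      rw [Finset.mul_sum]
      exact Finset.sum_congr rfl fun j _ => by ring
    simp only [Pi.smul_apply, smul_eq_mul]
    rw [h3]
    push_cast at h2 ⊢
    linear_combination (ρ i x π) * h2

end VolterraSystem

/-! ### Uniqueness of bounded solutions. -/

section Uniqueness

open MeasureTheory

/-- The bound does not depend on `y`, so it survives `y → ∞`; this is how an exponentially small
derivative is turned into decay towards a limit. -/
lemma norm_sub_le_of_norm_deriv_le_exp {E : Type*} [NormedAddCommGroup E] [NormedSpace ℝ E]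
    {F F' : ℝ → E} {a c x y : ℝ} (ha : 0 < a) (hc : 0 ≤ c) (hx : 0 ≤ x) (hxy : x ≤ y)
    (hF : ∀ t ∈ Icc x y, HasDerivWithinAt F (F' t) (Ici 0) t)
    (hF' : ∀ t ∈ Icc x y, ‖F' t‖ ≤ c * Real.exp (-a * t)) :
    ‖F y - F x‖ ≤ c / a * Real.exp (-a * x) := by
  have hd : ∀ t : ℝ, HasDerivAt (fun t => c / a * (Real.exp (-a * x) - Real.exp (-a * t)))
      (c * Real.exp (-a * t)) t := fun t => by
    have h1 : HasDerivAt (fun t : ℝ => -a * t) (-a) t := by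
      simpa using (hasDerivAt_id t).const_mul (-a)
    refine ((h1.exp.const_sub _).const_mul _).congr_deriv ?_
    field_simp
  have h := image_norm_le_of_norm_deriv_right_le_deriv_boundary (f := fun t => F t - F x)
    (a := x) (b := y) (f' := F')
    (fun t ht => ((hF t ht).continuousWithinAt.mono
      (fun s hs => hx.trans hs.1)).sub continuousWithinAt_const)
    (fun t ht => ((hF t ⟨ht.1, ht.2.le⟩).mono (Ici_subset_Ici.2 (hx.trans ht.1))).sub_const _)
    (by simp) hd (fun t ht => hF' t ⟨ht.1, ht.2.le⟩) ⟨hxy, le_rfl⟩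
  refine h.trans (mul_le_mul_of_nonneg_left ?_ (by positivity))
  linarith [Real.exp_pos (-a * y)]

lemma norm_exp_sub_primitive {l : ℝ → ℂ} (hl : Continuous l) (x y : ℝ) :
    ‖Complex.exp ((∫ s in (0 : ℝ)..x, l s) - ∫ s in (0 : ℝ)..y, l s)‖
      = Real.exp (-∫ s in x..y, (l s).re) := by
  rw [Complex.norm_exp, intervalIntegral.integral_interval_sub_left (hl.intervalIntegrable _ _)
    (hl.intervalIntegrable _ _), intervalIntegral.integral_symm]
  have := ContinuousLinearMap.intervalIntegral_comp_comm Complex.reCLM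
    (hl.intervalIntegrable (μ := volume) x y)
  simp only [Complex.reCLM_apply] at this
  rw [this, Complex.neg_re]

lemma hasDerivWithinAt_exp_primitive_mul {l : ℝ → ℂ} (hl : Continuous l) {f : ℝ → ℂ} {g : ℂ}
    {t : ℝ} (hf : HasDerivWithinAt f (l t * f t + g) (Ici 0) t) (c : ℂ) :
    HasDerivWithinAt (fun s => Complex.exp (c - ∫ r in (0 : ℝ)..s, l r) * f s)
      (Complex.exp (c - ∫ r in (0 : ℝ)..t, l r) * g) (Ici 0) t := by
  have hA : HasDerivAt (fun s => ∫ r in (0 : ℝ)..s, l r) (l t) t :=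
    intervalIntegral.integral_hasDerivAt_right (hl.intervalIntegrable _ _)
      hl.stronglyMeasurable.stronglyMeasurableAtFilter hl.continuousAt
  refine (((hA.const_sub c).cexp.hasDerivWithinAt (s := Ici 0)).mul hf).congr_deriv ?_
  ring

variable {ι : Type*} [Fintype ι]

/-- A bounded solution of `w' = diag(lam) w + R w`, with one nonincreasing mode `i₀` and all other
modes growing, vanishes if its component `i₀` vanishes at a point beyond which the total size of
the perturbation `R` is small. -/
theorem eq_zero_of_bounded_of_component_eq_zero {a C δ x₀ M : ℝ} (ha : 0 < a) (hC : 0 ≤ C)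
    (hδ : 0 < δ) (hx₀ : 0 ≤ x₀)
    (hsmall : Fintype.card ι * C / a * Real.exp (-a * x₀) ≤ 1 / 2) {i₀ : ι}
    {lam : ι → ℝ → ℂ} {R : ι → ι → ℝ → ℂ} (hlam : ∀ i, Continuous (lam i))
    (hre₀ : ∀ x, 0 ≤ x → (lam i₀ x).re ≤ 0)
    (hre : ∀ i, i ≠ i₀ → ∀ x, 0 ≤ x → δ ≤ (lam i x).re)
    (hR : ∀ i j x, 0 ≤ x → ‖R i j x‖ ≤ C * Real.exp (-a * x)) {w : ℝ → ι → ℂ}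
    (hw : ∀ i x, 0 ≤ x → HasDerivWithinAt (fun y => w y i)
      (lam i x * w x i + ∑ j, R i j x * w x j) (Ici 0) x)
    (hM : ∀ x, 0 ≤ x → ‖w x‖ ≤ M) (hzero : w x₀ i₀ = 0) :
    ∀ x, 0 ≤ x → w x = 0 := by
  have hsum : ∀ S, (∀ x, x₀ ≤ x → ‖w x‖ ≤ S) → ∀ i x, x₀ ≤ x →
      ‖∑ j, R i j x * w x j‖ ≤ (Fintype.card ι * C * S) * Real.exp (-a * x) := by
    intro S hS i x hx
    have hx0 : 0 ≤ x := hx₀.trans hx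
    calc ‖∑ j, R i j x * w x j‖ ≤ ∑ _j : ι, (C * Real.exp (-a * x)) * S :=
          norm_sum_le_of_le _ fun j _ => by
            rw [norm_mul]
            exact mul_le_mul (hR i j x hx0) ((norm_le_pi_norm _ _).trans (hS x hx))
              (norm_nonneg _) (by positivity)
      _ = _ := by simp only [Finset.sum_const, Finset.card_univ, nsmul_eq_mul]; ring
  -- By variation of constants, any bound beyond `x₀` improves by a factor `2`, because the integral
  -- of the perturbation beyond `x₀` is at most `1/2`; iteration gives zero.
  have hhalf : ∀ S, 0 ≤ S → (∀ x, x₀ ≤ x → ‖w x‖ ≤ S) → ∀ x, x₀ ≤ x → ‖w x‖ ≤ S / 2 := by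
    intro S hS0 hS x hx
    have hx0 : 0 ≤ x := hx₀.trans hx
    refine (pi_norm_le_iff_of_nonneg (by linarith)).2 fun i => ?_
    have hbound : ∀ y, x₀ ≤ y →
        (Fintype.card ι * C * S) / a * Real.exp (-a * y) ≤ S / 2 := by
      intro y hy
      have h1 : Real.exp (-a * y) ≤ Real.exp (-a * x₀) := Real.exp_le_exp.2 (by nlinarith)
      calc _ ≤ (Fintype.card ι * C * S) / a * Real.exp (-a * x₀) :=
            mul_le_mul_of_nonneg_left h1 (by positivity)
        _ = (Fintype.card ι * C / a * Real.exp (-a * x₀)) * S := by ring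
        _ ≤ 1 / 2 * S := mul_le_mul_of_nonneg_right hsmall hS0
        _ = _ := by ring
    set A : ℝ → ℂ := fun s => ∫ r in (0 : ℝ)..s, lam i r with hA
    by_cases hi : i = i₀
    -- The nonincreasing mode is integrated forward from `x₀`, where it vanishes.
    · have h := norm_sub_le_of_norm_deriv_le_exp ha (c := Fintype.card ι * C * S) (by positivity)
        hx₀ hx (fun t ht => hasDerivWithinAt_exp_primitive_mul (hlam i)
          (hw i t (hx₀.trans ht.1)) (A x)) (fun t ht => by
          rw [norm_mul, norm_exp_sub_primitive (hlam i), intervalIntegral.integral_symm, neg_neg]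
          refine (mul_le_of_le_one_left (norm_nonneg _) ?_).trans (hsum S hS i t ht.1)
          refine Real.exp_le_one_iff.2 ?_
          have := intervalIntegral.integral_mono_on (μ := volume) ht.2
            ((Complex.continuous_re.comp (hlam i)).intervalIntegrable _ _)
            (continuous_const.intervalIntegrable _ _)
            (fun s hs => hi ▸ hre₀ s ((hx₀.trans ht.1).trans hs.1))
          simpa using this)
      have e1 : Complex.exp (A x - ∫ r in (0 : ℝ)..x, lam i r) = 1 := by simp [hA]
      rw [e1, hi, hzero, mul_zero, sub_zero, one_mul] at h
      rw [hi]
      exact h.trans (hbound x₀ le_rfl)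
    -- A growing mode is integrated backward from `y`; boundedness of `w` kills the boundary term as
    -- `y → ∞`, and this is where the strict growth `δ > 0` is needed.
    · have hexp : ∀ y, x ≤ y → Real.exp (-∫ s in x..y, (lam i s).re)
          ≤ Real.exp (-(δ * (y - x))) := fun y hy => by
        have := intervalIntegral.integral_mono_on (μ := volume) hy
          (continuous_const.intervalIntegrable _ _)
          ((Complex.continuous_re.comp (hlam i)).intervalIntegrable _ _)
          (fun s hs => hre i hi s (hx0.trans hs.1))
        simp only [intervalIntegral.integral_const, smul_eq_mul] at this
        refine Real.exp_le_exp.2 (neg_le_neg ?_)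
        simpa [mul_comm] using this
      have h : ∀ y, x ≤ y → ‖w x i‖ ≤ S / 2 + Real.exp (-(δ * (y - x))) * S := by
        intro y hy
        have h := norm_sub_le_of_norm_deriv_le_exp ha (c := Fintype.card ι * C * S)
          (by positivity) hx0 hy (fun t ht => hasDerivWithinAt_exp_primitive_mul (hlam i)
            (hw i t (hx0.trans ht.1)) (A x)) (fun t ht => by
            rw [norm_mul, norm_exp_sub_primitive (hlam i)]
            refine (mul_le_of_le_one_left (norm_nonneg _) ?_).trans
              (hsum S hS i t (hx.trans ht.1))
            refine (hexp t ht.1).trans (Real.exp_le_one_iff.2 ?_)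
            have : 0 ≤ t - x := sub_nonneg.2 ht.1
            nlinarith)
        have e1 : Complex.exp (A x - ∫ r in (0 : ℝ)..x, lam i r) = 1 := by simp [hA]
        rw [e1, one_mul] at h
        have h2 : ‖Complex.exp (A x - ∫ r in (0 : ℝ)..y, lam i r) * w y i‖
            ≤ Real.exp (-(δ * (y - x))) * S := by
          rw [norm_mul, norm_exp_sub_primitive (hlam i)]
          exact mul_le_mul (hexp y hy) ((norm_le_pi_norm _ _).trans (hS y (hx.trans hy)))
            (norm_nonneg _) (Real.exp_pos _).le
        have h3 := norm_sub_norm_le (w x i)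
          (Complex.exp (A x - ∫ r in (0 : ℝ)..y, lam i r) * w y i)
        rw [norm_sub_rev] at h3
        linarith [hbound x hx]
      have hlim : Tendsto (fun y => S / 2 + Real.exp (-(δ * (y - x))) * S) atTop
          (𝓝 (S / 2 + 0 * S)) := by
        refine (Tendsto.mul_const _ (Real.tendsto_exp_atBot.comp ?_)).const_add _
        refine tendsto_neg_atTop_atBot.comp ?_
        exact (tendsto_atTop_add_const_right _ (-x) tendsto_id).const_mul_atTop hδ
      have := ge_of_tendsto hlim (eventually_atTop.2 ⟨x, h⟩)
      linarith
  have hM0 : 0 ≤ M := (norm_nonneg _).trans (hM x₀ hx₀)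
  have hpow : ∀ n : ℕ, ∀ x, x₀ ≤ x → ‖w x‖ ≤ M * (1 / 2) ^ n := by
    intro n
    induction n with
    | zero => intro x hx; simpa using hM x (hx₀.trans hx)
    | succ n ih =>
      intro x hx
      have := hhalf _ (by positivity) ih x hx
      rw [pow_succ]; linarith
  have hfar : ∀ x, x₀ ≤ x → w x = 0 := by
    intro x hx
    have hlim : Tendsto (fun n : ℕ => M * (1 / 2 : ℝ) ^ n) atTop (𝓝 (M * 0)) :=
      (tendsto_pow_atTop_nhds_zero_of_lt_one (by norm_num) (by norm_num)).const_mul M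
    have := ge_of_tendsto' hlim fun n => hpow n x hx
    rw [mul_zero] at this
    exact norm_le_zero_iff.1 this
  obtain ⟨K₁, hK₁⟩ : ∃ K, ∀ i, ∀ t ∈ Icc 0 x₀, ‖lam i t‖ ≤ K := by
    obtain ⟨K, hK⟩ := (isCompact_Icc (a := (0 : ℝ)) (b := x₀)).exists_bound_of_continuousOn
      (f := fun t i => lam i t) (continuous_pi hlam).continuousOn
    exact ⟨K, fun i t ht => (norm_le_pi_norm (fun i => lam i t) i).trans (hK t ht)⟩
  set K : ℝ := |K₁| + Fintype.card ι * C with hK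
  have hlip : ∀ t ∈ Ioc 0 x₀, LipschitzOnWith K.toNNReal
      (fun y : ι → ℂ => fun i => lam i t * y i + ∑ j, R i j t * y j) univ := by
    intro t ht
    refine LipschitzOnWith.of_dist_le_mul fun y _ y' _ => ?_
    have hK0 : 0 ≤ K := by positivity
    rw [Real.coe_toNNReal _ hK0, dist_eq_norm, dist_eq_norm]
    refine (pi_norm_le_iff_of_nonneg (by positivity)).2 fun i => ?_
    have e : (lam i t * y i + ∑ j, R i j t * y j) - (lam i t * y' i + ∑ j, R i j t * y' j)
        = lam i t * (y - y') i + ∑ j, R i j t * (y - y') j := by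
      simp only [Pi.sub_apply, mul_sub, Finset.sum_sub_distrib]; ring
    have h1 : ‖lam i t * (y - y') i‖ ≤ |K₁| * ‖y - y'‖ := by
      rw [norm_mul]
      exact mul_le_mul ((hK₁ i t ⟨ht.1.le, ht.2⟩).trans (le_abs_self _)) (norm_le_pi_norm _ _)
        (norm_nonneg _) (abs_nonneg _)
    have h2 : ‖∑ j, R i j t * (y - y') j‖ ≤ Fintype.card ι * C * ‖y - y'‖ := by
      calc _ ≤ ∑ _j : ι, C * ‖y - y'‖ := norm_sum_le_of_le _ fun j _ => by
            rw [norm_mul]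
            refine mul_le_mul ((hR i j t ht.1.le).trans ?_) (norm_le_pi_norm _ _)
              (norm_nonneg _) hC
            exact mul_le_of_le_one_right hC (Real.exp_le_one_iff.2 (by nlinarith [ht.1]))
        _ = _ := by simp only [Finset.sum_const, Finset.card_univ, nsmul_eq_mul]; ring
    simp only [Pi.sub_apply]
    rw [e, hK, add_mul]
    exact (norm_add_le _ _).trans (add_le_add h1 h2)
  have hwd : ∀ x, 0 ≤ x → HasDerivWithinAt w
      (fun i => lam i x * w x i + ∑ j, R i j x * w x j) (Ici 0) x := fun x hx =>
    hasDerivWithinAt_pi.2 fun i => hw i x hx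
  -- Zero at `x₀` propagates back to `[0, x₀]` by uniqueness for linear equations with bounded
  -- coefficients.
  have hnear := ODE_solution_unique_of_mem_Icc_left (g := fun _ => (0 : ι → ℂ)) hlip
    (fun t ht => (hwd t ht.1).continuousWithinAt.mono fun s hs => hs.1)
    (fun t ht => ((hwd t ht.1.le).hasDerivAt (Ici_mem_nhds ht.1)).hasDerivWithinAt)
    (fun _ _ => mem_univ _) continuousOn_const
    (fun t _ => by
      refine (hasDerivWithinAt_const t _ (0 : ι → ℂ)).congr_deriv ?_
      ext i; simp) (fun _ _ => mem_univ _) (hfar x₀ le_rfl)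
  intro x hx
  rcases le_total x x₀ with h | h
  · exact hnear ⟨hx, h⟩
  · exact hfar x h

end Uniqueness

/-! ### The profile as an integral curve, and its exponential convergence. -/

namespace ZND

lemma fderiv_apply_eq (f : State → ℝ) (q d : State) :
    fderiv ℝ f q d = dv f q * d.1 + dS f q * d.2.1 + dlam f q * d.2.2 := by
  have : d = d.1 • ((1, 0, 0) : State) + d.2.1 • ((0, 1, 0) : State)
      + d.2.2 • ((0, 0, 1) : State) := by
    ext <;> simp
  conv_lhs => rw [this]
  simp only [map_add, map_smul, smul_eq_mul, dv, dS, dlam]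
  ring

namespace Model

variable {Z : Model} {k : State}

lemma contDiffAt_p (hk : k ∈ Z.dom) : ContDiffAt ℝ ⊤ Z.p k := (Z.analytic_p k hk).contDiffAt
lemma contDiffAt_r (hk : k ∈ Z.dom) : ContDiffAt ℝ ⊤ Z.r k := (Z.analytic_r k hk).contDiffAt

lemma contDiffAt_fderiv_apply {f : State → ℝ} (hf : ContDiffAt ℝ ⊤ f k) (e : State) :
    ContDiffAt ℝ ⊤ (fun q => fderiv ℝ f q e) k :=
  (hf.fderiv_right (by simp)).clm_apply contDiffAt_const

lemma contDiffAt_entropySource (hk : k ∈ Z.dom) : ContDiffAt ℝ ⊤ Z.entropySource k :=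
  ((((Z.analytic_r k hk).contDiffAt).neg).mul (Z.analytic_dF k hk).contDiffAt).div
    (Z.analytic_T k hk).contDiffAt (Z.T_pos k hk).ne'

lemma contDiffAt_soundSq (hk : k ∈ Z.dom) : ContDiffAt ℝ ⊤ Z.soundSq k :=
  ((contDiffAt_fst.pow 2).neg).mul (contDiffAt_fderiv_apply (contDiffAt_p hk) _)

/-- In the product rule for `-r · (ΔF / T)` the term differentiating `ΔF / T` carries the factor `r
= 0`. Hence the source inherits vanishing `v` and `S` derivatives from `r`. -/
lemma hasFDerivAt_entropySource_zero (v S : ℝ) (hk : (v, S, (0 : ℝ)) ∈ Z.dom) :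
    fderiv ℝ Z.entropySource (v, S, 0)
      = (-Z.dF (v, S, 0) / Z.T (v, S, 0)) • fderiv ℝ Z.r (v, S, 0) := by
  have hr := ((contDiffAt_r hk).differentiableAt (by simp)).hasFDerivAt
  have hF := (((Z.analytic_dF _ hk).differentiableAt).mul
    ((Z.analytic_T _ hk).differentiableAt.inv (Z.T_pos _ hk).ne')).hasFDerivAt
  have h := hr.neg.mul hF
  have e : Z.entropySource = fun q => (-Z.r q) * ((Z.dF * Z.T⁻¹) q) := by
    ext q; simp [entropySource, div_eq_mul_inv, mul_assoc]
  rw [e]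
  refine h.fderiv.trans ?_
  have h0 : (-Z.r) (v, S, (0 : ℝ)) = 0 := by simp [Z.r_zero v S hk]
  rw [h0, zero_smul, zero_add, smul_neg, ← neg_smul]
  simp only [Pi.mul_apply, Pi.inv_apply, div_eq_mul_inv, neg_mul]

end Model

namespace Profile

variable {Z : Model} (P : Profile Z)

lemma hasDerivWithinAt_dx {f : ℝ → ℝ} (hf : AnalyticOn ℝ f (Ici 0)) {x : ℝ} (hx : 0 ≤ x) :
    HasDerivWithinAt f (dx f x) (Ici 0) x :=
  (hf.differentiableOn x hx).hasDerivWithinAt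

lemma dx_eq {f : ℝ → ℝ} {f' x : ℝ} (hx : 0 ≤ x) (hf : HasDerivWithinAt f f' (Ici 0) x) :
    dx f x = f' :=
  hf.derivWithin (uniqueDiffOn_Ici 0 x hx)

lemma u_pos {x : ℝ} (hx : 0 ≤ x) : 0 < P.u x := by
  obtain ⟨C₃, C₄, h₃, h⟩ := P.u_bounds
  exact h₃.trans_le (h x hx).1

/-- The mass flux, which is constant along the profile. -/
def flux : ℝ := P.massFlux 0

lemma flux_pos : 0 < P.flux := div_pos (P.u_pos le_rfl) (P.v_pos 0 le_rfl)

/-- Conservation of mass says `(u / v)' = 0`. It makes `u` a function of the state, so that all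
coefficients of the system become functions on state space. -/
lemma u_eq {x : ℝ} (hx : 0 ≤ x) : P.u x = P.flux * P.v x := by
  have hd : ∀ y, 0 ≤ y → HasDerivWithinAt (fun t => P.u t / P.v t) 0 (Ici 0) y := fun y hy => by
    refine ((hasDerivWithinAt_dx P.analytic_u hy).div (hasDerivWithinAt_dx P.analytic_v hy)
      (P.v_pos y hy).ne').congr_deriv ?_
    rw [div_eq_zero_iff]; left; linarith [P.mass y hy]
  have h := constant_of_has_deriv_right_zero (f := fun t => P.u t / P.v t) (a := 0) (b := x)
    (fun t ht => (hd t ht.1).continuousWithinAt.mono fun s hs => hs.1)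
    (fun t ht => (hd t ht.1).mono (Ici_subset_Ici.2 ht.1)) x ⟨hx, le_rfl⟩
  have hv := (P.v_pos x hx).ne'
  rw [flux, massFlux, ← h]
  field_simp

lemma continuousOn_q : ContinuousOn P.q (Ici 0) :=
  P.analytic_v.continuousOn.prodMk (P.analytic_S.continuousOn.prodMk P.analytic_lam.continuousOn)

/-- The end state. -/
def qInf : State := (P.vInf, P.SInf, 0)

/-- The closure of the trajectory of the profile in state space. -/
def states : Set State := insert P.qInf (P.q '' Ici 0)

lemma q_mem_states {x : ℝ} (hx : 0 ≤ x) : P.q x ∈ P.states := Or.inr ⟨x, hx, rfl⟩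

lemma qInf_mem_states : P.qInf ∈ P.states := Or.inl rfl

lemma tendsto_q : Tendsto P.q atTop (𝓝 P.qInf) := P.tendsto_inf

lemma isCompact_states : IsCompact P.states := by
  -- The even extension is continuous on the whole line with the same limit at both ends, so it
  -- extends continuously to the one-point compactification.
  have hc : Continuous fun x : ℝ => P.q |x| :=
    P.continuousOn_q.comp_continuous continuous_abs fun x => abs_nonneg x
  have ht : Tendsto (fun x : ℝ => P.q |x|) (cocompact ℝ) (𝓝 P.qInf) := by
    rw [cocompact_eq_atBot_atTop]
    exact P.tendsto_q.comp (tendsto_sup.2 ⟨tendsto_abs_atBot_atTop, tendsto_abs_atTop_atTop⟩)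
  have h := ht.isCompact_insert_range_of_cocompact hc
  have e : range (fun x : ℝ => P.q |x|) = P.q '' Ici 0 := by
    ext k
    constructor
    · rintro ⟨x, rfl⟩; exact ⟨|x|, abs_nonneg x, rfl⟩
    · rintro ⟨x, hx, rfl⟩; exact ⟨x, by simp [abs_of_nonneg (mem_Ici.1 hx)]⟩
  rwa [e] at h

/-- A property closed under limits holds on the closure of the trajectory if it holds on it. -/
lemma le_on_states {f g : State → ℝ} (hf : ContinuousAt f P.qInf) (hg : ContinuousAt g P.qInf)
    (h : ∀ x, 0 ≤ x → f (P.q x) ≤ g (P.q x)) {k : State} (hk : k ∈ P.states) : f k ≤ g k := by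
  rcases hk with rfl | ⟨x, hx, rfl⟩
  · exact le_of_tendsto_of_tendsto (hf.tendsto.comp P.tendsto_q) (hg.tendsto.comp P.tendsto_q)
      ((eventually_ge_atTop 0).mono h)
  · exact h x hx

lemma states_subset_dom : P.states ⊆ Z.dom := by
  rintro k (rfl | ⟨x, hx, rfl⟩)
  · exact P.inf_mem_dom
  · exact P.mem_dom x hx

/-- Uniform bounds on the closure of the trajectory: `v` is bounded below and the flow is uniformly
subsonic. -/
lemma exists_uniform_bounds : ∃ v₀ c : ℝ, 0 < v₀ ∧ 0 < c ∧ c < 1 ∧ ∀ k ∈ P.states,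
    v₀ ≤ k.1 ∧ (P.flux * k.1) ^ 2 ≤ c ^ 2 * Z.soundSq k := by
  obtain ⟨C₁, C₂, h₁, h₂, hs⟩ := P.subsonic
  obtain ⟨C₃, C₄, h₃, hu⟩ := P.u_bounds
  have hm := P.flux_pos
  refine ⟨C₃ / P.flux, C₂, by positivity, ?_, h₂, fun k hk => ⟨?_, ?_⟩⟩
  · exact h₁.trans_le ((hs 0 le_rfl).1.trans (hs 0 le_rfl).2)
  · refine P.le_on_states (f := fun _ => C₃ / P.flux) (g := fun k => k.1) continuousAt_const
      continuousAt_fst (fun x hx => ?_) hk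
    rw [div_le_iff₀' hm]
    exact (hu x hx).1.trans (P.u_eq hx).le
  · refine P.le_on_states (f := fun k => (P.flux * k.1) ^ 2) (g := fun k => C₂ ^ 2 * Z.soundSq k)
      (by fun_prop) (((Model.contDiffAt_soundSq P.inf_mem_dom).continuousAt).const_mul _)
      (fun x hx => ?_) hk
    obtain ⟨hl, hr⟩ := hs x hx
    -- If the sound speed were `0` then `κ` would be `0` by the convention for division by zero,
    -- contradicting the positive lower bound on `κ`.
    have hpos : 0 < Z.sound (P.q x) := by
      by_contra hneg
      have h0 : Z.sound (P.q x) = 0 := le_antisymm (not_lt.1 hneg) (Real.sqrt_nonneg _)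
      have : P.u x / Z.sound (P.v x, P.S x, P.lam x) = 0 := by
        change P.u x / Z.sound (P.q x) = 0
        rw [h0, div_zero]
      linarith
    have hle : P.u x ≤ C₂ * Z.sound (P.q x) := (div_le_iff₀ hpos).1 hr
    have hsq : Z.sound (P.q x) ^ 2 = Z.soundSq (P.q x) :=
      Real.sq_sqrt (Real.sqrt_pos.1 hpos).le
    rw [← hsq, ← mul_pow]
    refine pow_le_pow_left₀ (by have := P.v_pos x hx; simp only [q]; positivity) ?_ 2
    rw [← show P.u x = P.flux * (P.q x).1 from P.u_eq hx]
    exact hle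

lemma v_pos_of_mem {k : State} (hk : k ∈ P.states) : 0 < k.1 := by
  obtain ⟨v₀, c, h₀, hc, hc1, h⟩ := P.exists_uniform_bounds
  exact h₀.trans_le (h k hk).1

lemma soundSq_pos_of_mem {k : State} (hk : k ∈ P.states) : 0 < Z.soundSq k := by
  obtain ⟨v₀, c, h₀, hc, hc1, h⟩ := P.exists_uniform_bounds
  have h1 := (h k hk).2
  have h2 : 0 < (P.flux * k.1) ^ 2 := by
    have := P.flux_pos; have := P.v_pos_of_mem hk; positivity
  by_contra hneg
  nlinarith [sq_nonneg c]

lemma sq_flux_mul_lt_soundSq {k : State} (hk : k ∈ P.states) :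
    (P.flux * k.1) ^ 2 < Z.soundSq k := by
  obtain ⟨v₀, c, h₀, hc, hc1, h⟩ := P.exists_uniform_bounds
  have h1 := (h k hk).2
  have h2 := P.soundSq_pos_of_mem hk
  have h3 : c ^ 2 < 1 := pow_lt_one₀ hc.le hc1 two_ne_zero
  nlinarith

lemma sound_pos_of_mem {k : State} (hk : k ∈ P.states) : 0 < Z.sound k :=
  Real.sqrt_pos.2 (P.soundSq_pos_of_mem hk)

lemma sq_sound_of_mem {k : State} (hk : k ∈ P.states) : Z.sound k ^ 2 = Z.soundSq k :=
  Real.sq_sqrt (P.soundSq_pos_of_mem hk).le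

lemma flux_mul_lt_sound {k : State} (hk : k ∈ P.states) : P.flux * k.1 < Z.sound k :=
  Real.lt_sqrt_of_sq_lt (P.sq_flux_mul_lt_soundSq hk)

/-- The vector field on state space whose integral curve is the profile, divided by the rate. -/
def fieldFactor (k : State) : State :=
  (k.1 ^ 2 * (dS Z.p k * (-Z.dF k / Z.T k / (P.flux * k.1)) + dlam Z.p k * (1 / (P.flux * k.1)))
      / (Z.soundSq k - (P.flux * k.1) ^ 2),
    -Z.dF k / Z.T k / (P.flux * k.1), 1 / (P.flux * k.1))

/-- The vector field on state space whose integral curve is the profile. -/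
def field (k : State) : State := Z.r k • P.fieldFactor k

lemma contDiffAt_fieldFactor {k : State} (hk : k ∈ P.states) :
    ContDiffAt ℝ ⊤ P.fieldFactor k := by
  have hd := P.states_subset_dom hk
  have hv : P.flux * k.1 ≠ 0 := (mul_pos P.flux_pos (P.v_pos_of_mem hk)).ne'
  have hV : ContDiffAt ℝ ⊤ (fun k : State => P.flux * k.1) k := contDiffAt_const.mul contDiffAt_fst
  have hT : ContDiffAt ℝ ⊤ (fun k => -Z.dF k / Z.T k / (P.flux * k.1)) k :=
    (((Z.analytic_dF k hd).contDiffAt.neg).div (Z.analytic_T k hd).contDiffAt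
      (Z.T_pos k hd).ne').div hV hv
  have h1 : ContDiffAt ℝ ⊤ (fun k : State => 1 / (P.flux * k.1)) k := contDiffAt_const.div hV hv
  have hp := Model.contDiffAt_p hd
  refine ContDiffAt.prodMk ?_ (hT.prodMk h1)
  refine ContDiffAt.div ((contDiffAt_fst.pow 2).mul
    (((Model.contDiffAt_fderiv_apply hp _).mul hT).add
    ((Model.contDiffAt_fderiv_apply hp _).mul h1)))
    ((Model.contDiffAt_soundSq hd).sub (hV.pow 2)) ?_
  have := P.sq_flux_mul_lt_soundSq hk
  exact (sub_pos.2 this).ne'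

lemma contDiffAt_field {k : State} (hk : k ∈ P.states) : ContDiffAt ℝ ⊤ P.field k :=
  (Model.contDiffAt_r (P.states_subset_dom hk)).smul (P.contDiffAt_fieldFactor hk)

lemma hasDerivWithinAt_comp_q_dx {f : State → ℝ} {x : ℝ} (hx : 0 ≤ x)
    (hf : DifferentiableAt ℝ f (P.q x)) :
    HasDerivWithinAt (fun y => f (P.q y))
      (fderiv ℝ f (P.q x) (dx P.v x, dx P.S x, dx P.lam x)) (Ici 0) x :=
  hf.hasFDerivAt.comp_hasDerivWithinAt x ((hasDerivWithinAt_dx P.analytic_v hx).prodMk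
    ((hasDerivWithinAt_dx P.analytic_S hx).prodMk (hasDerivWithinAt_dx P.analytic_lam hx)))

/-- With `u = m v` the momentum equation reads `(c₀² - u²) v' = v² (p_S S' + p_λ λ')`, which
subsonicity allows to be solved for `v'`. All three derivatives then carry the factor `r`. -/
lemma field_q {x : ℝ} (hx : 0 ≤ x) : (dx P.v x, dx P.S x, dx P.lam x) = P.field (P.q x) := by
  have hk := P.q_mem_states hx
  have hm := P.flux_pos
  have hv := P.v_pos x hx
  have hu : P.u x = P.flux * P.v x := P.u_eq hx
  have hS : dx P.S x = Z.r (P.q x) * (-Z.dF (P.q x) / Z.T (P.q x) / (P.flux * P.v x)) := by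
    have h := P.entropy x hx
    change P.u x * dx P.S x = Z.entropySource (P.q x) at h
    rw [hu] at h
    rw [Model.entropySource] at h
    field_simp at h ⊢
    linear_combination h
  have hl : dx P.lam x = Z.r (P.q x) * (1 / (P.flux * P.v x)) := by
    have h := P.reaction x hx
    change P.u x * dx P.lam x = Z.r (P.q x) at h
    rw [hu] at h
    field_simp
    linear_combination h
  have hp : dx (fun y => Z.p (P.v y, P.S y, P.lam y)) x
      = dv Z.p (P.q x) * dx P.v x + dS Z.p (P.q x) * dx P.S x + dlam Z.p (P.q x) * dx P.lam x :=
    (dx_eq hx (P.hasDerivWithinAt_comp_q_dx hx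
      ((Model.contDiffAt_p (P.states_subset_dom hk)).differentiableAt (by simp)))).trans
      (fderiv_apply_eq _ _ _)
  have hdv : dx P.v x = Z.r (P.q x) * (P.fieldFactor (P.q x)).1 := by
    have h := P.momentum x hx
    have hmass := P.mass x hx
    have hpos := P.sq_flux_mul_lt_soundSq hk
    change (P.flux * P.v x) ^ 2 < _ at hpos
    have hdu : dx P.u x = P.flux * dx P.v x := by
      rw [hu] at hmass
      have : P.v x * (P.flux * dx P.v x - dx P.u x) = 0 := by linear_combination hmass
      rcases mul_eq_zero.1 this with h0 | h0
      · exact absurd h0 hv.ne'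
      · linarith
    rw [hp, hdu, hu] at h
    have hne : Z.soundSq (P.q x) - (P.flux * P.v x) ^ 2 ≠ 0 := (sub_pos.2 hpos).ne'
    change _ = Z.r (P.q x) * (P.v x ^ 2 *
      (dS Z.p (P.q x) * (-Z.dF (P.q x) / Z.T (P.q x) / (P.flux * P.v x))
        + dlam Z.p (P.q x) * (1 / (P.flux * P.v x)))
      / (Z.soundSq (P.q x) - (P.flux * P.v x) ^ 2))
    have hsq : Z.soundSq (P.q x) = -P.v x ^ 2 * dv Z.p (P.q x) := rfl
    rw [← mul_div_assoc, eq_div_iff hne]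
    calc _ = P.v x ^ 2 * (dS Z.p (P.q x) * dx P.S x + dlam Z.p (P.q x) * dx P.lam x) := by
          rw [hsq]; linear_combination (-P.v x) * h
      _ = _ := by rw [hS, hl]; ring
  refine Prod.ext hdv (Prod.ext hS hl)

lemma hasDerivWithinAt_comp_q {f : State → ℝ} {x : ℝ} (hx : 0 ≤ x)
    (hf : DifferentiableAt ℝ f (P.q x)) :
    HasDerivWithinAt (fun y => f (P.q y)) (fderiv ℝ f (P.q x) (P.field (P.q x))) (Ici 0) x := by
  rw [← P.field_q hx]
  exact P.hasDerivWithinAt_comp_q_dx hx hf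

lemma hasDerivWithinAt_q {x : ℝ} (hx : 0 ≤ x) :
    HasDerivWithinAt P.q (P.field (P.q x)) (Ici 0) x := by
  rw [← P.field_q hx]
  exact (hasDerivWithinAt_dx P.analytic_v hx).prodMk
    ((hasDerivWithinAt_dx P.analytic_S hx).prodMk (hasDerivWithinAt_dx P.analytic_lam hx))

/-- The linearization of the rate at the end state controls the rate along the profile. -/
lemma eventually_rate : ∃ b : ℝ, 0 < b ∧ ∀ᶠ x in atTop,
    |Z.r (P.q x)| ≤ 3 * b * |P.lam x| ∧ P.lam x * Z.r (P.q x) ≤ -b * P.lam x ^ 2 := by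
  set d : ℝ := dlam Z.r P.qInf with hd
  have hneg : d < 0 := Z.dlam_r_neg _ _ P.inf_mem_dom
  have hst : HasStrictFDerivAt Z.r (fderiv ℝ Z.r P.qInf) P.qInf :=
    (Model.contDiffAt_r P.inf_mem_dom).hasStrictFDerivAt (by simp)
  have hb : 0 < -d / 2 := by linarith
  have h1 := hst.isLittleO.def hb
  -- Strict differentiability at the end state allows comparing `q x` with its projection onto `λ =
  -- 0`, where `r` vanishes, instead of with the end state; the increment then involves `λ` alone.
  have hq0 : Tendsto (fun x => ((P.v x, P.S x, (0 : ℝ)) : State)) atTop (𝓝 P.qInf) := by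
    have hcont : Continuous fun k : State => ((k.1, k.2.1, (0 : ℝ)) : State) := by fun_prop
    exact (hcont.tendsto P.qInf).comp P.tendsto_q
  have h2 := (P.tendsto_q.prodMk_nhds hq0).eventually h1
  have h3 := hq0.eventually (Z.isOpen_dom.mem_nhds P.inf_mem_dom)
  -- With an error of at most `|d|/2 · |λ|`, the rate lies between half and three halves of its
  -- linear part `|d| |λ|`.
  refine ⟨-d / 2, hb, ?_⟩
  filter_upwards [h2, h3] with x hx2 hx3
  have e1 : P.q x - ((P.v x, P.S x, (0 : ℝ)) : State) = (0, 0, P.lam x) := by simp [q]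
  have e2 : fderiv ℝ Z.r P.qInf (0, 0, P.lam x) = d * P.lam x := by
    rw [fderiv_apply_eq]; simp [hd]
  have e3 : ‖((0, 0, P.lam x) : State)‖ = |P.lam x| := by
    simp [Prod.norm_def]
  simp only [e1, e2, e3, Z.r_zero _ _ hx3, sub_zero, Real.norm_eq_abs] at hx2
  constructor
  · have : |Z.r (P.q x)| ≤ |d * P.lam x| + |Z.r (P.q x) - d * P.lam x| := by
      have := abs_add_le (d * P.lam x) (Z.r (P.q x) - d * P.lam x)
      simpa using this
    rw [abs_mul, abs_of_neg hneg] at this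
    linarith
  · have h4 : |P.lam x * (Z.r (P.q x) - d * P.lam x)| ≤ |P.lam x| * (-d / 2 * |P.lam x|) := by
      rw [abs_mul]; exact mul_le_mul_of_nonneg_left hx2 (abs_nonneg _)
    have h5 := (le_abs_self _).trans h4
    have h6 := sq_abs (P.lam x)
    nlinarith

/-- The rate decays exponentially along the profile. -/
lemma exists_rate_decay : ∃ a C : ℝ, 0 < a ∧ 0 ≤ C ∧
    ∀ x, 0 ≤ x → |Z.r (P.q x)| ≤ C * Real.exp (-a * x) := by
  obtain ⟨b, hb, hev⟩ := P.eventually_rate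
  obtain ⟨X₀, hX₀⟩ := eventually_atTop.1 hev
  obtain ⟨C₃, C₄, h₃, hu⟩ := P.u_bounds
  have h₄ : 0 < C₄ := h₃.trans_le ((hu 0 le_rfl).1.trans (hu 0 le_rfl).2)
  set X₁ := max X₀ 0
  set a : ℝ := b / C₄ with ha
  have ha0 : 0 < a := by positivity
  have hdl : ∀ x, 0 ≤ x → HasDerivWithinAt P.lam (Z.r (P.q x) / P.u x) (Ici 0) x := fun x hx => by
    refine (hasDerivWithinAt_dx P.analytic_lam hx).congr_deriv ?_
    rw [eq_div_iff (P.u_pos hx).ne', mul_comm]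
    exact P.reaction x hx
  -- A Lyapunov argument: `(λ²)' = 2 λ r / u ≤ -2 (b / C₄) λ²`, since `u ≤ C₄`.
  have hanti : AntitoneOn (fun x => P.lam x ^ 2 * Real.exp (2 * a * x)) (Ici X₁) := by
    have hder : ∀ x ∈ Ici X₁, HasDerivWithinAt (fun x => P.lam x ^ 2 * Real.exp (2 * a * x))
        ((2 * P.lam x * (Z.r (P.q x) / P.u x) + 2 * a * P.lam x ^ 2) * Real.exp (2 * a * x))
        (Ici X₁) x := fun x hx => by
      have hx0 : 0 ≤ x := (le_max_right _ _).trans hx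
      have h1 : HasDerivAt (fun t : ℝ => 2 * a * t) (2 * a) x := by
        simpa using (hasDerivAt_id x).const_mul (2 * a)
      refine ((((hdl x hx0).pow 2).mul h1.exp.hasDerivWithinAt).mono
        (Ici_subset_Ici.2 (le_max_right _ _))).congr_deriv ?_
      simp only [Nat.cast_ofNat, Nat.add_one_sub_one, pow_one, Pi.pow_apply]
      ring
    refine antitoneOn_of_deriv_nonpos (convex_Ici _)
      (fun x hx => (hder x hx).continuousWithinAt) (fun x hx => ?_) (fun x hx => ?_)
    · rw [interior_Ici] at hx
      exact (hder x (mem_Ici.2 (le_of_lt hx))).differentiableWithinAt.mono interior_subset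
    · rw [interior_Ici] at hx
      rw [((hder x (mem_Ici.2 (le_of_lt hx))).hasDerivAt (Ici_mem_nhds hx)).deriv]
      refine mul_nonpos_of_nonpos_of_nonneg ?_ (Real.exp_pos _).le
      have hx0 : 0 ≤ x := (le_max_right _ _).trans (le_of_lt hx)
      have hr := (hX₀ x ((le_max_left _ _).trans (le_of_lt hx))).2
      have hux := P.u_pos hx0
      have hle : a * P.u x ≤ b := by
        rw [ha, div_mul_eq_mul_div, div_le_iff₀ h₄]
        exact mul_le_mul_of_nonneg_left (hu x hx0).2 hb.le
      have e : 2 * P.lam x * (Z.r (P.q x) / P.u x) + 2 * a * P.lam x ^ 2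
          = 2 * (P.lam x * Z.r (P.q x) + a * P.u x * P.lam x ^ 2) / P.u x := by
        field_simp
      rw [e]
      refine div_nonpos_of_nonpos_of_nonneg ?_ hux.le
      nlinarith [sq_nonneg (P.lam x)]
  set D : ℝ := |P.lam X₁| * Real.exp (a * X₁) with hD
  have hlam : ∀ x, X₁ ≤ x → |P.lam x| ≤ D * Real.exp (-a * x) := by
    intro x hx
    have h := hanti self_mem_Ici (mem_Ici.2 hx) hx
    have e : ∀ y, P.lam y ^ 2 * Real.exp (2 * a * y) = (|P.lam y| * Real.exp (a * y)) ^ 2 := by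
      intro y
      rw [mul_pow, sq_abs, ← Real.exp_nat_mul]; push_cast; ring_nf
    simp only [e] at h
    have h' := (sq_le_sq₀ (by positivity) (by positivity)).1 h
    calc |P.lam x| = (|P.lam x| * Real.exp (a * x)) * Real.exp (-a * x) := by
          rw [mul_assoc, ← Real.exp_add]; simp
      _ ≤ _ := mul_le_mul_of_nonneg_right h' (Real.exp_pos _).le
  have hrc : ContinuousOn (fun x => Z.r (P.q x)) (Ici 0) := fun x hx =>
    (P.hasDerivWithinAt_comp_q hx ((Model.contDiffAt_r (P.states_subset_dom
      (P.q_mem_states hx))).differentiableAt (by simp))).continuousWithinAt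
  obtain ⟨B, hB⟩ := (isCompact_Icc (a := (0 : ℝ)) (b := X₁)).exists_bound_of_continuousOn
    (hrc.mono fun x hx => hx.1)
  refine ⟨a, max (3 * b * D) (|B| * Real.exp (a * X₁)), ha0, by positivity, fun x hx => ?_⟩
  rcases le_total X₁ x with h | h
  · refine (hX₀ x ((le_max_left _ _).trans h)).1.trans ?_
    calc 3 * b * |P.lam x| ≤ 3 * b * (D * Real.exp (-a * x)) :=
          mul_le_mul_of_nonneg_left (hlam x h) (by positivity)
      _ = (3 * b * D) * Real.exp (-a * x) := by ring
      _ ≤ _ := mul_le_mul_of_nonneg_right (le_max_left _ _) (Real.exp_pos _).le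
  · have h1 : |Z.r (P.q x)| ≤ |B| := (hB x ⟨hx, h⟩).trans (le_abs_self _)
    have h2 : 1 ≤ Real.exp (a * X₁) * Real.exp (-a * x) := by
      rw [← Real.exp_add]; exact Real.one_le_exp (by nlinarith)
    calc |Z.r (P.q x)| ≤ |B| * (Real.exp (a * X₁) * Real.exp (-a * x)) := by
          nlinarith [abs_nonneg B]
      _ = (|B| * Real.exp (a * X₁)) * Real.exp (-a * x) := by ring
      _ ≤ _ := mul_le_mul_of_nonneg_right (le_max_right _ _) (Real.exp_pos _).le

/-- The vector field decays exponentially along the profile. -/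
lemma exists_field_decay : ∃ a C : ℝ, 0 < a ∧ 0 ≤ C ∧
    ∀ x, 0 ≤ x → ‖P.field (P.q x)‖ ≤ C * Real.exp (-a * x) := by
  obtain ⟨a, C, ha, hC, h⟩ := P.exists_rate_decay
  obtain ⟨B, hB⟩ := P.isCompact_states.exists_bound_of_continuousOn
    (f := P.fieldFactor) fun k hk => (P.contDiffAt_fieldFactor hk).continuousAt.continuousWithinAt
  refine ⟨a, C * |B|, ha, by positivity, fun x hx => ?_⟩
  rw [field, norm_smul, Real.norm_eq_abs]
  calc _ ≤ (C * Real.exp (-a * x)) * |B| :=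
        mul_le_mul (h x hx) ((hB _ (P.q_mem_states hx)).trans (le_abs_self _)) (norm_nonneg _)
          (by positivity)
    _ = _ := by ring

end Profile

end ZND

/-! ### Symbols in `(state, ω, ε)` and the solution following the least growing mode. -/

namespace ZND

namespace Profile

variable {Z : Model} (P : Profile Z)

/-- The exponential rate at which the profile approaches its end state. -/
def decayRate : ℝ := P.exists_field_decay.choose

lemma decayRate_pos : 0 < P.decayRate := P.exists_field_decay.choose_spec.choose_spec.1

/-- Points `(k, ω, ε)` with `k` in the closure of the trajectory and `ω`, `ε` small. -/
def paramSet (ρ : ℝ) : Set (State × ℂ × ℂ) :=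
  P.states ×ˢ (Metric.closedBall (0 : ℂ) ρ ×ˢ Metric.closedBall (0 : ℂ) ρ)

lemma isCompact_paramSet (ρ : ℝ) : IsCompact (P.paramSet ρ) :=
  P.isCompact_states.prod ((isCompact_closedBall _ _).prod (isCompact_closedBall _ _))

lemma mem_paramSet {ρ : ℝ} {k : State} {ω ε : ℂ} (hk : k ∈ P.states) (hω : ‖ω‖ ≤ ρ)
    (hε : ‖ε‖ ≤ ρ) : (k, ω, ε) ∈ P.paramSet ρ :=
  ⟨hk, by simpa using hω, by simpa using hε⟩

/-- Functions of the state and of the two small parameters that are real analytic near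
`paramSet`. -/
def IsSymbol (ρ : ℝ) (f : State × ℂ × ℂ → ℂ) : Prop :=
  ∀ k ∈ P.paramSet ρ, ContDiffAt ℝ ⊤ f k

/-- Derivative along the profile of a symbol. -/
def transport (f : State × ℂ × ℂ → ℂ) (k : State × ℂ × ℂ) : ℂ :=
  fderiv ℝ f k (P.field k.1, 0, 0)

/-- Exponential decay along the profile, uniformly in the parameters. -/
def DecaysAlong (ρ : ℝ) (f : State × ℂ × ℂ → ℂ) : Prop :=
  ∃ C, 0 ≤ C ∧ ∀ x ω ε, 0 ≤ x → ‖ω‖ ≤ ρ → ‖ε‖ ≤ ρ →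
    ‖f (P.q x, ω, ε)‖ ≤ C * Real.exp (-P.decayRate * x)

variable {P} {ρ : ℝ} {f g : State × ℂ × ℂ → ℂ}

namespace IsSymbol

lemma const (c : ℂ) : P.IsSymbol ρ fun _ => c := fun _ _ => contDiffAt_const
lemma add (hf : P.IsSymbol ρ f) (hg : P.IsSymbol ρ g) : P.IsSymbol ρ fun k => f k + g k :=
  fun k hk => (hf k hk).add (hg k hk)
lemma sub (hf : P.IsSymbol ρ f) (hg : P.IsSymbol ρ g) : P.IsSymbol ρ fun k => f k - g k :=
  fun k hk => (hf k hk).sub (hg k hk)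
lemma neg (hf : P.IsSymbol ρ f) : P.IsSymbol ρ fun k => -f k := fun k hk => (hf k hk).neg
lemma mul (hf : P.IsSymbol ρ f) (hg : P.IsSymbol ρ g) : P.IsSymbol ρ fun k => f k * g k :=
  fun k hk => (hf k hk).mul (hg k hk)
lemma div (hf : P.IsSymbol ρ f) (hg : P.IsSymbol ρ g) (h0 : ∀ k ∈ P.paramSet ρ, g k ≠ 0) :
    P.IsSymbol ρ fun k => f k / g k := by
  intro k hk
  simp only [div_eq_mul_inv]
  exact (hf k hk).mul ((hg k hk).inv (h0 k hk))
lemma pow (hf : P.IsSymbol ρ f) (n : ℕ) : P.IsSymbol ρ fun k => f k ^ n :=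
  fun k hk => (hf k hk).pow n
lemma sum {ι : Type*} {s : Finset ι} {F : ι → State × ℂ × ℂ → ℂ}
    (h : ∀ i ∈ s, P.IsSymbol ρ (F i)) : P.IsSymbol ρ fun k => ∑ i ∈ s, F i k :=
  fun k hk => ContDiffAt.sum fun i hi => h i hi k hk

lemma ofReal {f : State → ℝ} (hf : ∀ k ∈ P.states, ContDiffAt ℝ ⊤ f k) :
    P.IsSymbol ρ fun k => (f k.1 : ℂ) := fun k hk =>
  Complex.ofRealCLM.contDiff.contDiffAt.comp k ((hf k.1 hk.1).comp k contDiffAt_fst)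

lemma param₁ : P.IsSymbol ρ fun k => k.2.1 := fun k _ =>
  (contDiffAt_fst (𝕜 := ℝ)).comp k contDiffAt_snd
lemma param₂ : P.IsSymbol ρ fun k => k.2.2 := fun k _ =>
  (contDiffAt_snd (𝕜 := ℝ)).comp k contDiffAt_snd

lemma transport (hf : P.IsSymbol ρ f) : P.IsSymbol ρ (P.transport f) := fun k hk =>
  ((hf k hk).fderiv_right (by simp)).clm_apply
    (((P.contDiffAt_field hk.1).comp k contDiffAt_fst).prodMk contDiffAt_const)

lemma exists_bound (hf : P.IsSymbol ρ f) : ∃ C, 0 ≤ C ∧ ∀ k ∈ P.paramSet ρ, ‖f k‖ ≤ C := by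
  obtain ⟨C, hC⟩ := (P.isCompact_paramSet ρ).exists_bound_of_continuousOn
    fun k hk => (hf k hk).continuousAt.continuousWithinAt
  exact ⟨|C|, abs_nonneg C, fun k hk => (hC k hk).trans (le_abs_self C)⟩

lemma hasDerivWithinAt (hf : P.IsSymbol ρ f) {x : ℝ} {ω ε : ℂ} (hx : 0 ≤ x) (hω : ‖ω‖ ≤ ρ)
    (hε : ‖ε‖ ≤ ρ) : HasDerivWithinAt (fun y => f (P.q y, ω, ε))
      (P.transport f (P.q x, ω, ε)) (Ici 0) x := by
  have h1 := ((hf _ (P.mem_paramSet (P.q_mem_states hx) hω hε)).differentiableAt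
    (by simp)).hasFDerivAt
  exact h1.comp_hasDerivWithinAt x ((P.hasDerivWithinAt_q hx).prodMk
    ((hasDerivWithinAt_const x _ ω).prodMk (hasDerivWithinAt_const x _ ε)))

/-- The differential of `f` is bounded on the compact parameter set, and it is applied to the vector
field, which decays along the profile. -/
lemma decaysAlong_transport (hf : P.IsSymbol ρ f) : P.DecaysAlong ρ (P.transport f) := by
  obtain ⟨B, hB⟩ := (P.isCompact_paramSet ρ).exists_bound_of_continuousOn
    (f := fderiv ℝ f) fun k hk =>
      ((hf k hk).fderiv_right (m := ⊤) (by simp)).continuousAt.continuousWithinAt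
  obtain ⟨C, ha, hC, h⟩ := P.exists_field_decay.choose_spec
  refine ⟨|B| * C, by positivity, fun x ω ε hx hω hε => ?_⟩
  have h1 := (fderiv ℝ f (P.q x, ω, ε)).le_opNorm (P.field (P.q x), 0, 0)
  have h2 : ‖((P.field (P.q x), 0, 0) : State × ℂ × ℂ)‖ = ‖P.field (P.q x)‖ := by
    simp [Prod.norm_def]
  rw [h2] at h1
  refine h1.trans ?_
  rw [mul_assoc]
  exact mul_le_mul ((hB _ (P.mem_paramSet (P.q_mem_states hx) hω hε)).trans (le_abs_self _))
    (h x hx) (norm_nonneg _) (abs_nonneg _)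

/-- A symbol that vanishes at the end state decays along the profile. -/
lemma decaysAlong (hf : P.IsSymbol ρ f)
    (h0 : ∀ ω ε, ‖ω‖ ≤ ρ → ‖ε‖ ≤ ρ → f (P.qInf, ω, ε) = 0) : P.DecaysAlong ρ f := by
  obtain ⟨C, hC, h⟩ := hf.decaysAlong_transport
  refine ⟨C / P.decayRate, div_nonneg hC P.decayRate_pos.le, fun x ω ε hx hω hε => ?_⟩
  -- The decay of `f` is that of the integral of its derivative from `x` to `∞`, the value at the
  -- end state being zero.
  have h1 : ∀ y, x ≤ y → ‖f (P.q y, ω, ε) - f (P.q x, ω, ε)‖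
      ≤ C / P.decayRate * Real.exp (-P.decayRate * x) := fun y hy =>
    norm_sub_le_of_norm_deriv_le_exp P.decayRate_pos hC hx hy
      (F := fun y => f (P.q y, ω, ε))
      (fun t ht => hf.hasDerivWithinAt (hx.trans ht.1) hω hε)
      (fun t ht => h t ω ε (hx.trans ht.1) hω hε)
  have hlim : Tendsto (fun y => f (P.q y, ω, ε)) atTop (𝓝 0) := by
    rw [← h0 ω ε hω hε]
    exact ((hf _ (P.mem_paramSet P.qInf_mem_states hω hε)).continuousAt.tendsto).comp
      (P.tendsto_q.prodMk_nhds tendsto_const_nhds)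
  have h2 := le_of_tendsto (hlim.sub_const (f (P.q x, ω, ε))).norm (eventually_atTop.2 ⟨x, h1⟩)
  simpa using h2

lemma continuous_eval {X : Type*} [TopologicalSpace X] (hf : P.IsSymbol ρ f) {ω ε : X → ℂ}
    (hω : Continuous ω) (hε : Continuous ε) (hωρ : ∀ π, ‖ω π‖ ≤ ρ) (hερ : ∀ π, ‖ε π‖ ≤ ρ) :
    Continuous fun p : ℝ × X => f (P.q (max p.1 0), ω p.2, ε p.2) := by
  have hq : Continuous fun p : ℝ × X => P.q (max p.1 0) :=
    P.continuousOn_q.comp_continuous (by fun_prop) fun p => mem_Ici.2 (le_max_right _ _)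
  have h1 : Continuous fun p : ℝ × X => (P.q (max p.1 0), ω p.2, ε p.2) := by fun_prop
  refine continuous_iff_continuousAt.2 fun p => ?_
  exact ContinuousAt.comp (f := fun p : ℝ × X => (P.q (max p.1 0), ω p.2, ε p.2))
    (hf _ (P.mem_paramSet (P.q_mem_states (le_max_right _ _))
      (hωρ _) (hερ _))).continuousAt h1.continuousAt

end IsSymbol

namespace DecaysAlong

lemma zero : P.DecaysAlong ρ fun _ => 0 := ⟨0, le_rfl, by simp⟩

lemma add (hf : P.DecaysAlong ρ f) (hg : P.DecaysAlong ρ g) :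
    P.DecaysAlong ρ fun k => f k + g k := by
  obtain ⟨C, hC, h⟩ := hf
  obtain ⟨D, hD, h'⟩ := hg
  refine ⟨C + D, by positivity, fun x ω ε hx hω hε => (norm_add_le _ _).trans ?_⟩
  rw [add_mul]
  exact add_le_add (h x ω ε hx hω hε) (h' x ω ε hx hω hε)

lemma neg (hf : P.DecaysAlong ρ f) : P.DecaysAlong ρ fun k => -f k := by
  simpa only [DecaysAlong, norm_neg] using hf

lemma sub (hf : P.DecaysAlong ρ f) (hg : P.DecaysAlong ρ g) :
    P.DecaysAlong ρ fun k => f k - g k := by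
  simpa only [sub_eq_add_neg] using hf.add hg.neg

lemma symbol_mul (hf : P.IsSymbol ρ f) (hg : P.DecaysAlong ρ g) :
    P.DecaysAlong ρ fun k => f k * g k := by
  obtain ⟨C, hC, h⟩ := hf.exists_bound
  obtain ⟨D, hD, h'⟩ := hg
  refine ⟨C * D, by positivity, fun x ω ε hx hω hε => ?_⟩
  rw [norm_mul, mul_assoc]
  exact mul_le_mul (h _ (P.mem_paramSet (P.q_mem_states hx) hω hε)) (h' x ω ε hx hω hε)
    (norm_nonneg _) hC

lemma mul_symbol (hf : P.DecaysAlong ρ f) (hg : P.IsSymbol ρ g) :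
    P.DecaysAlong ρ fun k => f k * g k := by
  simpa only [mul_comm] using symbol_mul hg hf

lemma sum {ι : Type*} {s : Finset ι} {F : ι → State × ℂ × ℂ → ℂ}
    (h : ∀ i ∈ s, P.DecaysAlong ρ (F i)) : P.DecaysAlong ρ fun k => ∑ i ∈ s, F i k := by
  classical
  induction s using Finset.induction_on with
  | empty => simpa using zero
  | insert i s hi ih =>
    simp only [Finset.sum_insert hi]
    exact (h i (Finset.mem_insert_self i s)).add
      (ih fun j hj => h j (Finset.mem_insert_of_mem hj))

end DecaysAlong

lemma exists_common_bound {ι : Type*} [Fintype ι] {F : ι → State × ℂ × ℂ → ℂ}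
    (h : ∀ i, P.DecaysAlong ρ (F i)) : ∃ C, 0 ≤ C ∧ ∀ i x ω ε, 0 ≤ x → ‖ω‖ ≤ ρ → ‖ε‖ ≤ ρ →
      ‖F i (P.q x, ω, ε)‖ ≤ C * Real.exp (-P.decayRate * x) := by
  choose C hC h' using h
  refine ⟨∑ i, C i, Finset.sum_nonneg fun i _ => hC i, fun i x ω ε hx hω hε => ?_⟩
  refine (h' i x ω ε hx hω hε).trans (mul_le_mul_of_nonneg_right ?_ (Real.exp_pos _).le)
  exact Finset.single_le_sum (fun j _ => hC j) (Finset.mem_univ i)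

lemma hasDerivAt_integral_of_continuous {l : ℝ → ℂ} (hl : Continuous l) (x : ℝ) :
    HasDerivAt (fun y => ∫ s in (0 : ℝ)..y, l s) (l x) x :=
  intervalIntegral.integral_hasDerivAt_right (hl.intervalIntegrable _ _)
    hl.stronglyMeasurable.stronglyMeasurableAtFilter hl.continuousAt

/-- The solution of `w' = ε⁻¹ diag(μ) w + R w` that follows the mode `i₀`, when this mode has the
smallest growth; it is asymptotic to the unit vector `e_{i₀}` as `ε → 0`. -/
theorem exists_dominant_solution {ι : Type*} [Fintype ι] [DecidableEq ι] (i₀ : ι)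
    {μ ν : ι → State × ℂ × ℂ → ℂ} {R : ι → ι → State × ℂ × ℂ → ℂ}
    (hμ : ∀ i, P.IsSymbol ρ (μ i)) (hν : ∀ i, P.IsSymbol ρ (ν i)) (hν₀ : ν i₀ = fun _ => 0)
    (hνμ : ∀ i, i ≠ i₀ → ∀ k ∈ P.paramSet ρ, (μ i k - μ i₀ k) * ν i k = 1)
    (hR : ∀ i j, P.IsSymbol ρ (R i j)) (hRd : ∀ i j, P.DecaysAlong ρ (R i j)) :
    ∃ C, 0 ≤ C ∧ ∀ (X : Type) [TopologicalSpace X] [FirstCountableTopology X] (ω ε : X → ℂ),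
      Continuous ω → Continuous ε → (∀ π, ‖ω π‖ ≤ ρ) → (∀ π, ‖ε π‖ ≤ ρ) → (∀ π, ε π ≠ 0) →
      (∀ i x π, 0 ≤ x →
        0 ≤ ((μ i (P.q x, ω π, ε π) - μ i₀ (P.q x, ω π, ε π)) / ε π).re) →
      ∃ w : ℝ → X → ι → ℂ, (∀ x, 0 ≤ x → Continuous (w x)) ∧
        (∀ i x π, 0 ≤ x → HasDerivWithinAt (fun y => w y π i)
          (μ i (P.q x, ω π, ε π) / ε π * w x π i + ∑ j, R i j (P.q x, ω π, ε π) * w x π j)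
          (Ici 0) x) ∧
        (∀ x π, 0 ≤ x → ‖w x π‖ ≤
          C * ‖Complex.exp (∫ s in (0 : ℝ)..x, μ i₀ (P.q (max s 0), ω π, ε π) / ε π)‖) ∧
        ∀ π, ‖w 0 π - Pi.single i₀ 1‖ ≤ C * ‖ε π‖ := by
  -- First-order corrector. In the ansatz `w = E (e_{i₀} + ε (z - N))` the coupling `R i i₀` is a
  -- source of order `1`; off the diagonal `(μ i - μ i₀) N i = R i i₀` cancels it, and for `i = i₀`
  -- it is taken into `E`. What is left is `ψ`, the bounded source of the equation for `z`.
  set N : ι → State × ℂ × ℂ → ℂ := fun i k => R i i₀ k * ν i k with hN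
  have hNs : ∀ i, P.IsSymbol ρ (N i) := fun i => (hR i i₀).mul (hν i)
  have hNd : ∀ i, P.DecaysAlong ρ (N i) := fun i => (hRd i i₀).mul_symbol (hν i)
  set ψ : ι → State × ℂ × ℂ → ℂ := fun i k =>
    P.transport (N i) k + R i₀ i₀ k * N i k - ∑ j, R i j k * N j k with hψ
  have hψs : ∀ i, P.IsSymbol ρ (ψ i) := fun i =>
    ((hNs i).transport.add ((hR i₀ i₀).mul (hNs i))).sub
      (IsSymbol.sum fun j _ => (hR i j).mul (hNs j))
  have hψd : ∀ i, P.DecaysAlong ρ (ψ i) := fun i =>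
    ((hNs i).decaysAlong_transport.add ((hRd i₀ i₀).mul_symbol (hNs i))).sub
      (DecaysAlong.sum fun j _ => (hRd i j).mul_symbol (hNs j))
  -- Dividing by the scalar factor `E = exp ∫ (μ i₀ / ε + R i₀ i₀)` subtracts `R i₀ i₀` from every
  -- diagonal entry.
  set R' : ι → ι → State × ℂ × ℂ → ℂ := fun i j k => R i j k - if i = j then R i₀ i₀ k else 0
    with hR'
  have hR's : ∀ i j, P.IsSymbol ρ (R' i j) := fun i j => by
    by_cases h : i = j
    · simpa [hR', h] using (hR j j).sub (hR i₀ i₀)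
    · simpa [hR', h] using hR i j
  have hR'd : ∀ i j, P.DecaysAlong ρ (R' i j) := fun i j => by
    by_cases h : i = j
    · simpa [hR', h] using (hRd j j).sub (hRd i₀ i₀)
    · simpa [hR', h] using hRd i j
  obtain ⟨C₁, hC₁, h₁⟩ := exists_common_bound hNd
  obtain ⟨C₂, hC₂, h₂⟩ := exists_common_bound hψd
  obtain ⟨C₃, hC₃, h₃⟩ := exists_common_bound (F := fun p : ι × ι => R' p.1 p.2)
    fun p => hR'd p.1 p.2
  obtain ⟨C₄, hC₄, h₄⟩ := hRd i₀ i₀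
  have ha := P.decayRate_pos
  set K : ℝ := Real.exp (2 * (Fintype.card ι + 1) * (C₂ + C₃) / P.decayRate) with hK
  have hK0 : 0 < K := Real.exp_pos _
  have hD1 : 1 ≤ Real.exp (C₄ / P.decayRate) := Real.one_le_exp (by positivity)
  -- The first factor bounds `exp ∫ R i₀ i₀`, and `C₁ + K` bounds `z - N`. The `max ρ 1` lets one
  -- constant serve both estimates: `|ε| ≤ ρ` is used for the size of `w`, while `|ε|` itself is
  -- kept at `x = 0`.
  refine ⟨Real.exp (C₄ / P.decayRate) * (1 + max ρ 1 * (C₁ + K)), by positivity, ?_⟩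
  intro X _ _ ω ε hω hε hωρ hερ hε0 hre
  have hmax : ∀ {x : ℝ}, 0 ≤ x → max x 0 = x := fun hx => max_eq_left hx
  have hlamc : ∀ i, Continuous (Function.uncurry fun (x : ℝ) (π : X) =>
      (μ i (P.q (max x 0), ω π, ε π) - μ i₀ (P.q (max x 0), ω π, ε π)) / ε π) := fun i =>
    (((hμ i).continuous_eval hω hε hωρ hερ).sub
      ((hμ i₀).continuous_eval hω hε hωρ hερ)).div (hε.comp continuous_snd) fun p => hε0 p.2
  -- The bound obtained for `z` is free of `ε` although the rates are divided by it.
  obtain ⟨z, hzc, hzb, hzd⟩ := exists_bounded_solution (X := X) ha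
    (add_nonneg hC₂ hC₃)
    (lam := fun i x π => (μ i (P.q (max x 0), ω π, ε π) - μ i₀ (P.q (max x 0), ω π, ε π)) / ε π)
    (R := fun i j x π => R' i j (P.q (max x 0), ω π, ε π))
    (ρ := fun i x π => ψ i (P.q (max x 0), ω π, ε π)) hlamc
    (fun i j => (hR's i j).continuous_eval hω hε hωρ hερ)
    (fun i => (hψs i).continuous_eval hω hε hωρ hερ)
    (fun i x π hx => by rw [hmax hx]; exact hre i x π hx)
    (fun i j x π hx => by
      rw [hmax hx]
      refine (h₃ (i, j) x _ _ hx (hωρ π) (hερ π)).trans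
        (mul_le_mul_of_nonneg_right (by linarith) (Real.exp_pos _).le))
    (fun i x π hx => by
      rw [hmax hx]
      refine (h₂ i x _ _ hx (hωρ π) (hερ π)).trans
        (mul_le_mul_of_nonneg_right (by linarith) (Real.exp_pos _).le))
  set β : X → ℝ → ℂ := fun π s => R i₀ i₀ (P.q (max s 0), ω π, ε π) with hβ
  have hβu : Continuous (Function.uncurry fun (s : ℝ) (π : X) => β π s) :=
    (hR i₀ i₀).continuous_eval hω hε hωρ hερ
  have hβc : ∀ π, Continuous (β π) := fun π =>
    hβu.comp (by fun_prop : Continuous fun s : ℝ => (s, π))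
  set γ : X → ℝ → ℂ := fun π s => μ i₀ (P.q (max s 0), ω π, ε π) / ε π with hγ
  have hγu : Continuous (Function.uncurry fun (s : ℝ) (π : X) => γ π s) :=
    ((hμ i₀).continuous_eval hω hε hωρ hερ).div (hε.comp continuous_snd) fun p => hε0 p.2
  have hγc : ∀ π, Continuous (γ π) := fun π =>
    hγu.comp (by fun_prop : Continuous fun s : ℝ => (s, π))
  set E : ℝ → X → ℂ := fun x π =>
    Complex.exp ((∫ s in (0 : ℝ)..x, γ π s) + ∫ s in (0 : ℝ)..x, β π s) with hE
  have hEd : ∀ x π, HasDerivAt (fun y => E y π) (E x π * (γ π x + β π x)) x := fun x π =>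
    ((hasDerivAt_integral_of_continuous (hγc π) x).add
      (hasDerivAt_integral_of_continuous (hβc π) x)).cexp
  set y : ℝ → X → ι → ℂ := fun x π i =>
    (if i = i₀ then 1 else 0) + ε π * (z (x, π) i - N i (P.q (max x 0), ω π, ε π)) with hy
  have hyb : ∀ x π, 0 ≤ x → ∀ i, ‖z (x, π) i - N i (P.q (max x 0), ω π, ε π)‖ ≤ C₁ + K := by
    intro x π hx i
    refine (norm_sub_le _ _).trans ?_
    have hz := (norm_le_pi_norm (z (x, π)) i).trans (hzb x π hx)
    have hn := h₁ i x _ _ hx (hωρ π) (hερ π)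
    have he : Real.exp (-P.decayRate * x) ≤ 1 := Real.exp_le_one_iff.2 (by nlinarith)
    rw [hmax hx]
    nlinarith
  refine ⟨fun x π i => E x π * y x π i, fun x hx => ?_, fun i x π hx => ?_, fun x π hx => ?_,
    fun π => ?_⟩
  · refine continuous_pi fun i => Continuous.mul ?_ ?_
    · exact Complex.continuous_exp.comp
        ((continuous_integral_uncurry hγu continuous_const continuous_const continuous_id).add
          (continuous_integral_uncurry hβu continuous_const continuous_const continuous_id))
    · refine continuous_const.add (hε.mul (Continuous.sub ?_ ?_))
      · exact (continuous_apply i).comp (hzc.comp (by fun_prop : Continuous fun π : X => (x, π)))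
      · exact ((hNs i).continuous_eval hω hε hωρ hερ).comp
          (by fun_prop : Continuous fun π : X => (x, π))
  · have hNx : HasDerivWithinAt (fun y => N i (P.q (max y 0), ω π, ε π))
        (P.transport (N i) (P.q x, ω π, ε π)) (Ici 0) x :=
      ((hNs i).hasDerivWithinAt hx (hωρ π) (hερ π)).congr
        (fun s hs => by rw [hmax hs]) (by rw [hmax hx])
    have hyd := (((hzd i π x hx).sub hNx).const_mul (ε π)).const_add
      (if i = i₀ then (1 : ℂ) else 0)
    refine ((hEd x π).hasDerivWithinAt.mul hyd).congr_deriv ?_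
    have hk := P.mem_paramSet (P.q_mem_states hx) (hωρ π) (hερ π)
    simp only [hγ, hβ, hmax hx, hy, Pi.sub_apply]
    have hνi : (μ i (P.q x, ω π, ε π) - μ i₀ (P.q x, ω π, ε π)) * N i (P.q x, ω π, ε π)
        = R i i₀ (P.q x, ω π, ε π) - if i = i₀ then R i₀ i₀ (P.q x, ω π, ε π) else 0 := by
      by_cases h : i = i₀
      · simp [h]
      · have := hνμ i h _ hk
        simp only [hN, h, if_false, sub_zero]
        linear_combination (R i i₀ (P.q x, ω π, ε π)) * this
    have hsum1 : ∑ j, R' i j (P.q x, ω π, ε π) * z (x, π) j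
        = ∑ j, R i j (P.q x, ω π, ε π) * z (x, π) j - R i₀ i₀ (P.q x, ω π, ε π) * z (x, π) i := by
      simp only [hR', sub_mul, Finset.sum_sub_distrib, ite_mul, zero_mul, Finset.sum_ite_eq,
        Finset.mem_univ, if_true]
    have hsum2 : ∑ j, R i j (P.q x, ω π, ε π) * (E x π * ((if j = i₀ then 1 else 0)
          + ε π * (z (x, π) j - N j (P.q x, ω π, ε π))))
        = E x π * (R i i₀ (P.q x, ω π, ε π) + ε π * (∑ j, R i j (P.q x, ω π, ε π) * z (x, π) j
          - ∑ j, R i j (P.q x, ω π, ε π) * N j (P.q x, ω π, ε π))) := by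
      rw [← Finset.sum_sub_distrib, Finset.mul_sum]
      have : R i i₀ (P.q x, ω π, ε π) = ∑ j, R i j (P.q x, ω π, ε π) * if j = i₀ then 1 else 0 := by
        simp
      rw [this, ← Finset.sum_add_distrib, Finset.mul_sum]
      exact Finset.sum_congr rfl fun j _ => by ring
    rw [hsum1, hsum2]
    simp only [hψ]
    have h0 := hε0 π
    generalize N i (P.q x, ω π, ε π) = n at hνi ⊢
    by_cases h : i = i₀
    · subst h
      simp only [if_true]
      field_simp
      ring
    · simp only [h, if_false] at hνi ⊢
      field_simp
      linear_combination (E x π * ε π) * hνi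
  · refine (pi_norm_le_iff_of_nonneg (by positivity)).2 fun i => ?_
    have hEb : ‖E x π‖ ≤ ‖Complex.exp (∫ s in (0 : ℝ)..x, γ π s)‖ *
        Real.exp (C₄ / P.decayRate) := by
      simp only [hE, Complex.exp_add, norm_mul]
      refine mul_le_mul_of_nonneg_left ?_ (norm_nonneg _)
      refine (Complex.norm_exp_le_exp_norm _).trans (Real.exp_le_exp.2 ?_)
      have := norm_sub_le_of_norm_deriv_le_exp (F := fun y => ∫ s in (0 : ℝ)..y, β π s) ha hC₄
        le_rfl hx (fun t _ => (hasDerivAt_integral_of_continuous (hβc π) t).hasDerivWithinAt)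
        (fun t ht => by
          simp only [hβ, hmax ht.1]
          exact h₄ t _ _ ht.1 (hωρ π) (hερ π))
      simpa using this
    have hyi : ‖y x π i‖ ≤ 1 + max ρ 1 * (C₁ + K) := by
      refine (norm_add_le _ _).trans (add_le_add ?_ ?_)
      · split_ifs <;> simp
      · rw [norm_mul]
        exact mul_le_mul ((hερ π).trans (le_max_left _ _)) (hyb x π hx i) (norm_nonneg _)
          (by positivity)
    rw [norm_mul]
    calc ‖E x π‖ * ‖y x π i‖ ≤ _ := mul_le_mul hEb hyi (norm_nonneg _) (by positivity)
      _ = _ := by ring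
  · refine (pi_norm_le_iff_of_nonneg (by positivity)).2 fun i => ?_
    have e1 : E 0 π = 1 := by simp [hE]
    have e2 : E 0 π * y 0 π i - (Pi.single i₀ (1 : ℂ) : ι → ℂ) i
        = ε π * (z (0, π) i - N i (P.q (max 0 0), ω π, ε π)) := by
      rw [e1, hy, Pi.single_apply]; ring
    rw [Pi.sub_apply, e2, norm_mul, mul_comm]
    refine mul_le_mul_of_nonneg_right ((hyb 0 π le_rfl i).trans ?_) (norm_nonneg _)
    have h5 : C₁ + K ≤ max ρ 1 * (C₁ + K) :=
      le_mul_of_one_le_left (by positivity) (le_max_right _ _)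
    have h6 : 0 ≤ max ρ 1 * (C₁ + K) := by positivity
    nlinarith

end Profile

end ZND

/-! ### Explicit diagonalization of the principal part. -/

namespace ZND

section Algebra

/-- The matrix `A_x` with `u`, `v`, `c₀`, `p_S`, `p_λ` as variables. -/
def matAx (v u c pS pl : ℂ) : Matrix (Fin 5) (Fin 5) ℂ :=
  !![u, -v, 0, 0, 0;
     -c ^ 2 / v, u, 0, v * pS, v * pl;
     0, 0, u, 0, 0;
     0, 0, 0, u, 0;
     0, 0, 0, 0, u]

/-- The matrix `A_y` with `v`, `c₀`, `p_S`, `p_λ` as variables. -/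
def matAy (v c pS pl : ℂ) : Matrix (Fin 5) (Fin 5) ℂ :=
  !![0, 0, -v, 0, 0;
     0, 0, 0, 0, 0;
     -c ^ 2 / v, 0, 0, v * pS, v * pl;
     0, 0, 0, 0, 0;
     0, 0, 0, 0, 0]

/-- The inverse of `A_x`. -/
def matAxInv (v u c pS pl : ℂ) : Matrix (Fin 5) (Fin 5) ℂ :=
  !![-u / (c ^ 2 - u ^ 2), -v / (c ^ 2 - u ^ 2), 0,
       v ^ 2 * pS / (u * (c ^ 2 - u ^ 2)), v ^ 2 * pl / (u * (c ^ 2 - u ^ 2));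
     -c ^ 2 / (v * (c ^ 2 - u ^ 2)), -u / (c ^ 2 - u ^ 2), 0,
       v * pS / (c ^ 2 - u ^ 2), v * pl / (c ^ 2 - u ^ 2);
     0, 0, 1 / u, 0, 0;
     0, 0, 0, 1 / u, 0;
     0, 0, 0, 0, 1 / u]

/-- Rows: left eigenvectors of `Φ₀`, with `ω = 1 / ζ` and `σ = s / ζ`. -/
def leftEigen (v u c pS pl ω σ : ℂ) : Matrix (Fin 5) (Fin 5) ℂ :=
  !![u * v / (2 * σ * c), u * (u + c * σ) / (2 * σ * (c + u * σ)),
       Complex.I * ω * u * (c ^ 2 - u ^ 2) / (2 * σ * (c + u * σ)), 0, 0;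
     -(u * v) / (2 * σ * c), -(u * (u - c * σ)) / (2 * σ * (c - u * σ)),
       -(Complex.I * ω * u * (c ^ 2 - u ^ 2)) / (2 * σ * (c - u * σ)), 0, 0;
     0, Complex.I * ω * u / (1 - ω ^ 2 * u ^ 2), 1 / (1 - ω ^ 2 * u ^ 2), 0, 0;
     v ^ 2 * pS / c ^ 2, 0, 0, 1, 0;
     v ^ 2 * pl / c ^ 2, 0, 0, 0, 1]

/-- Columns: right eigenvectors of `Φ₀`; the first one is `T₁ / ζ`. -/
def rightEigen (v u c pS pl ω σ : ℂ) : Matrix (Fin 5) (Fin 5) ℂ :=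
  !![c * σ / (u * v), -(c * σ) / (u * v), -(Complex.I * ω * c ^ 2) / v, 0, 0;
     1 / u, 1 / u, Complex.I * ω * u, 0, 0;
     -(Complex.I * ω), -(Complex.I * ω), 1, 0, 0;
     -(v * pS * σ) / (c * u), v * pS * σ / (c * u), Complex.I * ω * v * pS, 1, 0;
     -(v * pl * σ) / (c * u), v * pl * σ / (c * u), Complex.I * ω * v * pl, 0, 1]

/-- The eigenvalues of `Φ₀ / ζ`. -/
def eigenvalue (u c σ : ℂ) : Fin 5 → ℂ :=
  ![-(u + c * σ) / (c ^ 2 - u ^ 2), -(u - c * σ) / (c ^ 2 - u ^ 2), 1 / u, 1 / u, 1 / u]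

/-- The matrix whose only nonzero row is the last one. -/
def lastRow (b : Fin 5 → ℂ) : Matrix (Fin 5) (Fin 5) ℂ :=
  Matrix.of fun i j => if i = 4 then b j else 0

variable {v u c pS pl ω σ : ℂ}

lemma matAx_mul_matAxInv (hv : v ≠ 0) (hu : u ≠ 0) (hD : c ^ 2 - u ^ 2 ≠ 0) :
    matAx v u c pS pl * matAxInv v u c pS pl = 1 := by
  ext i j
  fin_cases i <;> fin_cases j <;>
    simp [matAx, matAxInv, Matrix.mul_apply, Fin.sum_univ_five] <;>
    field_simp <;> ring

lemma leftEigen_mul_rightEigen (hv : v ≠ 0) (hu : u ≠ 0) (hc : c ≠ 0) (hσ0 : σ ≠ 0)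
    (h₁ : c + u * σ ≠ 0) (h₂ : c - u * σ ≠ 0) (h₃ : 1 - ω ^ 2 * u ^ 2 ≠ 0)
    (hσ : σ ^ 2 = 1 + (c ^ 2 - u ^ 2) * ω ^ 2) :
    leftEigen v u c pS pl ω σ * rightEigen v u c pS pl ω σ = 1 := by
  have hI : Complex.I ^ 2 = -1 := Complex.I_sq
  ext i j
  fin_cases i <;> fin_cases j <;>
    simp [leftEigen, rightEigen, Matrix.mul_apply, Fin.sum_univ_five] <;>
    first
    | done
    | (field_simp; done)
    | (field_simp; ring; done)
    | (field_simp; linear_combination (-u) * hσ - u * ω ^ 2 * (c ^ 2 - u ^ 2) * hI)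
    | (field_simp; linear_combination u * hσ + u * ω ^ 2 * (c ^ 2 - u ^ 2) * hI)
    | (field_simp; linear_combination ω ^ 2 * u ^ 2 * hI)

/-- This is the transpose of the eigenvector relation `L Φ₀ = ζ D L`, multiplied by `A_x` so that no
inverse appears. Entrywise it reduces to `i² = -1` and the quadratic relation for `σ`. -/
lemma leftEigen_mul_eigen (hv : v ≠ 0) (hu : u ≠ 0) (hc : c ≠ 0) (hD : c ^ 2 - u ^ 2 ≠ 0)
    (hσ0 : σ ≠ 0) (h₁ : c + u * σ ≠ 0) (h₂ : c - u * σ ≠ 0) (h₃ : 1 - ω ^ 2 * u ^ 2 ≠ 0)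
    (hσ : σ ^ 2 = 1 + (c ^ 2 - u ^ 2) * ω ^ 2) :
    (1 + (Complex.I * ω) • matAy v c pS pl) * (leftEigen v u c pS pl ω σ).transpose
      = matAx v u c pS pl * ((leftEigen v u c pS pl ω σ).transpose
          * Matrix.diagonal (eigenvalue u c σ)) := by
  have hI : Complex.I ^ 2 = -1 := Complex.I_sq
  ext i j
  fin_cases i <;> fin_cases j <;>
    simp [leftEigen, matAx, matAy, Matrix.mul_apply, Fin.sum_univ_five, Matrix.one_apply,
      eigenvalue, Matrix.diagonal_apply, Matrix.add_apply] <;>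
    first
    | done
    | (field_simp; done)
    | (field_simp; ring; done)
    | (field_simp
       linear_combination (-c * (c ^ 2 - u ^ 2)) * hσ - c * ω ^ 2 * (c ^ 2 - u ^ 2) ^ 2 * hI)
    | (field_simp
       linear_combination (c * (c ^ 2 - u ^ 2)) * hσ + c * ω ^ 2 * (c ^ 2 - u ^ 2) ^ 2 * hI)

end Algebra

end ZND

/-! ### The shear for the non-decaying part, and the principal part along the profile. -/

namespace ZND

section Algebra

variable {v u c pS pl ω σ : ℂ}

/-- The last column of the left eigenvector matrix is the last unit vector, so the limit of `Φ₁` is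
unaffected by multiplication from the left. -/
lemma leftEigen_mul_lastRow (b : Fin 5 → ℂ) :
    leftEigen v u c pS pl ω σ * lastRow b = lastRow b := by
  ext i j
  fin_cases i <;> simp [leftEigen, lastRow, Matrix.mul_apply]

lemma lastRow_mul (b : Fin 5 → ℂ) (A : Matrix (Fin 5) (Fin 5) ℂ) :
    lastRow b * A = lastRow fun j => ∑ i, b i * A i j := by
  ext i j
  by_cases h : i = 4 <;> simp [lastRow, Matrix.mul_apply, h]

/-- The matrix differing from the identity in its last row. -/
def shear (d : Fin 4 → ℂ) : Matrix (Fin 5) (Fin 5) ℂ :=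
  !![1, 0, 0, 0, 0; 0, 1, 0, 0, 0; 0, 0, 1, 0, 0; 0, 0, 0, 1, 0; d 0, d 1, d 2, d 3, 1]

lemma shear_mul_shear_neg (d : Fin 4 → ℂ) : shear d * shear (-d) = 1 := by
  ext i j
  fin_cases i <;> fin_cases j <;>
    simp [shear, Matrix.mul_apply, Fin.sum_univ_five]

/-- Adding a last row gives a lower triangular matrix whose last eigenvalue is `l₂ + b 4`. The
conditions divide `b j` by eigenvalue differences; for `j = 2, 3` the difference is `b 4` alone, so
the shift `b 4` is what separates the triple eigenvalue. -/
lemma shear_mul_triangular {d : Fin 4 → ℂ} {l₀ l₁ l₂ : ℂ} {b : Fin 5 → ℂ}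
    (h0 : d 0 * (l₂ + b 4 - l₀) = b 0) (h1 : d 1 * (l₂ + b 4 - l₁) = b 1)
    (h2 : d 2 * b 4 = b 2) (h3 : d 3 * b 4 = b 3) :
    shear d * (Matrix.diagonal ![l₀, l₁, l₂, l₂, l₂] + lastRow b)
      = Matrix.diagonal ![l₀, l₁, l₂, l₂, l₂ + b 4] * shear d := by
  ext i j
  fin_cases i <;> fin_cases j <;>
    simp [shear, lastRow, Matrix.mul_apply, Fin.sum_univ_five, Matrix.diagonal_apply,
      Matrix.add_apply]
  · linear_combination -h0
  · linear_combination -h1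
  · linear_combination -h2
  · linear_combination -h3

end Algebra

namespace Profile

variable {Z : Model} (P : Profile Z)

lemma cplx_Ax {x : ℝ} (hx : 0 ≤ x) : cplx (P.Ax x) =
    matAx (P.v x) (P.u x) (Z.sound (P.q x)) (dS Z.p (P.q x)) (dlam Z.p (P.q x)) := by
  have h : P.cSq x = Z.sound (P.q x) ^ 2 := (P.sq_sound_of_mem (P.q_mem_states hx)).symm
  ext i j
  fin_cases i <;> fin_cases j <;> simp [cplx, Ax, matAx, h]

lemma cplx_Ay {x : ℝ} (hx : 0 ≤ x) : cplx (P.Ay x) =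
    matAy (P.v x) (Z.sound (P.q x)) (dS Z.p (P.q x)) (dlam Z.p (P.q x)) := by
  have h : P.cSq x = Z.sound (P.q x) ^ 2 := (P.sq_sound_of_mem (P.q_mem_states hx)).symm
  ext i j
  fin_cases i <;> fin_cases j <;> simp [cplx, Ay, matAy, h]

lemma u_lt_sound {x : ℝ} (hx : 0 ≤ x) : P.u x < Z.sound (P.q x) := by
  rw [P.u_eq hx]; exact P.flux_mul_lt_sound (P.q_mem_states hx)

lemma sq_sound_sub_sq_ne_zero {a b : ℝ} (ha : 0 < a) (hab : a < b) :
    (b : ℂ) ^ 2 - (a : ℂ) ^ 2 ≠ 0 := by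
  have : 0 < b ^ 2 - a ^ 2 := by nlinarith
  exact_mod_cast this.ne'

lemma inv_cplx_Ax {x : ℝ} (hx : 0 ≤ x) : (cplx (P.Ax x))⁻¹ =
    matAxInv (P.v x) (P.u x) (Z.sound (P.q x)) (dS Z.p (P.q x)) (dlam Z.p (P.q x)) := by
  rw [P.cplx_Ax hx]
  exact Matrix.inv_eq_right_inv (matAx_mul_matAxInv
    (Complex.ofReal_ne_zero.2 (P.v_pos x hx).ne') (Complex.ofReal_ne_zero.2 (P.u_pos hx).ne')
    (sq_sound_sub_sq_ne_zero (P.u_pos hx) (P.u_lt_sound hx)))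

lemma leftEigen_mul_Phi0 {x : ℝ} (hx : 0 ≤ x) {ζ ω σ : ℂ} (hζ : ζ * ω = 1)
    (hσ0 : σ ≠ 0) (h₁ : (Z.sound (P.q x) : ℂ) + P.u x * σ ≠ 0)
    (h₂ : (Z.sound (P.q x) : ℂ) - P.u x * σ ≠ 0) (h₃ : 1 - ω ^ 2 * (P.u x : ℂ) ^ 2 ≠ 0)
    (hσ : σ ^ 2 = 1 + ((Z.sound (P.q x) : ℂ) ^ 2 - (P.u x : ℂ) ^ 2) * ω ^ 2) :
    leftEigen (P.v x) (P.u x) (Z.sound (P.q x)) (dS Z.p (P.q x)) (dlam Z.p (P.q x)) ω σ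
        * P.Phi0 x ζ
      = (ζ • Matrix.diagonal (eigenvalue (P.u x) (Z.sound (P.q x)) σ)) *
        leftEigen (P.v x) (P.u x) (Z.sound (P.q x)) (dS Z.p (P.q x)) (dlam Z.p (P.q x)) ω σ := by
  have hv := Complex.ofReal_ne_zero.2 (P.v_pos x hx).ne'
  have hu := Complex.ofReal_ne_zero.2 (P.u_pos hx).ne'
  have hc := Complex.ofReal_ne_zero.2 (P.sound_pos_of_mem (P.q_mem_states hx)).ne'
  have hD := sq_sound_sub_sq_ne_zero (P.u_pos hx) (P.u_lt_sound hx)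
  have key := leftEigen_mul_eigen (pS := (dS Z.p (P.q x) : ℂ)) (pl := (dlam Z.p (P.q x) : ℂ))
    hv hu hc hD hσ0 h₁ h₂ h₃ hσ
  have hinv := mul_eq_one_comm.1 (matAx_mul_matAxInv (pS := (dS Z.p (P.q x) : ℂ))
    (pl := (dlam Z.p (P.q x) : ℂ)) hv hu hD)
  rw [Phi0, P.inv_cplx_Ax hx, P.cplx_Ay hx]
  have e : ∀ A : Matrix (Fin 5) (Fin 5) ℂ, ζ • (1 : Matrix (Fin 5) (Fin 5) ℂ) + Complex.I • A
      = ζ • (1 + (Complex.I * ω) • A) := fun A => by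
    rw [smul_add, smul_smul]
    congr 2
    linear_combination (-Complex.I) * hζ
  rw [e]
  apply Matrix.transpose_injective
  rw [Matrix.transpose_mul, Matrix.transpose_transpose, Matrix.transpose_mul,
    Matrix.transpose_smul, Matrix.diagonal_transpose, Matrix.mul_smul, Matrix.smul_mul,
    Matrix.mul_smul, Matrix.mul_assoc, key, ← Matrix.mul_assoc, hinv, Matrix.one_mul]

end Profile

end ZND

/-! ### The root `σ`, and a radius on which all denominators are nonzero. -/

namespace ZND

namespace Profile

variable {Z : Model} (P : Profile Z)

/-- The specific volume as a symbol. -/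
def symV (k : State × ℂ × ℂ) : ℂ := (k.1.1 : ℂ)

/-- The velocity as a symbol. -/
def symU (k : State × ℂ × ℂ) : ℂ := ((P.flux * k.1.1 : ℝ) : ℂ)

variable (Z) in
/-- The sound speed as a symbol. -/
def symC (k : State × ℂ × ℂ) : ℂ := (Z.sound k.1 : ℂ)

variable (Z) in
/-- `p_S` as a symbol. -/
def symPS (k : State × ℂ × ℂ) : ℂ := (dS Z.p k.1 : ℂ)

variable (Z) in
/-- `p_λ` as a symbol. -/
def symPlam (k : State × ℂ × ℂ) : ℂ := (dlam Z.p k.1 : ℂ)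

/-- The square of `σ = s / ζ` in terms of `ω = 1 / ζ`. -/
def sigmaSq (k : State × ℂ × ℂ) : ℂ := 1 + (symC Z k ^ 2 - P.symU k ^ 2) * k.2.1 ^ 2

/-- The root `σ = s / ζ` close to `1`. -/
def sigma (k : State × ℂ × ℂ) : ℂ := Complex.exp (1 / 2 * Complex.log (P.sigmaSq k))

/-- The growth rate, at the end state, of the mode coming from the linearized reaction. -/
def endRate : ℝ := -dlam Z.r P.qInf / (P.flux * P.vInf)

/-- `1 / u - α` for the decaying eigenvalue `α`. -/
def gap₀ (k : State × ℂ × ℂ) : ℂ := symC Z k * (symC Z k + P.symU k * P.sigma k) /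
  (P.symU k * (symC Z k ^ 2 - P.symU k ^ 2))

/-- `1 / u - α` for the growing acoustic eigenvalue `α`. -/
def gap₁ (k : State × ℂ × ℂ) : ℂ := symC Z k * (symC Z k - P.symU k * P.sigma k) /
  (P.symU k * (symC Z k ^ 2 - P.symU k ^ 2))

lemma vInf_pos : 0 < P.vInf := P.v_pos_of_mem P.qInf_mem_states

lemma endRate_pos : 0 < P.endRate :=
  div_pos (neg_pos.2 (Z.dlam_r_neg _ _ P.inf_mem_dom)) (mul_pos P.flux_pos P.vInf_pos)

lemma sigma_sq {k : State × ℂ × ℂ} (h : 0 < (P.sigmaSq k).re) : P.sigma k ^ 2 = P.sigmaSq k := by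
  have h0 : P.sigmaSq k ≠ 0 := fun h' => by simp [h'] at h
  rw [sigma, ← Complex.exp_nat_mul]
  convert Complex.exp_log h0 using 2
  push_cast; ring

lemma sigma_re_pos {k : State × ℂ × ℂ} (h : 0 < (P.sigmaSq k).re) : 0 < (P.sigma k).re := by
  rw [sigma, Complex.exp_re]
  refine mul_pos (Real.exp_pos _) (Real.cos_pos_of_mem_Ioo ?_)
  have h1 := abs_lt.1 (Complex.abs_arg_lt_pi_div_two_iff.2 (Or.inl h))
  have h2 : (1 / 2 * Complex.log (P.sigmaSq k)).im = 1 / 2 * (P.sigmaSq k).arg := by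
    rw [show (1 / 2 : ℂ) = ((1 / 2 : ℝ) : ℂ) by push_cast; rfl, Complex.im_ofReal_mul,
      Complex.log_im]
  rw [h2]
  constructor <;> linarith [h1.1, h1.2, Real.pi_pos]

/-- Since `(σ - 1)(σ + 1) = σ² - 1` and `Re σ > 0`, the second factor has modulus at least `1`. -/
lemma norm_sigma_sub_one_le {k : State × ℂ × ℂ} (h : 0 < (P.sigmaSq k).re) :
    ‖P.sigma k - 1‖ ≤ ‖P.sigmaSq k - 1‖ := by
  have h1 : (P.sigma k - 1) * (P.sigma k + 1) = P.sigmaSq k - 1 := by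
    rw [← P.sigma_sq h]; ring
  have h2 : 1 ≤ ‖P.sigma k + 1‖ := by
    refine le_trans ?_ (Complex.re_le_norm _)
    simp only [Complex.add_re, Complex.one_re]
    linarith [P.sigma_re_pos h]
  rw [← h1, norm_mul]
  exact le_mul_of_one_le_right (norm_nonneg _) h2

/-- The radius `ρ` is small enough for all quantities below to be symbols. -/
structure Admissible (ρ : ℝ) : Prop where
  pos : 0 < ρ
  sound_mul_le : ∀ k ∈ P.states, Z.sound k * ρ ≤ 1 / 2
  sigmaSq_re_pos : ∀ k ∈ P.paramSet ρ, 0 < (P.sigmaSq k).re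
  plus_ne_zero : ∀ k ∈ P.paramSet ρ, symC Z k + P.symU k * P.sigma k ≠ 0
  minus_ne_zero : ∀ k ∈ P.paramSet ρ, symC Z k - P.symU k * P.sigma k ≠ 0
  vortical_ne_zero : ∀ k ∈ P.paramSet ρ, 1 - k.2.1 ^ 2 * P.symU k ^ 2 ≠ 0
  gap₀_ne_zero : ∀ k ∈ P.paramSet ρ, P.gap₀ k + k.2.2 * P.endRate ≠ 0
  gap₁_ne_zero : ∀ k ∈ P.paramSet ρ, P.gap₁ k + k.2.2 * P.endRate ≠ 0

lemma contDiffAt_sound {k : State} (hk : k ∈ P.states) : ContDiffAt ℝ ⊤ Z.sound k :=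
  (Model.contDiffAt_soundSq (P.states_subset_dom hk)).sqrt (P.soundSq_pos_of_mem hk).ne'

lemma exists_admissible : ∃ ρ, P.Admissible ρ := by
  obtain ⟨v₀, κ, h₀, hκ, hκ1, hb⟩ := P.exists_uniform_bounds
  obtain ⟨c₁, hc₁⟩ := P.isCompact_states.exists_bound_of_continuousOn
    (f := Z.sound) fun k hk => (P.contDiffAt_sound hk).continuousAt.continuousWithinAt
  have hcmax : ∀ k ∈ P.states, Z.sound k ≤ c₁ := fun k hk => (le_abs_self _).trans (hc₁ k hk)
  have hc₁0 : 0 < c₁ := (P.sound_pos_of_mem P.qInf_mem_states).trans_le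
    (hcmax _ P.qInf_mem_states)
  have hβ := P.endRate_pos
  -- Here `κ` bounds the Mach number and `c₁` the sound speed. The first bound keeps `σ² - 1`, which
  -- is at most `(c₁ ρ)²`, small enough for `Re σ² > 0` and for `u |σ| < c₀` uniformly; the second
  -- keeps `|ε| endRate` below the acoustic gaps.
  set ρ : ℝ := min (min (1 / 2) ((1 - κ) / 2) / c₁) ((1 - κ) / (4 * c₁ * P.endRate)) with hρ
  have h1κ : 0 < 1 - κ := by linarith
  have hρ0 : 0 < ρ := by
    refine lt_min (div_pos (lt_min (by norm_num) (by linarith)) hc₁0) (by positivity)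
  have hρ1 : c₁ * ρ ≤ 1 / 2 ∧ c₁ * ρ ≤ (1 - κ) / 2 := by
    have h : ρ ≤ min (1 / 2) ((1 - κ) / 2) / c₁ := min_le_left _ _
    rw [le_div_iff₀' hc₁0] at h
    exact ⟨h.trans (min_le_left _ _), h.trans (min_le_right _ _)⟩
  have hρ2 : ρ * P.endRate < (1 - κ) / (2 * c₁) := by
    have h : ρ ≤ (1 - κ) / (4 * c₁ * P.endRate) := min_le_right _ _
    calc ρ * P.endRate ≤ (1 - κ) / (4 * c₁ * P.endRate) * P.endRate :=
          mul_le_mul_of_nonneg_right h hβ.le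
      _ = (1 - κ) / (4 * c₁) := by field_simp
      _ < _ := div_lt_div_of_pos_left h1κ (by positivity) (by linarith)
  have hu : ∀ k ∈ P.states, 0 < P.flux * k.1 ∧ P.flux * k.1 ≤ κ * Z.sound k := fun k hk => by
    refine ⟨mul_pos P.flux_pos (P.v_pos_of_mem hk), ?_⟩
    have h := (hb k hk).2
    rw [← P.sq_sound_of_mem hk, ← mul_pow] at h
    exact (sq_le_sq₀ (mul_pos P.flux_pos (P.v_pos_of_mem hk)).le
      (mul_pos hκ (P.sound_pos_of_mem hk)).le).1 h
  have hτ : ∀ k ∈ P.paramSet ρ, ‖P.sigmaSq k - 1‖ ≤ (1 - κ) / 2 ∧ ‖P.sigmaSq k - 1‖ ≤ 1 / 4 := by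
    rintro ⟨k, ω, ε⟩ ⟨hk, hω, -⟩
    obtain ⟨hu0, hu1⟩ := hu k hk
    have hc := P.sound_pos_of_mem hk
    have hcm := hcmax k hk
    have huc := P.flux_mul_lt_sound hk
    have e : P.sigmaSq (k, ω, ε) - 1
        = ((Z.sound k ^ 2 - (P.flux * k.1) ^ 2 : ℝ) : ℂ) * ω ^ 2 := by
      simp only [sigmaSq, symC, symU]; push_cast; ring
    have hω' : ‖ω‖ ≤ ρ := by simpa using hω
    have hpos : 0 ≤ Z.sound k ^ 2 - (P.flux * k.1) ^ 2 := by nlinarith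
    have hle : ‖P.sigmaSq (k, ω, ε) - 1‖ ≤ (c₁ * ρ) ^ 2 := by
      rw [e, norm_mul, norm_pow, Complex.norm_real, Real.norm_of_nonneg hpos, mul_pow c₁]
      refine mul_le_mul ?_ (pow_le_pow_left₀ (norm_nonneg _) hω' 2) (by positivity)
        (by positivity)
      nlinarith [sq_nonneg (P.flux * k.1), mul_self_le_mul_self hc.le hcm]
    have h0 : 0 ≤ c₁ * ρ := by positivity
    constructor <;> nlinarith [hρ1.1, hρ1.2]
  have hre : ∀ k ∈ P.paramSet ρ, 0 < (P.sigmaSq k).re := fun k hk => by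
    have h1 := (Complex.abs_re_le_norm _).trans (hτ k hk).2
    have h2 := (abs_le.1 h1).1
    simp only [Complex.sub_re, Complex.one_re] at h2
    linarith
  -- Stated for any `z` of modulus `|σ|` so as to serve both signs `c₀ ± u σ`. The constant comes
  -- from `1 - κ (1 + (1 - κ)/2) = (1 - κ)(1 - κ/2) ≥ (1 - κ)/2`.
  have hlow : ∀ k ∈ P.paramSet ρ, ∀ z : ℂ, ‖z‖ = ‖P.sigma k‖ →
      Z.sound k.1 * ((1 - κ) / 2) ≤ ‖symC Z k + P.symU k * z‖ := by
    intro k hk z hz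
    obtain ⟨hu0, hu1⟩ := hu k.1 hk.1
    have hc := P.sound_pos_of_mem hk.1
    have h1 : ‖z‖ ≤ 1 + (1 - κ) / 2 := by
      have h2 := (P.norm_sigma_sub_one_le (hre k hk)).trans (hτ k hk).1
      have h3 := norm_add_le (1 : ℂ) (P.sigma k - 1)
      rw [add_sub_cancel, norm_one] at h3
      rw [hz]; linarith
    have h2 : ‖symC Z k‖ = Z.sound k.1 := by
      rw [symC, Complex.norm_real, Real.norm_of_nonneg hc.le]
    have h3 : ‖P.symU k * z‖ ≤ κ * Z.sound k.1 * (1 + (1 - κ) / 2) := by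
      rw [norm_mul, symU, Complex.norm_real, Real.norm_of_nonneg hu0.le]
      exact mul_le_mul hu1 h1 (norm_nonneg _) (by positivity)
    have h4 := norm_sub_norm_le (symC Z k) (-(P.symU k * z))
    rw [norm_neg, sub_neg_eq_add] at h4
    rw [h2] at h4
    nlinarith [mul_pos hc h1κ, mul_pos (mul_pos hc h1κ) h1κ]
  have hgap : ∀ k ∈ P.paramSet ρ, ∀ z : ℂ, ‖z‖ = ‖P.sigma k‖ →
      symC Z k * (symC Z k + P.symU k * z) / (P.symU k * (symC Z k ^ 2 - P.symU k ^ 2))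
        + k.2.2 * P.endRate ≠ 0 := by
    intro k hk z hz hzero
    obtain ⟨hu0, hu1⟩ := hu k.1 hk.1
    have hc := P.sound_pos_of_mem hk.1
    have huc := P.flux_mul_lt_sound hk.1
    have h1 := hlow k hk z hz
    have h2 : ‖k.2.2 * (P.endRate : ℂ)‖ < (1 - κ) / (2 * c₁) := by
      rw [norm_mul, Complex.norm_real, Real.norm_of_nonneg hβ.le]
      have : ‖k.2.2‖ ≤ ρ := by simpa using hk.2.2
      exact (mul_le_mul_of_nonneg_right this hβ.le).trans_lt hρ2
    rw [← norm_neg, ← eq_neg_of_add_eq_zero_left hzero] at h2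
    have hD0 : 0 < Z.sound k.1 ^ 2 - (P.flux * k.1.1) ^ 2 := by nlinarith
    have e1 : P.symU k * (symC Z k ^ 2 - P.symU k ^ 2)
        = ((P.flux * k.1.1 * (Z.sound k.1 ^ 2 - (P.flux * k.1.1) ^ 2) : ℝ) : ℂ) := by
      simp only [symU, symC]; push_cast; ring
    rw [norm_div, norm_mul, e1, Complex.norm_real, Real.norm_of_nonneg (by positivity), symC,
      Complex.norm_real, Real.norm_of_nonneg hc.le, div_lt_div_iff₀ (by positivity)
      (by positivity)] at h2
    have h3 : Z.sound k.1 * (Z.sound k.1 * ((1 - κ) / 2)) * (2 * c₁) ≤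
        Z.sound k.1 * ‖symC Z k + P.symU k * z‖ * (2 * c₁) :=
      mul_le_mul_of_nonneg_right (mul_le_mul_of_nonneg_left h1 hc.le) (by positivity)
    -- Bounding the denominator by `c₁ c₀²` makes the gap at least `(1 - κ) / (2 c₁)`, which exceeds
    -- `|ε| endRate` by the choice of `ρ`.
    have h4 : P.flux * k.1.1 * (Z.sound k.1 ^ 2 - (P.flux * k.1.1) ^ 2)
        ≤ c₁ * Z.sound k.1 ^ 2 :=
      mul_le_mul (huc.le.trans (hcmax _ hk.1)) (by nlinarith) hD0.le hc₁0.le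
    have h5 := mul_le_mul_of_nonneg_left h4 h1κ.le
    have h6 := h3.trans_lt h2
    nlinarith
  refine ⟨ρ, hρ0, fun k hk => ?_, hre, fun k hk h => ?_, fun k hk h => ?_, fun k hk h => ?_,
    fun k hk => hgap k hk _ rfl, fun k hk => ?_⟩
  · exact (mul_le_mul_of_nonneg_right (hcmax k hk) hρ0.le).trans hρ1.1
  · have := hlow k hk _ rfl
    rw [h, norm_zero] at this
    nlinarith [mul_pos (P.sound_pos_of_mem hk.1) h1κ]
  · have := hlow k hk (-P.sigma k) (norm_neg _)
    rw [mul_neg, ← sub_eq_add_neg, h, norm_zero] at this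
    nlinarith [mul_pos (P.sound_pos_of_mem hk.1) h1κ]
  · obtain ⟨hu0, hu1⟩ := hu k.1 hk.1
    have hω : ‖k.2.1‖ ≤ ρ := by simpa using hk.2.1
    have huc := (P.flux_mul_lt_sound hk.1).le.trans (hcmax _ hk.1)
    have h1 : ‖k.2.1 * P.symU k‖ ≤ 1 / 2 := by
      rw [norm_mul, symU, Complex.norm_real, Real.norm_of_nonneg hu0.le]
      calc _ ≤ ρ * c₁ := mul_le_mul hω huc hu0.le hρ0.le
        _ ≤ 1 / 2 := by rw [mul_comm]; exact hρ1.1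
    have h2 : ‖(k.2.1 * P.symU k) ^ 2‖ = 1 := by
      rw [mul_pow, ← sub_eq_zero.1 h, norm_one]
    rw [norm_pow] at h2
    nlinarith [norm_nonneg (k.2.1 * P.symU k)]
  · have := hgap k hk (-P.sigma k) (norm_neg _)
    rwa [mul_neg, ← sub_eq_add_neg] at this

end Profile

end ZND

/-! ### The coefficients and the diagonalizing transformation as symbols. -/

namespace ZND

namespace Profile

variable {Z : Model} (P : Profile Z)

/-- Matrices of symbols. -/
def IsSymbolMatrix (ρ : ℝ) (A : State × ℂ × ℂ → Matrix (Fin 5) (Fin 5) ℂ) : Prop :=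
  ∀ i j, P.IsSymbol ρ fun k => A k i j

variable {P} in
lemma IsSymbolMatrix.mul {ρ : ℝ} {A A' : State × ℂ × ℂ → Matrix (Fin 5) (Fin 5) ℂ}
    (hA : P.IsSymbolMatrix ρ A) (hA' : P.IsSymbolMatrix ρ A') :
    P.IsSymbolMatrix ρ fun k => A k * A' k := fun i j => by
  simp only [Matrix.mul_apply]
  exact IsSymbol.sum fun l _ => (hA i l).mul (hA' l j)

/-- Left eigenvectors along the profile. -/
def symLeft (k : State × ℂ × ℂ) : Matrix (Fin 5) (Fin 5) ℂ :=
  leftEigen (symV k) (P.symU k) (symC Z k) (symPS Z k) (symPlam Z k) k.2.1 (P.sigma k)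

/-- Right eigenvectors along the profile. -/
def symRight (k : State × ℂ × ℂ) : Matrix (Fin 5) (Fin 5) ℂ :=
  rightEigen (symV k) (P.symU k) (symC Z k) (symPS Z k) (symPlam Z k) k.2.1 (P.sigma k)

/-- The matrix `B` as a function of the state. -/
def stateB (k : State) : Matrix (Fin 5) (Fin 5) ℝ :=
  !![-(P.flux * (P.field k).1), (P.field k).1, 0, 0, 0;
     fderiv ℝ Z.p k (P.field k)
       - k.1 * fderiv ℝ (fun q => Z.soundSq q / q.1 ^ 2) k (P.field k),
       P.flux * (P.field k).1, 0, k.1 * fderiv ℝ (dS Z.p) k (P.field k),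
       k.1 * fderiv ℝ (dlam Z.p) k (P.field k);
     0, 0, 0, 0, 0;
     -dv Z.entropySource k, (P.field k).2.1, 0, -dS Z.entropySource k, -dlam Z.entropySource k;
     -dv Z.r k, (P.field k).2.2, 0, -dS Z.r k, -dlam Z.r k]

/-- The matrix `Φ₁` as a symbol. -/
def symPhi1 (k : State × ℂ × ℂ) : Matrix (Fin 5) (Fin 5) ℂ :=
  (matAxInv (symV k) (P.symU k) (symC Z k) (symPS Z k) (symPlam Z k)
    * cplx (P.stateB k.1)).transpose

/-- The nonzero row of `Φ₁` at the end state. -/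
def endRow (j : Fin 5) : ℂ := P.symPhi1 (P.qInf, 0, 0) 4 j

/-- The nonzero row of `Φ₁` at the end state, in the basis of eigenvectors of `Φ₀`. -/
def coupling (k : State × ℂ × ℂ) (j : Fin 5) : ℂ := ∑ i, P.endRow i * P.symRight k i j

/-- The shear that diagonalizes the limit of the system. -/
def shearCoeff (k : State × ℂ × ℂ) : Fin 4 → ℂ :=
  ![k.2.2 * (P.coupling k 0 / (P.gap₀ k + k.2.2 * P.endRate)),
    k.2.2 * (P.coupling k 1 / (P.gap₁ k + k.2.2 * P.endRate)),
    P.coupling k 2 / P.endRate, P.coupling k 3 / P.endRate]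

/-- The diagonalizing transformation. -/
def symL (k : State × ℂ × ℂ) : Matrix (Fin 5) (Fin 5) ℂ := shear (P.shearCoeff k) * P.symLeft k

/-- The inverse of the diagonalizing transformation. -/
def symQ (k : State × ℂ × ℂ) : Matrix (Fin 5) (Fin 5) ℂ := P.symRight k * shear (-P.shearCoeff k)

/-- The eigenvalues of the diagonalized system. -/
def symEigen (k : State × ℂ × ℂ) : Fin 5 → ℂ :=
  ![-(P.symU k + symC Z k * P.sigma k) / (symC Z k ^ 2 - P.symU k ^ 2),
    -(P.symU k - symC Z k * P.sigma k) / (symC Z k ^ 2 - P.symU k ^ 2),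
    1 / P.symU k, 1 / P.symU k, 1 / P.symU k + k.2.2 * P.endRate]

lemma contDiffAt_soundSq_div {k : State} (hk : k ∈ P.states) :
    ContDiffAt ℝ ⊤ (fun q : State => Z.soundSq q / q.1 ^ 2) k :=
  (Model.contDiffAt_soundSq (P.states_subset_dom hk)).div (contDiffAt_fst.pow 2)
    (pow_ne_zero 2 (P.v_pos_of_mem hk).ne')

lemma symV_ne_zero {k : State × ℂ × ℂ} (hk : k.1 ∈ P.states) : symV k ≠ 0 :=
  Complex.ofReal_ne_zero.2 (P.v_pos_of_mem hk).ne'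

lemma symU_ne_zero {k : State × ℂ × ℂ} (hk : k.1 ∈ P.states) : P.symU k ≠ 0 :=
  Complex.ofReal_ne_zero.2 (mul_pos P.flux_pos (P.v_pos_of_mem hk)).ne'

lemma symC_ne_zero {k : State × ℂ × ℂ} (hk : k.1 ∈ P.states) : symC Z k ≠ 0 :=
  Complex.ofReal_ne_zero.2 (P.sound_pos_of_mem hk).ne'

lemma symD_ne_zero {k : State × ℂ × ℂ} (hk : k.1 ∈ P.states) :
    symC Z k ^ 2 - P.symU k ^ 2 ≠ 0 :=
  sq_sound_sub_sq_ne_zero (mul_pos P.flux_pos (P.v_pos_of_mem hk)) (P.flux_mul_lt_sound hk)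

variable {P} {ρ : ℝ}

lemma isSymbol_symV : P.IsSymbol ρ symV := IsSymbol.ofReal fun _ _ => contDiffAt_fst

lemma isSymbol_symU : P.IsSymbol ρ P.symU :=
  IsSymbol.ofReal (f := fun k => P.flux * k.1) fun _ _ => contDiffAt_const.mul contDiffAt_fst

lemma isSymbol_symC : P.IsSymbol ρ (symC Z) := IsSymbol.ofReal fun _ hk => P.contDiffAt_sound hk

lemma isSymbol_symPS : P.IsSymbol ρ (symPS Z) := IsSymbol.ofReal fun _ hk =>
  Model.contDiffAt_fderiv_apply (Model.contDiffAt_p (P.states_subset_dom hk)) _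

lemma isSymbol_symPlam : P.IsSymbol ρ (symPlam Z) := IsSymbol.ofReal fun _ hk =>
  Model.contDiffAt_fderiv_apply (Model.contDiffAt_p (P.states_subset_dom hk)) _

lemma isSymbol_symD : P.IsSymbol ρ fun k => symC Z k ^ 2 - P.symU k ^ 2 :=
  (isSymbol_symC.pow 2).sub (isSymbol_symU.pow 2)

lemma sigma_ne_zero {k : State × ℂ × ℂ} : P.sigma k ≠ 0 := Complex.exp_ne_zero _

lemma symRight_last (k : State × ℂ × ℂ) (i : Fin 5) :
    P.symRight k i 4 = if i = 4 then 1 else 0 := by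
  fin_cases i <;> simp [symRight, rightEigen]

lemma isSymbolMatrix_symPhi1 : P.IsSymbolMatrix ρ P.symPhi1 := by
  have hInv : P.IsSymbolMatrix ρ fun k =>
      matAxInv (symV k) (P.symU k) (symC Z k) (symPS Z k) (symPlam Z k) := by
    have h0 : P.IsSymbol ρ fun _ => (0 : ℂ) := IsSymbol.const 0
    have hu : P.IsSymbol ρ fun k => 1 / P.symU k :=
      (IsSymbol.const 1).div isSymbol_symU fun k hk => P.symU_ne_zero hk.1
    have hd : ∀ {f : State × ℂ × ℂ → ℂ}, P.IsSymbol ρ f →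
        P.IsSymbol ρ fun k => f k / (symC Z k ^ 2 - P.symU k ^ 2) := fun hf =>
      hf.div isSymbol_symD fun k hk => P.symD_ne_zero hk.1
    have hud : ∀ {f : State × ℂ × ℂ → ℂ}, P.IsSymbol ρ f →
        P.IsSymbol ρ fun k => f k / (P.symU k * (symC Z k ^ 2 - P.symU k ^ 2)) := fun hf =>
      hf.div (isSymbol_symU.mul isSymbol_symD) fun k hk =>
        mul_ne_zero (P.symU_ne_zero hk.1) (P.symD_ne_zero hk.1)
    have hvd : P.IsSymbol ρ fun k =>
        -symC Z k ^ 2 / (symV k * (symC Z k ^ 2 - P.symU k ^ 2)) :=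
      ((isSymbol_symC.pow 2).neg).div (isSymbol_symV.mul isSymbol_symD) fun k hk =>
        mul_ne_zero (P.symV_ne_zero hk.1) (P.symD_ne_zero hk.1)
    intro i j
    fin_cases i <;> fin_cases j
    exacts [hd isSymbol_symU.neg, hd isSymbol_symV.neg, h0,
      hud ((isSymbol_symV.pow 2).mul isSymbol_symPS),
      hud ((isSymbol_symV.pow 2).mul isSymbol_symPlam),
      hvd, hd isSymbol_symU.neg, h0, hd (isSymbol_symV.mul isSymbol_symPS),
      hd (isSymbol_symV.mul isSymbol_symPlam),
      h0, h0, hu, h0, h0, h0, h0, h0, hu, h0, h0, h0, h0, h0, hu]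
  have hB : P.IsSymbolMatrix ρ fun k => cplx (P.stateB k.1) := by
    have h0 : P.IsSymbol ρ fun _ => ((0 : ℝ) : ℂ) := IsSymbol.const _
    have hp : ∀ k ∈ P.states, ContDiffAt ℝ ⊤ Z.p k := fun k hk =>
      Model.contDiffAt_p (P.states_subset_dom hk)
    have hr : ∀ k ∈ P.states, ContDiffAt ℝ ⊤ Z.r k := fun k hk =>
      Model.contDiffAt_r (P.states_subset_dom hk)
    have hΦ : ∀ k ∈ P.states, ContDiffAt ℝ ⊤ Z.entropySource k := fun k hk =>
      Model.contDiffAt_entropySource (P.states_subset_dom hk)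
    have hder : ∀ {f : State → ℝ}, (∀ k ∈ P.states, ContDiffAt ℝ ⊤ f k) →
        ∀ k ∈ P.states, ContDiffAt ℝ ⊤ (fun k => fderiv ℝ f k (P.field k)) k := fun hf k hk =>
      ((hf k hk).fderiv_right (by simp)).clm_apply (P.contDiffAt_field hk)
    have hpart : ∀ {f : State → ℝ}, (∀ k ∈ P.states, ContDiffAt ℝ ⊤ f k) → ∀ e : State,
        ∀ k ∈ P.states, ContDiffAt ℝ ⊤ (fun k => fderiv ℝ f k e) k := fun hf e k hk =>
      Model.contDiffAt_fderiv_apply (hf k hk) e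
    have hX₁ : ∀ k ∈ P.states, ContDiffAt ℝ ⊤ (fun k => (P.field k).1) k := fun k hk =>
      contDiffAt_fst.comp k (P.contDiffAt_field hk)
    have hX₂ : ∀ k ∈ P.states, ContDiffAt ℝ ⊤ (fun k => (P.field k).2.1) k := fun k hk =>
      contDiffAt_fst.comp k (contDiffAt_snd.comp k (P.contDiffAt_field hk))
    have hX₃ : ∀ k ∈ P.states, ContDiffAt ℝ ⊤ (fun k => (P.field k).2.2) k := fun k hk =>
      contDiffAt_snd.comp k (contDiffAt_snd.comp k (P.contDiffAt_field hk))
    have hv : ∀ {f : State → ℝ}, (∀ k ∈ P.states, ContDiffAt ℝ ⊤ f k) →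
        P.IsSymbol ρ fun k => ((k.1.1 * f k.1 : ℝ) : ℂ) := fun hf =>
      IsSymbol.ofReal (f := fun k => k.1 * _) fun k hk => contDiffAt_fst.mul (hf k hk)
    have hn : ∀ {f : State → ℝ}, (∀ k ∈ P.states, ContDiffAt ℝ ⊤ f k) →
        P.IsSymbol ρ fun k => ((-f k.1 : ℝ) : ℂ) := fun hf =>
      IsSymbol.ofReal (f := fun k => -_) fun k hk => (hf k hk).neg
    have hu : ∀ k ∈ P.states, ContDiffAt ℝ ⊤ (fun k => P.flux * (P.field k).1) k := fun k hk =>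
      contDiffAt_const.mul (hX₁ k hk)
    have h21 : P.IsSymbol ρ fun k => ((fderiv ℝ Z.p k.1 (P.field k.1)
        - k.1.1 * fderiv ℝ (fun q => Z.soundSq q / q.1 ^ 2) k.1 (P.field k.1) : ℝ) : ℂ) :=
      IsSymbol.ofReal (f := fun k => fderiv ℝ Z.p k (P.field k)
        - k.1 * fderiv ℝ (fun q => Z.soundSq q / q.1 ^ 2) k (P.field k)) fun k hk =>
        (hder hp k hk).sub (contDiffAt_fst.mul (hder (fun k hk => P.contDiffAt_soundSq_div hk) k hk))
    intro i j
    fin_cases i <;> fin_cases j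
    exacts [hn hu, IsSymbol.ofReal hX₁, h0, h0, h0,
      h21, IsSymbol.ofReal hu, h0, hv (hder (hpart hp _)), hv (hder (hpart hp _)),
      h0, h0, h0, h0, h0,
      hn (hpart hΦ _), IsSymbol.ofReal hX₂, h0, hn (hpart hΦ _), hn (hpart hΦ _),
      hn (hpart hr _), IsSymbol.ofReal hX₃, h0, hn (hpart hr _), hn (hpart hr _)]
  exact fun i j => (hInv.mul hB) j i

lemma isSymbol_sigma (hρ : P.Admissible ρ) : P.IsSymbol ρ P.sigma := by
  intro k hk
  have h1 : ContDiffAt ℝ ⊤ P.sigmaSq k :=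
    (((IsSymbol.const 1).add (isSymbol_symD.mul (IsSymbol.param₁.pow 2))) k hk)
  have h2 : ContDiffAt ℝ ⊤ Complex.log (P.sigmaSq k) :=
    (Complex.contDiffAt_log (Or.inl (hρ.sigmaSq_re_pos k hk))).restrict_scalars ℝ
  exact (contDiffAt_const.mul (h2.comp k h1)).cexp

lemma isSymbolMatrix_symLeft (hρ : P.Admissible ρ) : P.IsSymbolMatrix ρ P.symLeft := by
  have hσ := isSymbol_sigma hρ
  have h0 : P.IsSymbol ρ fun _ => (0 : ℂ) := IsSymbol.const 0
  have h1 : P.IsSymbol ρ fun _ => (1 : ℂ) := IsSymbol.const 1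
  have hU := isSymbol_symU (P := P) (ρ := ρ)
  have hC := isSymbol_symC (P := P) (ρ := ρ)
  have h2σ : P.IsSymbol ρ fun k => 2 * P.sigma k := (IsSymbol.const 2).mul hσ
  have h2σ0 : ∀ k : State × ℂ × ℂ, 2 * P.sigma k ≠ 0 := fun k =>
    mul_ne_zero two_ne_zero sigma_ne_zero
  have hsc : ∀ {f : State × ℂ × ℂ → ℂ}, P.IsSymbol ρ f →
      P.IsSymbol ρ fun k => f k / (2 * P.sigma k * symC Z k) := fun hf =>
    hf.div (h2σ.mul hC) fun k hk => mul_ne_zero (h2σ0 k) (P.symC_ne_zero hk.1)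
  have hp : ∀ {f : State × ℂ × ℂ → ℂ}, P.IsSymbol ρ f →
      P.IsSymbol ρ fun k => f k / (2 * P.sigma k * (symC Z k + P.symU k * P.sigma k)) :=
    fun hf => hf.div (h2σ.mul (hC.add (hU.mul hσ))) fun k hk =>
      mul_ne_zero (h2σ0 k) (hρ.plus_ne_zero k hk)
  have hm : ∀ {f : State × ℂ × ℂ → ℂ}, P.IsSymbol ρ f →
      P.IsSymbol ρ fun k => f k / (2 * P.sigma k * (symC Z k - P.symU k * P.sigma k)) :=
    fun hf => hf.div (h2σ.mul (hC.sub (hU.mul hσ))) fun k hk =>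
      mul_ne_zero (h2σ0 k) (hρ.minus_ne_zero k hk)
  have hn : ∀ {f : State × ℂ × ℂ → ℂ}, P.IsSymbol ρ f →
      P.IsSymbol ρ fun k => f k / (1 - k.2.1 ^ 2 * P.symU k ^ 2) :=
    fun hf => hf.div (h1.sub ((IsSymbol.param₁.pow 2).mul (hU.pow 2))) hρ.vortical_ne_zero
  have hcc : ∀ {f : State × ℂ × ℂ → ℂ}, P.IsSymbol ρ f →
      P.IsSymbol ρ fun k => f k / symC Z k ^ 2 := fun hf =>
    hf.div (hC.pow 2) fun k hk => pow_ne_zero 2 (P.symC_ne_zero hk.1)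
  have hi : P.IsSymbol ρ fun k => Complex.I * k.2.1 * P.symU k :=
    ((IsSymbol.const _).mul IsSymbol.param₁).mul hU
  intro i j
  fin_cases i <;> fin_cases j
  exacts [hsc (hU.mul isSymbol_symV), hp (hU.mul (hU.add (hC.mul hσ))),
    hp (hi.mul isSymbol_symD), h0, h0,
    hsc (hU.mul isSymbol_symV).neg, hm (hU.mul (hU.sub (hC.mul hσ))).neg,
    hm (hi.mul isSymbol_symD).neg, h0, h0,
    h0, hn hi, hn h1, h0, h0,
    hcc ((isSymbol_symV.pow 2).mul isSymbol_symPS), h0, h0, h1, h0,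
    hcc ((isSymbol_symV.pow 2).mul isSymbol_symPlam), h0, h0, h0, h1]

lemma isSymbolMatrix_symRight (hρ : P.Admissible ρ) : P.IsSymbolMatrix ρ P.symRight := by
  have hσ := isSymbol_sigma hρ
  have h0 : P.IsSymbol ρ fun _ => (0 : ℂ) := IsSymbol.const 0
  have h1 : P.IsSymbol ρ fun _ => (1 : ℂ) := IsSymbol.const 1
  have hU := isSymbol_symU (P := P) (ρ := ρ)
  have hC := isSymbol_symC (P := P) (ρ := ρ)
  have hV := isSymbol_symV (P := P) (ρ := ρ)
  have huv : ∀ {f : State × ℂ × ℂ → ℂ}, P.IsSymbol ρ f →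
      P.IsSymbol ρ fun k => f k / (P.symU k * symV k) := fun hf =>
    hf.div (hU.mul hV) fun k hk => mul_ne_zero (P.symU_ne_zero hk.1) (P.symV_ne_zero hk.1)
  have hcu : ∀ {f : State × ℂ × ℂ → ℂ}, P.IsSymbol ρ f →
      P.IsSymbol ρ fun k => f k / (symC Z k * P.symU k) := fun hf =>
    hf.div (hC.mul hU) fun k hk => mul_ne_zero (P.symC_ne_zero hk.1) (P.symU_ne_zero hk.1)
  have hu : P.IsSymbol ρ fun k => 1 / P.symU k := h1.div hU fun k hk => P.symU_ne_zero hk.1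
  have hi : P.IsSymbol ρ fun k => Complex.I * k.2.1 := (IsSymbol.const _).mul IsSymbol.param₁
  have h02 : P.IsSymbol ρ fun k => -(Complex.I * k.2.1 * symC Z k ^ 2) / symV k :=
    (hi.mul (hC.pow 2)).neg.div hV fun k hk => P.symV_ne_zero hk.1
  intro i j
  fin_cases i <;> fin_cases j
  exacts [huv (hC.mul hσ), huv (hC.mul hσ).neg, h02, h0, h0,
    hu, hu, hi.mul hU, h0, h0,
    hi.neg, hi.neg, h1, h0, h0,
    hcu ((hV.mul isSymbol_symPS).mul hσ).neg, hcu ((hV.mul isSymbol_symPS).mul hσ),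
    (hi.mul hV).mul isSymbol_symPS, h1, h0,
    hcu ((hV.mul isSymbol_symPlam).mul hσ).neg, hcu ((hV.mul isSymbol_symPlam).mul hσ),
    (hi.mul hV).mul isSymbol_symPlam, h0, h1]

lemma isSymbol_coupling (hρ : P.Admissible ρ) (j : Fin 5) :
    P.IsSymbol ρ fun k => P.coupling k j :=
  IsSymbol.sum fun i _ => (IsSymbol.const _).mul (isSymbolMatrix_symRight hρ i j)

lemma isSymbol_gap₀ (hρ : P.Admissible ρ) : P.IsSymbol ρ P.gap₀ :=
  (isSymbol_symC.mul (isSymbol_symC.add (isSymbol_symU.mul (isSymbol_sigma hρ)))).div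
    (isSymbol_symU.mul isSymbol_symD) fun _ hk =>
      mul_ne_zero (P.symU_ne_zero hk.1) (P.symD_ne_zero hk.1)

lemma isSymbol_gap₁ (hρ : P.Admissible ρ) : P.IsSymbol ρ P.gap₁ :=
  (isSymbol_symC.mul (isSymbol_symC.sub (isSymbol_symU.mul (isSymbol_sigma hρ)))).div
    (isSymbol_symU.mul isSymbol_symD) fun _ hk =>
      mul_ne_zero (P.symU_ne_zero hk.1) (P.symD_ne_zero hk.1)

lemma isSymbol_endRate : P.IsSymbol ρ fun k => k.2.2 * P.endRate :=
  IsSymbol.param₂.mul (IsSymbol.const _)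

/-- The first shear coefficient is `ε` times this bounded ratio, so the shear displaces the first
eigenvector only by `O(|ε|)`. The coefficients inside the triple eigenvalue carry no factor `ε`, but
they do not affect the first column. -/
lemma isSymbol_shearRatio (hρ : P.Admissible ρ) :
    P.IsSymbol ρ fun k => P.coupling k 0 / (P.gap₀ k + k.2.2 * P.endRate) :=
  (isSymbol_coupling hρ 0).div ((isSymbol_gap₀ hρ).add isSymbol_endRate) hρ.gap₀_ne_zero

lemma isSymbol_shearCoeff (hρ : P.Admissible ρ) (j : Fin 4) :
    P.IsSymbol ρ fun k => P.shearCoeff k j := by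
  have hβ : ∀ k ∈ P.paramSet ρ, (P.endRate : ℂ) ≠ 0 := fun _ _ =>
    Complex.ofReal_ne_zero.2 P.endRate_pos.ne'
  fin_cases j
  exacts [IsSymbol.param₂.mul (isSymbol_shearRatio hρ),
    IsSymbol.param₂.mul ((isSymbol_coupling hρ 1).div
      ((isSymbol_gap₁ hρ).add isSymbol_endRate) hρ.gap₁_ne_zero),
    (isSymbol_coupling hρ 2).div (IsSymbol.const _) hβ,
    (isSymbol_coupling hρ 3).div (IsSymbol.const _) hβ]

lemma isSymbolMatrix_shear {d : State × ℂ × ℂ → Fin 4 → ℂ}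
    (hd : ∀ j, P.IsSymbol ρ fun k => d k j) : P.IsSymbolMatrix ρ fun k => shear (d k) := by
  have h0 : P.IsSymbol ρ fun _ => (0 : ℂ) := IsSymbol.const 0
  have h1 : P.IsSymbol ρ fun _ => (1 : ℂ) := IsSymbol.const 1
  intro i j
  fin_cases i <;> fin_cases j
  exacts [h1, h0, h0, h0, h0, h0, h1, h0, h0, h0, h0, h0, h1, h0, h0, h0, h0, h0, h1, h0,
    hd 0, hd 1, hd 2, hd 3, h1]

lemma isSymbolMatrix_symL (hρ : P.Admissible ρ) : P.IsSymbolMatrix ρ P.symL :=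
  (isSymbolMatrix_shear (isSymbol_shearCoeff hρ)).mul (isSymbolMatrix_symLeft hρ)

lemma isSymbolMatrix_symQ (hρ : P.Admissible ρ) : P.IsSymbolMatrix ρ P.symQ :=
  (isSymbolMatrix_symRight hρ).mul
    (isSymbolMatrix_shear fun j => (isSymbol_shearCoeff hρ j).neg)

lemma symLeft_mul_symRight (hρ : P.Admissible ρ) {k : State × ℂ × ℂ} (hk : k ∈ P.paramSet ρ) :
    P.symLeft k * P.symRight k = 1 :=
  leftEigen_mul_rightEigen (P.symV_ne_zero hk.1) (P.symU_ne_zero hk.1) (P.symC_ne_zero hk.1)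
    sigma_ne_zero (hρ.plus_ne_zero k hk) (hρ.minus_ne_zero k hk) (hρ.vortical_ne_zero k hk)
    (P.sigma_sq (hρ.sigmaSq_re_pos k hk))

lemma symL_mul_symQ (hρ : P.Admissible ρ) {k : State × ℂ × ℂ} (hk : k ∈ P.paramSet ρ) :
    P.symL k * P.symQ k = 1 := by
  rw [symL, symQ, Matrix.mul_assoc, ← Matrix.mul_assoc (P.symLeft k), symLeft_mul_symRight hρ hk,
    Matrix.one_mul, shear_mul_shear_neg]

lemma symQ_mul_symL (hρ : P.Admissible ρ) {k : State × ℂ × ℂ} (hk : k ∈ P.paramSet ρ) :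
    P.symQ k * P.symL k = 1 := mul_eq_one_comm.1 (symL_mul_symQ hρ hk)

lemma isSymbol_symEigen (hρ : P.Admissible ρ) (i : Fin 5) :
    P.IsSymbol ρ fun k => P.symEigen k i := by
  have hσ := isSymbol_sigma hρ
  have hu : P.IsSymbol ρ fun k => 1 / P.symU k :=
    (IsSymbol.const 1).div isSymbol_symU fun k hk => P.symU_ne_zero hk.1
  fin_cases i
  exacts [(isSymbol_symU.add (isSymbol_symC.mul hσ)).neg.div isSymbol_symD
      fun k hk => P.symD_ne_zero hk.1,
    (isSymbol_symU.sub (isSymbol_symC.mul hσ)).neg.div isSymbol_symD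
      fun k hk => P.symD_ne_zero hk.1, hu, hu, hu.add isSymbol_endRate]

end Profile

end ZND

/-! ### Reduction of the system to diagonal form plus a decaying remainder. -/

namespace ZND

namespace Profile

variable {Z : Model} {P : Profile Z}

lemma field_qInf : P.field P.qInf = 0 := by
  have h : Z.r P.qInf = 0 := Z.r_zero _ _ P.inf_mem_dom
  rw [field, h, zero_smul]

lemma along_eq {f : State → ℝ} {x : ℝ} (hx : 0 ≤ x) (hf : ContDiffAt ℝ ⊤ f (P.q x)) :
    dx (fun y => f (P.q y)) x = fderiv ℝ f (P.q x) (P.field (P.q x)) :=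
  dx_eq hx (P.hasDerivWithinAt_comp_q hx (hf.differentiableAt (by simp)))

lemma B_eq_stateB {x : ℝ} (hx : 0 ≤ x) : P.B x = P.stateB (P.q x) := by
  have hk := P.q_mem_states hx
  have hp := Model.contDiffAt_p (P.states_subset_dom hk)
  have hX := P.field_q hx
  have h1 : dx P.v x = (P.field (P.q x)).1 := congrArg Prod.fst hX
  have h2 : dx P.S x = (P.field (P.q x)).2.1 := congrArg (fun y => y.2.1) hX
  have h3 : dx P.lam x = (P.field (P.q x)).2.2 := congrArg (fun y => y.2.2) hX
  have hu : dx P.u x = P.flux * (P.field (P.q x)).1 := by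
    rw [← h1]
    exact dx_eq hx (((hasDerivWithinAt_dx P.analytic_v hx).const_mul P.flux).congr
      (fun y hy => P.u_eq hy) (P.u_eq hx))
  have h4 : P.along Z.p x = fderiv ℝ Z.p (P.q x) (P.field (P.q x)) := along_eq hx hp
  have h5 : P.along (dS Z.p) x = fderiv ℝ (dS Z.p) (P.q x) (P.field (P.q x)) :=
    along_eq hx (Model.contDiffAt_fderiv_apply hp _)
  have h6 : P.along (dlam Z.p) x = fderiv ℝ (dlam Z.p) (P.q x) (P.field (P.q x)) :=
    along_eq hx (Model.contDiffAt_fderiv_apply hp _)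
  have h7 : dx (fun y => P.cSq y / P.v y ^ 2) x
      = fderiv ℝ (fun q : State => Z.soundSq q / q.1 ^ 2) (P.q x) (P.field (P.q x)) :=
    along_eq hx (P.contDiffAt_soundSq_div hk)
  have h8 : P.v x = (P.q x).1 := rfl
  rw [B, stateB, h1, h2, h3, hu, h4, h5, h6, h7, h8]

lemma symPhi1_eq {x : ℝ} (hx : 0 ≤ x) (ω ε : ℂ) : P.symPhi1 (P.q x, ω, ε) = P.Phi1 x := by
  have hu : P.symU (P.q x, ω, ε) = (P.u x : ℂ) := by rw [P.u_eq hx]; rfl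
  rw [Phi1, symPhi1, P.inv_cplx_Ax hx, B_eq_stateB hx, hu]
  rfl

lemma dv_entropySource_qInf : dv Z.entropySource P.qInf = 0 := by
  have h1 : dv Z.r P.qInf = 0 := Z.dv_r_zero _ _ P.inf_mem_dom
  rw [dv] at h1 ⊢
  rw [qInf, Model.hasFDerivAt_entropySource_zero _ _ P.inf_mem_dom, ← qInf,
    smul_apply, h1, smul_zero]

lemma dS_entropySource_qInf : dS Z.entropySource P.qInf = 0 := by
  have h1 : dS Z.r P.qInf = 0 := Z.dS_r_zero _ _ P.inf_mem_dom
  rw [dS] at h1 ⊢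
  rw [qInf, Model.hasFDerivAt_entropySource_zero _ _ P.inf_mem_dom, ← qInf,
    smul_apply, h1, smul_zero]

/-- At the end state the profile is stationary and the source terms depend on `λ` alone to first
order, so `B` has a single nonzero column, the last; transposition turns it into a row. -/
lemma symPhi1_qInf (ω ε : ℂ) : P.symPhi1 (P.qInf, ω, ε) = lastRow P.endRow := by
  have h1 : dv Z.r P.qInf = 0 := Z.dv_r_zero _ _ P.inf_mem_dom
  have h2 : dS Z.r P.qInf = 0 := Z.dS_r_zero _ _ P.inf_mem_dom
  have h : ∀ i j, i ≠ 4 → P.symPhi1 (P.qInf, ω, ε) i j = 0 := by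
    intro i j hi
    rw [symPhi1, Matrix.transpose_apply, Matrix.mul_apply]
    refine Finset.sum_eq_zero fun l _ => ?_
    have : cplx (P.stateB P.qInf) l i = 0 := by
      simp only [cplx, stateB, field_qInf, dv_entropySource_qInf, dS_entropySource_qInf, h1, h2]
      fin_cases l <;> fin_cases i <;> simp at hi ⊢
    rw [this, mul_zero]
  ext i j
  by_cases hi : i = 4
  · subst hi
    simp only [lastRow, Matrix.of_apply, if_true]
    rfl
  · simp only [lastRow, Matrix.of_apply, hi, if_false]
    exact h i j hi

lemma endRow_four : P.endRow 4 = P.endRate := by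
  rw [endRow, symPhi1, Matrix.transpose_apply, Matrix.mul_apply, Fin.sum_univ_five]
  simp [matAxInv, cplx, stateB, symU, endRate, qInf]
  ring

/-- The row is frozen at the end state while the eigenvectors are those at the current state; with
this mixture the shear is exact everywhere and only `Φ₁ - Φ₁(∞)` is left over. -/
lemma lastRow_endRow {ρ : ℝ} (hρ : P.Admissible ρ) {k : State × ℂ × ℂ}
    (hk : k ∈ P.paramSet ρ) : lastRow P.endRow = lastRow (P.coupling k) * P.symLeft k := by
  have h : lastRow P.endRow * P.symRight k = lastRow (P.coupling k) := lastRow_mul _ _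
  rw [← h, Matrix.mul_assoc, mul_eq_one_comm.1 (symLeft_mul_symRight hρ hk), Matrix.mul_one]

lemma coupling_four (k : State × ℂ × ℂ) : P.coupling k 4 = P.endRate := by
  simp [coupling, symRight_last, endRow_four]

lemma inv_sub_symEigen {k : State × ℂ × ℂ} (hk : k.1 ∈ P.states) :
    1 / P.symU k - P.symEigen k 0 = P.gap₀ k ∧ 1 / P.symU k - P.symEigen k 1 = P.gap₁ k := by
  have hu := P.symU_ne_zero hk
  have hD := P.symD_ne_zero hk
  constructor
  · simp only [symEigen, gap₀, Matrix.cons_val_zero]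
    field_simp
    ring
  · simp only [symEigen, gap₁, Matrix.cons_val_one, Matrix.cons_val_zero]
    field_simp
    ring

/-- The difference between `Φ₁` and its limit. -/
def symF (P : Profile Z) (k : State × ℂ × ℂ) : Matrix (Fin 5) (Fin 5) ℂ :=
  P.symPhi1 k - lastRow P.endRow

/-- `symL` diagonalizes `Φ₀ / h + Φ₁` up to terms decaying along the profile. -/
lemma symL_mul_system {ρ : ℝ} (hρ : P.Admissible ρ) {x h : ℝ} {ζ ω ε : ℂ} (hx : 0 ≤ x)
    (hω : ‖ω‖ ≤ ρ) (hε : ‖ε‖ ≤ ρ) (hζ : ζ * ω = 1) (hh : ε * ζ = h) (hh0 : h ≠ 0) :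
    P.symL (P.q x, ω, ε) * (((1 / h : ℝ) : ℂ) • P.Phi0 x ζ + P.Phi1 x)
      = Matrix.diagonal (fun i => P.symEigen (P.q x, ω, ε) i / ε) * P.symL (P.q x, ω, ε)
        + P.symL (P.q x, ω, ε) * P.symF (P.q x, ω, ε) := by
  set k : State × ℂ × ℂ := (P.q x, ω, ε) with hk'
  have hk : k ∈ P.paramSet ρ := P.mem_paramSet (P.q_mem_states hx) hω hε
  have hh0' : (h : ℂ) ≠ 0 := Complex.ofReal_ne_zero.2 hh0
  have hε0 : ε ≠ 0 := fun h0 => hh0' (by rw [← hh, h0, zero_mul])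
  have hβ : (P.endRate : ℂ) ≠ 0 := Complex.ofReal_ne_zero.2 P.endRate_pos.ne'
  have hu : P.symU k = (P.u x : ℂ) := by rw [P.u_eq hx]; rfl
  have hL0 : P.symLeft k * P.Phi0 x ζ
      = (ζ • Matrix.diagonal (eigenvalue (P.symU k) (symC Z k) (P.sigma k))) * P.symLeft k := by
    have := P.leftEigen_mul_Phi0 hx hζ (σ := P.sigma k) sigma_ne_zero
      (by rw [← hu]; exact hρ.plus_ne_zero k hk) (by rw [← hu]; exact hρ.minus_ne_zero k hk)
      (by rw [← hu]; exact hρ.vortical_ne_zero k hk)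
      (by rw [← hu]; exact P.sigma_sq (hρ.sigmaSq_re_pos k hk))
    rw [← hu] at this
    exact this
  have hscal : ((1 / h : ℝ) : ℂ) * ζ = 1 / ε := by
    push_cast
    rw [← hh]
    have : ζ ≠ 0 := left_ne_zero_of_mul_eq_one hζ
    field_simp
  have hdiag : ((1 / h : ℝ) : ℂ) • (ζ • Matrix.diagonal
      (eigenvalue (P.symU k) (symC Z k) (P.sigma k)))
      = Matrix.diagonal ![P.symEigen k 0 / ε, P.symEigen k 1 / ε, 1 / P.symU k / ε,
        1 / P.symU k / ε, 1 / P.symU k / ε] := by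
    rw [smul_smul, hscal, ← Matrix.diagonal_smul]
    congr 1
    ext i
    fin_cases i <;> simp [eigenvalue, symEigen] <;> ring
  have hε2 : k.2.2 = ε := rfl
  have hg := inv_sub_symEigen hk.1
  -- The eigenvalue differences are `gap / ε + endRate`, or `endRate` inside the triple eigenvalue.
  -- Clearing `ε` explains the form `ε · coupling / (gap + ε endRate)` of the first two
  -- coefficients.
  have htri := shear_mul_triangular (d := P.shearCoeff k) (l₀ := P.symEigen k 0 / ε)
    (l₁ := P.symEigen k 1 / ε) (l₂ := 1 / P.symU k / ε) (b := P.coupling k)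
    (by
      have h0 := hρ.gap₀_ne_zero k hk
      rw [coupling_four, eq_add_of_sub_eq hg.1]
      simp only [shearCoeff, Matrix.cons_val_zero, hε2] at h0 ⊢
      field_simp
      ring)
    (by
      have h0 := hρ.gap₁_ne_zero k hk
      rw [coupling_four, eq_add_of_sub_eq hg.2]
      simp only [shearCoeff, Matrix.cons_val_one, Matrix.cons_val_zero, hε2] at h0 ⊢
      field_simp
      ring)
    (by
      rw [coupling_four]
      simp only [shearCoeff, Matrix.cons_val]
      field_simp)
    (by
      rw [coupling_four]
      simp only [shearCoeff, Matrix.cons_val]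
      field_simp)
  have hμ : Matrix.diagonal (fun i => P.symEigen k i / ε)
      = Matrix.diagonal ![P.symEigen k 0 / ε, P.symEigen k 1 / ε, 1 / P.symU k / ε,
        1 / P.symU k / ε, 1 / P.symU k / ε + P.coupling k 4] := by
    congr 1
    ext i
    rw [coupling_four]
    fin_cases i <;> simp [symEigen, hε2]
    field_simp
  have hE : P.symLeft k * lastRow P.endRow = lastRow P.endRow := leftEigen_mul_lastRow _
  have hΦ1 : P.Phi1 x = lastRow P.endRow + P.symF k := by
    rw [symF, symPhi1_eq hx, add_sub_cancel]
  rw [hΦ1, ← add_assoc, Matrix.mul_add]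
  congr 1
  rw [hμ, symL, ← Matrix.mul_assoc, ← htri, Matrix.mul_assoc, Matrix.mul_assoc]
  congr 1
  rw [Matrix.mul_add, Matrix.add_mul, hE, ← lastRow_endRow hρ hk, ← hdiag, Matrix.mul_smul, hL0]
  simp only [Matrix.smul_mul]

/-- The remainder of the diagonalized system. -/
def symR (P : Profile Z) (k : State × ℂ × ℂ) : Matrix (Fin 5) (Fin 5) ℂ :=
  ((Matrix.of fun i j => P.transport (fun k => P.symL k i j) k) + P.symL k * P.symF k) * P.symQ k

lemma isSymbol_symF {ρ : ℝ} (i j : Fin 5) : P.IsSymbol ρ fun k => P.symF k i j :=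
  (isSymbolMatrix_symPhi1 i j).sub (IsSymbol.const _)

lemma decaysAlong_symF {ρ : ℝ} (i j : Fin 5) : P.DecaysAlong ρ fun k => P.symF k i j :=
  (isSymbol_symF i j).decaysAlong fun ω ε _ _ => by
    simp [symF, symPhi1_qInf]

lemma isSymbol_symR {ρ : ℝ} (hρ : P.Admissible ρ) (i j : Fin 5) :
    P.IsSymbol ρ fun k => P.symR k i j := by
  have h1 : P.IsSymbolMatrix ρ fun k => ((Matrix.of fun i j =>
      P.transport (fun k => P.symL k i j) k) + P.symL k * P.symF k) := fun i j =>
    (isSymbolMatrix_symL hρ i j).transport.add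
      (((isSymbolMatrix_symL hρ).mul fun i j => isSymbol_symF i j) i j)
  exact (h1.mul (isSymbolMatrix_symQ hρ)) i j

lemma decaysAlong_symR {ρ : ℝ} (hρ : P.Admissible ρ) (i j : Fin 5) :
    P.DecaysAlong ρ fun k => P.symR k i j := by
  simp only [symR, Matrix.mul_apply, Matrix.add_apply, Matrix.of_apply]
  refine DecaysAlong.sum fun l _ => DecaysAlong.mul_symbol ?_ (isSymbolMatrix_symQ hρ l j)
  exact (isSymbolMatrix_symL hρ i l).decaysAlong_transport.add
    (DecaysAlong.sum fun n _ => DecaysAlong.symbol_mul (isSymbolMatrix_symL hρ i n)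
      (decaysAlong_symF n l))

end Profile

end ZND

/-! ### Transfer of solutions between the original and the diagonalized system. -/

namespace ZND

namespace Profile

variable {Z : Model} {P : Profile Z}

lemma hasDerivWithinAt_C5 {θ : ℝ → C5} {θ' : Fin 5 → ℂ} {s : Set ℝ} {x : ℝ} :
    HasDerivWithinAt θ (WithLp.toLp 2 θ') s x ↔
      HasDerivWithinAt (fun y => (θ y).ofLp) θ' s x := by
  constructor
  · intro h
    exact ((PiLp.continuousLinearEquiv 2 ℝ fun _ : Fin 5 => ℂ).hasFDerivAt).comp_hasDerivWithinAt
      x h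
  · intro h
    exact ((PiLp.continuousLinearEquiv 2 ℝ fun _ : Fin 5 => ℂ).symm.hasFDerivAt
      ).comp_hasDerivWithinAt x h

lemma hasDerivWithinAt_mulVec {A : ℝ → Matrix (Fin 5) (Fin 5) ℂ} {A' : Matrix (Fin 5) (Fin 5) ℂ}
    {w : ℝ → Fin 5 → ℂ} {w' : Fin 5 → ℂ} {s : Set ℝ} {x : ℝ}
    (hA : ∀ i j, HasDerivWithinAt (fun y => A y i j) (A' i j) s x)
    (hw : HasDerivWithinAt w w' s x) :
    HasDerivWithinAt (fun y => (A y).mulVec (w y)) (A'.mulVec (w x) + (A x).mulVec w') s x := by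
  refine hasDerivWithinAt_pi.2 fun i => ?_
  have hw' := hasDerivWithinAt_pi.1 hw
  have h := HasDerivWithinAt.fun_sum (u := Finset.univ) fun j _ => (hA i j).mul (hw' j)
  refine h.congr_deriv ?_
  simp only [Finset.sum_add_distrib, Pi.add_apply, Matrix.mulVec, dotProduct]

/-- The matrix of the system. -/
def systemMatrix (P : Profile Z) (ζ : ℂ) (h x : ℝ) : Matrix (Fin 5) (Fin 5) ℂ :=
  ((1 / h : ℝ) : ℂ) • P.Phi0 x ζ + P.Phi1 x

variable {ρ h x : ℝ} {ζ ω ε : ℂ}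

/-- The derivative of `symL` along the profile. -/
def symLDeriv (P : Profile Z) (k : State × ℂ × ℂ) : Matrix (Fin 5) (Fin 5) ℂ :=
  Matrix.of fun i j => P.transport (fun k => P.symL k i j) k

/-- The derivative of `symQ` along the profile. -/
def symQDeriv (P : Profile Z) (k : State × ℂ × ℂ) : Matrix (Fin 5) (Fin 5) ℂ :=
  Matrix.of fun i j => P.transport (fun k => P.symQ k i j) k

/-- Differentiate `L Q = 1` along the profile; uniqueness of one-sided derivatives on the half-line
gives `L' Q + L Q' = 0`. -/
lemma symQDeriv_eq (hρ : P.Admissible ρ) (hx : 0 ≤ x) (hω : ‖ω‖ ≤ ρ) (hε : ‖ε‖ ≤ ρ) :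
    P.symQDeriv (P.q x, ω, ε)
      = -(P.symQ (P.q x, ω, ε) * P.symLDeriv (P.q x, ω, ε) * P.symQ (P.q x, ω, ε)) := by
  have hk : ∀ {y : ℝ}, 0 ≤ y → (P.q y, ω, ε) ∈ P.paramSet ρ := fun hy =>
    P.mem_paramSet (P.q_mem_states hy) hω hε
  have h : P.symLDeriv (P.q x, ω, ε) * P.symQ (P.q x, ω, ε)
      + P.symL (P.q x, ω, ε) * P.symQDeriv (P.q x, ω, ε) = 0 := by
    ext i j
    have hd := HasDerivWithinAt.fun_sum (u := Finset.univ) fun l _ =>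
      ((isSymbolMatrix_symL hρ i l).hasDerivWithinAt hx hω hε).mul
      ((isSymbolMatrix_symQ hρ l j).hasDerivWithinAt hx hω hε)
    have hc : HasDerivWithinAt (fun _ : ℝ => (1 : Matrix (Fin 5) (Fin 5) ℂ) i j) 0 (Ici 0) x :=
      hasDerivWithinAt_const _ _ _
    have he := hd.congr (f₁ := fun _ : ℝ => (1 : Matrix (Fin 5) (Fin 5) ℂ) i j)
      (fun y hy => by rw [← symL_mul_symQ hρ (hk hy)]; rfl)
      (by rw [← symL_mul_symQ hρ (hk hx)]; rfl)
    have hu := (uniqueDiffOn_Ici (0 : ℝ) x hx).eq_deriv _ he hc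
    rw [Finset.sum_add_distrib] at hu
    exact hu
  calc P.symQDeriv (P.q x, ω, ε)
      = P.symQ (P.q x, ω, ε) * (P.symL (P.q x, ω, ε) * P.symQDeriv (P.q x, ω, ε)) := by
        rw [← Matrix.mul_assoc, symQ_mul_symL hρ (hk hx), Matrix.one_mul]
    _ = _ := by rw [eq_neg_of_add_eq_zero_right h, Matrix.mul_neg, ← Matrix.mul_assoc]

lemma hasDerivWithinAt_symL_mulVec (hρ : P.Admissible ρ) (hx : 0 ≤ x)
    (hω : ‖ω‖ ≤ ρ) (hε : ‖ε‖ ≤ ρ) (hζ : ζ * ω = 1) (hh : ε * ζ = h) (hh0 : h ≠ 0)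
    {θ : ℝ → Fin 5 → ℂ}
    (hθ : HasDerivWithinAt θ ((P.systemMatrix ζ h x).mulVec (θ x)) (Ici 0) x) (i : Fin 5) :
    HasDerivWithinAt (fun y => (P.symL (P.q y, ω, ε)).mulVec (θ y) i)
      (P.symEigen (P.q x, ω, ε) i / ε * (P.symL (P.q x, ω, ε)).mulVec (θ x) i
        + ∑ j, P.symR (P.q x, ω, ε) i j * (P.symL (P.q x, ω, ε)).mulVec (θ x) j) (Ici 0) x := by
  have hk := P.mem_paramSet (ρ := ρ) (P.q_mem_states hx) hω hε
  have hd := hasDerivWithinAt_mulVec (A := fun y => P.symL (P.q y, ω, ε))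
    (A' := P.symLDeriv (P.q x, ω, ε))
    (fun i j => (isSymbolMatrix_symL hρ i j).hasDerivWithinAt hx hω hε) hθ
  refine (hasDerivWithinAt_pi.1 hd i).congr_deriv ?_
  have hsys := symL_mul_system hρ hx hω hε hζ hh hh0
  have e1 : (P.symL (P.q x, ω, ε)).mulVec ((P.systemMatrix ζ h x).mulVec (θ x))
      = (Matrix.diagonal fun i => P.symEigen (P.q x, ω, ε) i / ε).mulVec
          ((P.symL (P.q x, ω, ε)).mulVec (θ x))
        + (P.symL (P.q x, ω, ε) * P.symF (P.q x, ω, ε)).mulVec (θ x) := by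
    rw [Matrix.mulVec_mulVec, systemMatrix, hsys, Matrix.add_mulVec, Matrix.mulVec_mulVec]
  have e2 : (P.symR (P.q x, ω, ε)).mulVec ((P.symL (P.q x, ω, ε)).mulVec (θ x))
      = (P.symLDeriv (P.q x, ω, ε)).mulVec (θ x)
        + (P.symL (P.q x, ω, ε) * P.symF (P.q x, ω, ε)).mulVec (θ x) := by
    rw [Matrix.mulVec_mulVec, symR, Matrix.mul_assoc, symQ_mul_symL hρ hk, Matrix.mul_one,
      Matrix.add_mulVec]
    rfl
  change _ = _ + (P.symR (P.q x, ω, ε)).mulVec ((P.symL (P.q x, ω, ε)).mulVec (θ x)) i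
  rw [e1, e2]
  simp only [Pi.add_apply, Matrix.mulVec_diagonal]
  ring

lemma hasDerivWithinAt_symQ_mulVec (hρ : P.Admissible ρ) (hx : 0 ≤ x)
    (hω : ‖ω‖ ≤ ρ) (hε : ‖ε‖ ≤ ρ) (hζ : ζ * ω = 1) (hh : ε * ζ = h) (hh0 : h ≠ 0)
    {w : ℝ → Fin 5 → ℂ}
    (hw : ∀ i, HasDerivWithinAt (fun y => w y i) (P.symEigen (P.q x, ω, ε) i / ε * w x i
        + ∑ j, P.symR (P.q x, ω, ε) i j * w x j) (Ici 0) x) :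
    HasDerivWithinAt (fun y => (P.symQ (P.q y, ω, ε)).mulVec (w y))
      ((P.systemMatrix ζ h x).mulVec ((P.symQ (P.q x, ω, ε)).mulVec (w x))) (Ici 0) x := by
  have hk := P.mem_paramSet (ρ := ρ) (P.q_mem_states hx) hω hε
  have hw' : HasDerivWithinAt w
      ((Matrix.diagonal fun i => P.symEigen (P.q x, ω, ε) i / ε).mulVec (w x)
        + (P.symR (P.q x, ω, ε)).mulVec (w x)) (Ici 0) x := by
    refine hasDerivWithinAt_pi.2 fun i => (hw i).congr_deriv ?_
    simp only [Pi.add_apply, Matrix.mulVec_diagonal]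
    rfl
  have hd := hasDerivWithinAt_mulVec (A := fun y => P.symQ (P.q y, ω, ε))
    (A' := P.symQDeriv (P.q x, ω, ε))
    (fun i j => (isSymbolMatrix_symQ hρ i j).hasDerivWithinAt hx hω hε) hw'
  refine hd.congr_deriv ?_
  have hsys := symL_mul_system hρ hx hω hε hζ hh hh0
  change _ * P.systemMatrix ζ h x = _ at hsys
  have hQL := symQ_mul_symL hρ hk
  have hLQ := symL_mul_symQ hρ hk
  rw [symQDeriv_eq hρ hx hω hε]
  have hR : P.symR (P.q x, ω, ε) = (P.symLDeriv (P.q x, ω, ε)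
      + P.symL (P.q x, ω, ε) * P.symF (P.q x, ω, ε)) * P.symQ (P.q x, ω, ε) := rfl
  rw [hR]
  generalize P.symQ (P.q x, ω, ε) = Q at *
  generalize P.symL (P.q x, ω, ε) = L at *
  generalize P.symLDeriv (P.q x, ω, ε) = L' at *
  generalize P.symF (P.q x, ω, ε) = F at *
  generalize (Matrix.diagonal fun i => P.symEigen (P.q x, ω, ε) i / ε) = D at *
  generalize P.systemMatrix ζ h x = A at *
  have key : Q * D = A * Q - F * Q := by
    have h1 : D = L * A * Q - L * F * Q := by
      rw [hsys, Matrix.add_mul, add_sub_cancel_right, Matrix.mul_assoc, hLQ, Matrix.mul_one]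
    rw [h1, Matrix.mul_sub, ← Matrix.mul_assoc, ← Matrix.mul_assoc, hQL, Matrix.one_mul,
      ← Matrix.mul_assoc, ← Matrix.mul_assoc, hQL, Matrix.one_mul]
  have key2 : Q * ((L' + L * F) * Q) = Q * L' * Q + F * Q := by
    rw [Matrix.add_mul, Matrix.mul_add, Matrix.mul_assoc L, ← Matrix.mul_assoc Q L, hQL,
      Matrix.one_mul, ← Matrix.mul_assoc]
  rw [Matrix.mulVec_add, Matrix.mulVec_mulVec, Matrix.mulVec_mulVec, Matrix.mulVec_mulVec, key,
    key2, ← Matrix.add_mulVec, ← Matrix.add_mulVec]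
  congr 1
  abel

end Profile

end ZND

/-! ### The branch of `s` and the real parts of the growth rates. -/

namespace ZND

/-- From `(y - ζ)(y + ζ) = a` one gets `y - ζ = a · conj(y + ζ) / N` with `N = |y + ζ|²`. Taking
real parts, `(N - a)(Re y - Re ζ) = 2 a Re ζ`, and `N > a`. -/
lemma re_le_re_of_sq_eq {y ζ : ℂ} {a : ℝ} (ha : 0 < a) (h : y ^ 2 = ζ ^ 2 + a)
    (hN : a < Complex.normSq (y + ζ)) (hζ : 0 ≤ ζ.re) :
    ζ.re ≤ y.re ∧ (ζ.re = 0 → y.re = 0) := by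
  have h1 := congrArg Complex.re h
  have h2 := congrArg Complex.im h
  simp only [sq, Complex.mul_re, Complex.mul_im, Complex.add_re, Complex.add_im,
    Complex.ofReal_re, Complex.ofReal_im] at h1 h2
  have hNe : Complex.normSq (y + ζ) = (y.re + ζ.re) ^ 2 + (y.im + ζ.im) ^ 2 := by
    simp only [Complex.normSq_apply, Complex.add_re, Complex.add_im]; ring
  set N := Complex.normSq (y + ζ)
  have key : (y.re - ζ.re) * N = a * (y.re + ζ.re) := by
    rw [hNe]
    linear_combination (y.re + ζ.re) * h1 + (y.im + ζ.im) * h2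
  have key2 : (N - a) * (y.re - ζ.re) = 2 * a * ζ.re := by linear_combination key
  have hpos : 0 < N - a := by linarith
  constructor
  · by_contra hlt
    have h3 : y.re - ζ.re < 0 := by linarith
    have h4 := mul_neg_of_pos_of_neg hpos h3
    nlinarith
  · intro h0
    rw [h0, mul_zero, sub_zero] at key2
    rcases mul_eq_zero.1 key2 with h5 | h5
    · exact absurd h5 hpos.ne'
    · exact h5

lemma sq_cpow_half {y : ℂ} (h : 0 < y.re ∨ y.re = 0 ∧ 0 < y.im) :
    (y ^ 2) ^ (1 / 2 : ℂ) = y := by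
  have h1 : -(Real.pi / (2 : ℕ)) < y.arg := by
    have : -(Real.pi / 2) < y.arg :=
      Complex.neg_pi_div_two_lt_arg_iff.2 (h.imp id fun h => h.2.le)
    push_cast; linarith
  have h2 : y.arg ≤ Real.pi / (2 : ℕ) := by
    have : y.arg ≤ Real.pi / 2 :=
      Complex.arg_le_pi_div_two_iff.2 (Or.inl (h.elim le_of_lt fun h => h.1.ge))
    push_cast; linarith
  have := Complex.pow_cpow_nat_inv two_ne_zero h1 h2
  simpa [one_div] using this

namespace Profile

variable {Z : Model} {P : Profile Z} {ρ h x : ℝ} {ζ ω ε : ℂ}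

/-- The value `(k, ω, ε)` of the symbol variables attached to `(x, ζ, h)`. -/
def point (P : Profile Z) (ζ : ℂ) (h x : ℝ) : State × ℂ × ℂ := (P.q x, ζ⁻¹, h / ζ)

/-- Parameters for which the construction applies. -/
structure Large (ρ : ℝ) (ζ : ℂ) (h : ℝ) : Prop where
  re_nonneg : 0 ≤ ζ.re
  le_norm : ρ⁻¹ ≤ ‖ζ‖
  pos : 0 < h
  le_one : h ≤ 1

lemma Large.ne_zero (hρ : 0 < ρ) (hL : Large ρ ζ h) : ζ ≠ 0 := by
  have := (inv_pos.2 hρ).trans_le hL.le_norm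
  exact norm_pos_iff.1 this

lemma Large.norm_inv_le (hρ : 0 < ρ) (hL : Large ρ ζ h) : ‖ζ⁻¹‖ ≤ ρ := by
  rw [norm_inv]
  exact inv_le_of_inv_le₀ hρ hL.le_norm

lemma Large.norm_div_le (hρ : 0 < ρ) (hL : Large ρ ζ h) : ‖(h : ℂ) / ζ‖ ≤ ρ := by
  rw [div_eq_mul_inv, norm_mul, Complex.norm_real, Real.norm_of_nonneg hL.pos.le]
  exact (mul_le_of_le_one_left (norm_nonneg _) hL.le_one).trans (hL.norm_inv_le hρ)

lemma Large.point_mem (hρ : 0 < ρ) (hL : Large ρ ζ h) (hx : 0 ≤ x) :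
    P.point ζ h x ∈ P.paramSet ρ :=
  P.mem_paramSet (P.q_mem_states hx) (hL.norm_inv_le hρ) (hL.norm_div_le hρ)

/-- `s = ζ σ`. -/
def root (P : Profile Z) (ζ : ℂ) (h x : ℝ) : ℂ := ζ * P.sigma (P.point ζ h x)

/-- `c₀² - u²` along the profile. -/
def gapSq (P : Profile Z) (x : ℝ) : ℝ := Z.sound (P.q x) ^ 2 - P.u x ^ 2

lemma gapSq_pos (hx : 0 ≤ x) : 0 < P.gapSq x := by
  have h1 := P.u_pos hx
  have h2 := P.u_lt_sound hx
  rw [gapSq]; nlinarith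

lemma symU_point (hx : 0 ≤ x) : P.symU (P.point ζ h x) = (P.u x : ℂ) := by
  rw [P.u_eq hx]; rfl

lemma symC_point : symC Z (P.point ζ h x) = (Z.sound (P.q x) : ℂ) := rfl

lemma sq_root (hρ : P.Admissible ρ) (hL : Large ρ ζ h) (hx : 0 ≤ x) :
    P.root ζ h x ^ 2 = ζ ^ 2 + (P.gapSq x : ℂ) := by
  have hζ := hL.ne_zero hρ.pos
  rw [root, mul_pow, P.sigma_sq (hρ.sigmaSq_re_pos _ (hL.point_mem hρ.pos hx)), sigmaSq,
    symU_point hx, symC_point, gapSq]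
  simp only [point]
  push_cast
  field_simp

lemma re_le_re_root (hρ : P.Admissible ρ) (hL : Large ρ ζ h) (hx : 0 ≤ x) :
    ζ.re ≤ (P.root ζ h x).re ∧ (ζ.re = 0 → (P.root ζ h x).re = 0) := by
  refine re_le_re_of_sq_eq (gapSq_pos hx) (sq_root hρ hL hx) ?_ hL.re_nonneg
  have hk := hL.point_mem (P := P) hρ.pos hx
  have h1 : P.root ζ h x + ζ = ζ * (P.sigma (P.point ζ h x) + 1) := by rw [root]; ring
  have h2 : 1 ≤ ‖P.sigma (P.point ζ h x) + 1‖ := by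
    refine le_trans ?_ (Complex.re_le_norm _)
    simp only [Complex.add_re, Complex.one_re]
    linarith [P.sigma_re_pos (hρ.sigmaSq_re_pos _ hk)]
  -- Since `c₀ ≤ 1/(2ρ)`, this makes `|s + ζ|²` exceed `c₀²`, and so `c₀² - u²`.
  have h3 : ρ⁻¹ ≤ ‖P.root ζ h x + ζ‖ := by
    rw [h1, norm_mul]
    exact hL.le_norm.trans (le_mul_of_one_le_right (norm_nonneg _) h2)
  have h4 := hρ.sound_mul_le _ (P.q_mem_states hx)
  have h5 : Z.sound (P.q x) ≤ 1 / 2 * ρ⁻¹ := by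
    rw [← div_eq_mul_inv, le_div_iff₀ hρ.pos]; exact h4
  have h6 := P.sound_pos_of_mem (P.q_mem_states hx)
  have h7 := P.u_pos hx
  rw [Complex.normSq_eq_norm_sq, gapSq]
  nlinarith

/-- For `Re ζ > 0` both are the square root with positive real part. On the axis `ζ σ` is purely
imaginary with the sign of `Im ζ`; the principal root of a negative number is `+i|s|`, so the sign
has to be reversed exactly when `Im ζ < 0`. -/
lemma s_eq_root (hρ : P.Admissible ρ) (hL : Large ρ ζ h) (hx : 0 ≤ x) :
    P.s x ζ = P.root ζ h x := by
  have hc := P.sound_pos_of_mem (P.q_mem_states hx)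
  have hgap : P.cSq x * P.eta x = P.gapSq x := by
    have h1 : P.cSq x = Z.sound (P.q x) ^ 2 := (P.sq_sound_of_mem (P.q_mem_states hx)).symm
    rw [h1, eta, kappa, gapSq]
    field_simp
  have hsq := sq_root hρ hL hx
  obtain ⟨hre, hre0⟩ := re_le_re_root hρ hL hx
  rw [s, hgap, ← hsq]
  rcases hL.re_nonneg.lt_or_eq with hpos | hzero
  · rw [if_neg fun hcond => hpos.ne' hcond.1]
    exact sq_cpow_half (Or.inl (hpos.trans_le hre))
  · have hy := hre0 hzero.symm
    have hζ := hL.ne_zero hρ.pos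
    have him : ζ.im ≠ 0 := fun h0 => hζ (Complex.ext hzero.symm h0)
    have hσ := P.sigma_re_pos (hρ.sigmaSq_re_pos _ (hL.point_mem (P := P) hρ.pos hx))
    have hyim : (P.root ζ h x).im = ζ.im * (P.sigma (P.point ζ h x)).re := by
      rw [root, Complex.mul_im, ← hzero]; ring
    have hne : (P.root ζ h x).im ≠ 0 := by
      rw [hyim]; exact mul_ne_zero him hσ.ne'
    have hneg : (P.root ζ h x ^ 2).re < 0 := by
      rw [sq, Complex.mul_re, hy]
      have := mul_self_pos.2 hne
      linarith
    rcases lt_or_gt_of_ne him with hlt | hgt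
    · rw [if_pos ⟨hzero.symm, hlt, hneg⟩]
      have hsq' : P.root ζ h x ^ 2 = (-P.root ζ h x) ^ 2 := by ring
      rw [hsq', sq_cpow_half, neg_neg]
      right
      rw [Complex.neg_re, Complex.neg_im, hy, hyim]
      exact ⟨neg_zero, by nlinarith⟩
    · rw [if_neg fun hcond => hgt.not_gt hcond.2.1]
      refine sq_cpow_half (Or.inr ⟨hy, ?_⟩)
      rw [hyim]; positivity

lemma T1_eq (hρ : P.Admissible ρ) (hL : Large ρ ζ h) (hx : 0 ≤ x) :
    P.T1 x ζ = WithLp.toLp 2 (ζ • fun i => P.symRight (P.point ζ h x) i 0) := by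
  have hζ := hL.ne_zero hρ.pos
  have hc := Complex.ofReal_ne_zero.2 (P.sound_pos_of_mem (P.q_mem_states hx)).ne'
  have hu := Complex.ofReal_ne_zero.2 (P.u_pos hx).ne'
  have hv := Complex.ofReal_ne_zero.2 (P.v_pos x hx).ne'
  rw [T1, s_eq_root hρ hL hx]
  congr 1
  have hV : symV (P.point ζ h x) = (P.v x : ℂ) := rfl
  have hom : (P.point ζ h x).2.1 = ζ⁻¹ := rfl
  have hS : symPS Z (P.point ζ h x) = (dS Z.p (P.q x) : ℂ) := rfl
  have hl : symPlam Z (P.point ζ h x) = (dlam Z.p (P.q x) : ℂ) := rfl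
  ext i
  simp only [Pi.smul_apply, smul_eq_mul, symRight, symU_point hx, symC_point, hV, hom, hS, hl]
  fin_cases i <;> simp [rightEigen, massFlux, kappa, root] <;> field_simp

/-- Real parts of the growth rates of the modes. -/
lemma re_symEigen (hL : Large ρ ζ h) (hρ : P.Admissible ρ) (hx : 0 ≤ x) :
    (P.symEigen (P.point ζ h x) 0 / (h / ζ)).re
        = -(P.u x * ζ.re + Z.sound (P.q x) * (P.root ζ h x).re) / (P.gapSq x * h) ∧
      (P.symEigen (P.point ζ h x) 1 / (h / ζ)).re
        = (Z.sound (P.q x) * (P.root ζ h x).re - P.u x * ζ.re) / (P.gapSq x * h) ∧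
      (P.symEigen (P.point ζ h x) 2 / (h / ζ)).re = ζ.re / (P.u x * h) ∧
      (P.symEigen (P.point ζ h x) 3 / (h / ζ)).re = ζ.re / (P.u x * h) ∧
      (P.symEigen (P.point ζ h x) 4 / (h / ζ)).re = ζ.re / (P.u x * h) + P.endRate := by
  have hζ := hL.ne_zero hρ.pos
  have hu := Complex.ofReal_ne_zero.2 (P.u_pos hx).ne'
  have hh : (h : ℂ) ≠ 0 := Complex.ofReal_ne_zero.2 hL.pos.ne'
  have hD : (Z.sound (P.q x) : ℂ) ^ 2 - (P.u x : ℂ) ^ 2 = ((P.gapSq x : ℝ) : ℂ) := by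
    rw [gapSq]; push_cast; ring
  have hD0 := Complex.ofReal_ne_zero.2 (gapSq_pos (P := P) hx).ne'
  have hε : (P.point ζ h x).2.2 = h / ζ := rfl
  have e0 : P.symEigen (P.point ζ h x) 0 / (h / ζ)
      = ((1 / (P.gapSq x * h) : ℝ) : ℂ) *
        -((P.u x : ℂ) * ζ + (Z.sound (P.q x) : ℂ) * P.root ζ h x) := by
    simp only [symEigen, Matrix.cons_val_zero, symU_point hx, symC_point, hD, root]
    push_cast
    field_simp
  have e1 : P.symEigen (P.point ζ h x) 1 / (h / ζ)
      = ((1 / (P.gapSq x * h) : ℝ) : ℂ) *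
        ((Z.sound (P.q x) : ℂ) * P.root ζ h x - (P.u x : ℂ) * ζ) := by
    simp only [symEigen, Matrix.cons_val_one, Matrix.cons_val_zero, symU_point hx, symC_point,
      hD, root]
    push_cast
    field_simp
    ring
  have e2 : 1 / P.symU (P.point ζ h x) / (h / ζ) = ((1 / (P.u x * h) : ℝ) : ℂ) * ζ := by
    rw [symU_point hx]
    push_cast
    field_simp
  have e4 : P.symEigen (P.point ζ h x) 4 / (h / ζ)
      = ((1 / (P.u x * h) : ℝ) : ℂ) * ζ + (P.endRate : ℂ) := by
    rw [← e2]
    simp only [symEigen, Matrix.cons_val, hε]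
    field_simp
  have r2 : (1 / P.symU (P.point ζ h x) / (h / ζ)).re = ζ.re / (P.u x * h) := by
    rw [e2, Complex.re_ofReal_mul]; ring
  refine ⟨?_, ?_, r2, r2, ?_⟩
  · rw [e0, Complex.re_ofReal_mul]
    simp only [Complex.neg_re, Complex.add_re, Complex.re_ofReal_mul]
    ring
  · rw [e1, Complex.re_ofReal_mul]
    simp only [Complex.sub_re, Complex.re_ofReal_mul]
    ring
  · rw [e4, Complex.add_re, Complex.re_ofReal_mul, Complex.ofReal_re]; ring

/-- The first mode is the least growing one. -/
lemma re_symEigen_sub_nonneg (hL : Large ρ ζ h) (hρ : P.Admissible ρ) (hx : 0 ≤ x) (i : Fin 5) :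
    0 ≤ ((P.symEigen (P.point ζ h x) i - P.symEigen (P.point ζ h x) 0) / (h / ζ)).re := by
  obtain ⟨h0, h1, h2, h3, h4⟩ := re_symEigen hL hρ hx
  have hr := (re_le_re_root hρ hL hx).1
  have hζ := hL.re_nonneg
  have hu := P.u_pos hx
  have hc := P.sound_pos_of_mem (P.q_mem_states hx)
  have hD := gapSq_pos (P := P) hx
  have hh := hL.pos
  have hr0 : 0 ≤ (P.root ζ h x).re := hζ.trans hr
  have hneg : (P.symEigen (P.point ζ h x) 0 / (h / ζ)).re ≤ 0 := by
    rw [h0]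
    exact div_nonpos_of_nonpos_of_nonneg (by nlinarith [mul_nonneg hu.le hζ, mul_nonneg hc.le hr0])
      (by positivity)
  have h2' : 0 ≤ ζ.re / (P.u x * h) := by positivity
  have h1' : 0 ≤ (P.symEigen (P.point ζ h x) 1 / (h / ζ)).re := by
    rw [h1]
    refine div_nonneg (sub_nonneg.2 ?_) (by positivity)
    exact mul_le_mul (P.u_lt_sound hx).le hr hζ hc.le
  have h4' : 0 ≤ (P.symEigen (P.point ζ h x) 4 / (h / ζ)).re := by
    rw [h4]; exact add_nonneg h2' P.endRate_pos.le
  rw [sub_div, Complex.sub_re]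
  fin_cases i
  · exact (sub_self _).ge
  · exact sub_nonneg.2 (hneg.trans h1')
  · exact sub_nonneg.2 (hneg.trans (h2 ▸ h2'))
  · exact sub_nonneg.2 (hneg.trans (h3 ▸ h2'))
  · exact sub_nonneg.2 (hneg.trans h4')

end Profile

end ZND

/-! ### The family of decaying solutions. -/

namespace ZND

namespace Profile

variable {Z : Model} {P : Profile Z} {ρ h x : ℝ} {ζ : ℂ}

lemma exists_decay_rate (hρ : P.Admissible ρ) : ∃ a, 0 < a ∧ ∀ {ζ : ℂ} {h x : ℝ}, Large ρ ζ h →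
    0 ≤ x → (P.symEigen (P.point ζ h x) 0 / (h / ζ)).re ≤ -(a * ζ.re) := by
  obtain ⟨C₃, C₄, h₃, hu⟩ := P.u_bounds
  have hρ0 := hρ.pos
  -- The numerator is at least `C₃ Re ζ` and the denominator `(c₀² - u²) h` is at most `c₀² ≤ 1 / (4
  -- ρ²)`.
  refine ⟨C₃ * (4 * ρ ^ 2), by positivity, fun {ζ h x} hL hx => ?_⟩
  rw [(re_symEigen hL hρ hx).1]
  have hD := gapSq_pos (P := P) hx
  have hc := P.sound_pos_of_mem (P.q_mem_states hx)
  have hcρ := hρ.sound_mul_le _ (P.q_mem_states hx)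
  have hr := (re_le_re_root hρ hL hx).1
  have hζ := hL.re_nonneg
  have hh := hL.pos
  have hgap : 4 * ρ ^ 2 * (P.gapSq x * h) ≤ 1 := by
    have h1 : P.gapSq x ≤ Z.sound (P.q x) ^ 2 := by
      rw [gapSq]; linarith [sq_nonneg (P.u x)]
    have h2 : P.gapSq x * h ≤ Z.sound (P.q x) ^ 2 :=
      (mul_le_of_le_one_right hD.le hL.le_one).trans h1
    have h3 : 0 ≤ Z.sound (P.q x) * ρ := by positivity
    nlinarith [mul_le_mul_of_nonneg_left h2 (by positivity : 0 ≤ 4 * ρ ^ 2)]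
  rw [div_le_iff₀ (by positivity)]
  have h4 : C₃ * ζ.re ≤ P.u x * ζ.re := mul_le_mul_of_nonneg_right (hu x hx).1 hζ
  have h5 : 0 ≤ Z.sound (P.q x) * (P.root ζ h x).re := mul_nonneg hc.le (hζ.trans hr)
  have h6 := mul_le_mul_of_nonneg_left hgap (mul_nonneg h₃.le hζ)
  linarith

/-- For the acoustic mode, `Re s ≥ Re ζ` cancels the factor `c₀ - u` and leaves `Re ζ / ((c₀ + u)
h)`. Then `u < c₀`, `c₀ ρ ≤ 1/2` and `h ≤ 1` give the constant `ρ`. The strict growth feeds the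
uniqueness argument. -/
lemma le_re_symEigen (hρ : P.Admissible ρ) (hL : Large ρ ζ h) (hx : 0 ≤ x) {i : Fin 5}
    (hi : i ≠ 0) : ρ * ζ.re ≤ (P.symEigen (P.point ζ h x) i / (h / ζ)).re := by
  obtain ⟨-, h1, h2, h3, h4⟩ := re_symEigen hL hρ hx
  have hρ0 := hρ.pos
  have hD := gapSq_pos (P := P) hx
  have hc := P.sound_pos_of_mem (P.q_mem_states hx)
  have hu := P.u_pos hx
  have huc := P.u_lt_sound hx
  have hcρ := hρ.sound_mul_le _ (P.q_mem_states hx)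
  have hr := (re_le_re_root hρ hL hx).1
  have hζ := hL.re_nonneg
  have hh := hL.pos
  have hh1 := hL.le_one
  have h2' : ρ * ζ.re ≤ ζ.re / (P.u x * h) := by
    rw [le_div_iff₀ (by positivity)]
    have e1 : ρ * (P.u x * h) ≤ 1 := by
      have : P.u x * h ≤ P.u x := mul_le_of_le_one_right hu.le hh1
      nlinarith
    nlinarith
  have h1' : ρ * ζ.re ≤ (P.symEigen (P.point ζ h x) 1 / (h / ζ)).re := by
    rw [h1, le_div_iff₀ (by positivity)]
    have e1 : Z.sound (P.q x) * ζ.re ≤ Z.sound (P.q x) * (P.root ζ h x).re :=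
      mul_le_mul_of_nonneg_left hr hc.le
    have e2 : ρ * ((Z.sound (P.q x) + P.u x) * h) ≤ 1 := by
      have : (Z.sound (P.q x) + P.u x) * h ≤ Z.sound (P.q x) + P.u x :=
        mul_le_of_le_one_right (by positivity) hh1
      nlinarith
    have e3 := mul_le_mul_of_nonneg_left e2 (mul_nonneg (sub_nonneg.2 huc.le) hζ)
    rw [gapSq]
    nlinarith
  have h4' : ρ * ζ.re ≤ (P.symEigen (P.point ζ h x) 4 / (h / ζ)).re := by
    rw [h4]; linarith [P.endRate_pos]
  fin_cases i
  · exact absurd rfl hi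
  · exact h1'
  · exact h2'.trans h2.ge
  · exact h2'.trans h3.ge
  · exact h4'

/-- The reciprocals of the differences between the first eigenvalue and the others. -/
def symGapInv (P : Profile Z) (i : Fin 5) (k : State × ℂ × ℂ) : ℂ :=
  if i = 0 then 0 else 1 / (P.symEigen k i - P.symEigen k 0)

lemma symEigen_sub_ne_zero (hρ : P.Admissible ρ) {k : State × ℂ × ℂ} (hk : k ∈ P.paramSet ρ)
    {i : Fin 5} (hi : i ≠ 0) : P.symEigen k i - P.symEigen k 0 ≠ 0 := by
  have hg := (inv_sub_symEigen (P := P) hk.1).1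
  have hg0 : P.gap₀ k ≠ 0 := div_ne_zero
    (mul_ne_zero (P.symC_ne_zero hk.1) (hρ.plus_ne_zero k hk))
    (mul_ne_zero (P.symU_ne_zero hk.1) (P.symD_ne_zero hk.1))
  have h1 : P.symEigen k 1 - P.symEigen k 0
      = 2 * (symC Z k * P.sigma k) / (symC Z k ^ 2 - P.symU k ^ 2) := by
    simp only [symEigen, Matrix.cons_val_one, Matrix.cons_val_zero]
    ring
  have h4 : P.symEigen k 4 - P.symEigen k 0 = P.gap₀ k + k.2.2 * P.endRate := by
    rw [← hg]
    simp only [symEigen, Matrix.cons_val]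
    ring
  fin_cases i
  · exact absurd rfl hi
  · change P.symEigen k 1 - P.symEigen k 0 ≠ 0
    rw [h1]
    exact div_ne_zero (mul_ne_zero two_ne_zero (mul_ne_zero (P.symC_ne_zero hk.1) sigma_ne_zero))
      (P.symD_ne_zero hk.1)
  · exact hg.symm ▸ hg0
  · exact hg.symm ▸ hg0
  · change P.symEigen k 4 - P.symEigen k 0 ≠ 0
    rw [h4]; exact hρ.gap₀_ne_zero k hk

lemma isSymbol_symGapInv (hρ : P.Admissible ρ) (i : Fin 5) : P.IsSymbol ρ (P.symGapInv i) := by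
  unfold symGapInv
  by_cases hi : i = 0
  · simpa [hi] using (IsSymbol.const 0 : P.IsSymbol ρ fun _ => (0 : ℂ))
  · simp only [if_neg hi]
    exact (IsSymbol.const 1).div ((isSymbol_symEigen hρ i).sub (isSymbol_symEigen hρ 0))
      fun k hk => symEigen_sub_ne_zero hρ hk hi

/-- The set of parameters `ζ`. -/
def zetaSet (ρ : ℝ) : Set ℂ := {ζ | 0 ≤ ζ.re ∧ ρ⁻¹ ≤ ‖ζ‖}

lemma symQ_mulVec_single (k : State × ℂ × ℂ) (i : Fin 5) :
    (P.symQ k).mulVec (Pi.single 0 1) i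
      = P.symRight k i 0 - if i = 4 then P.shearCoeff k 0 else 0 := by
  rw [Matrix.mulVec_single_one, Matrix.col_apply, symQ, Matrix.mul_apply, Fin.sum_univ_five]
  simp only [symRight_last]
  simp [shear]
  split_ifs <;> simp [sub_eq_add_neg]

lemma norm_toLp_le (y : Fin 5 → ℂ) : ‖(WithLp.toLp 2 y : C5)‖ ≤ 5 * ‖y‖ := by
  rw [EuclideanSpace.norm_eq, Real.sqrt_le_left (by positivity)]
  have h : ∑ i : Fin 5, ‖y i‖ ^ 2 ≤ ∑ _i : Fin 5, ‖y‖ ^ 2 :=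
    Finset.sum_le_sum fun i _ => pow_le_pow_left₀ (norm_nonneg _) (norm_le_pi_norm y i) 2
  refine h.trans ?_
  simp only [Finset.sum_const, Finset.card_univ, Fintype.card_fin, nsmul_eq_mul]
  push_cast
  nlinarith [sq_nonneg ‖y‖]

lemma norm_ofLp_le (v : C5) : ‖v.ofLp‖ ≤ ‖v‖ :=
  (pi_norm_le_iff_of_nonneg (norm_nonneg _)).2 fun i => PiLp.norm_apply_le v i

lemma norm_mulVec_le {A : Matrix (Fin 5) (Fin 5) ℂ} {C : ℝ} (hC : 0 ≤ C)
    (hA : ∀ i j, ‖A i j‖ ≤ C) (y : Fin 5 → ℂ) : ‖A.mulVec y‖ ≤ 5 * C * ‖y‖ := by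
  refine (pi_norm_le_iff_of_nonneg (by positivity)).2 fun i => ?_
  calc ‖∑ j, A i j * y j‖ ≤ ∑ _j : Fin 5, C * ‖y‖ := norm_sum_le_of_le _ fun j _ => by
        rw [norm_mul]
        exact mul_le_mul (hA i j) (norm_le_pi_norm y j) (norm_nonneg _) hC
    _ = _ := by
        simp only [Finset.sum_const, Finset.card_univ, Fintype.card_fin, nsmul_eq_mul]
        push_cast; ring

lemma IsSymbolMatrix.exists_bound {A : State × ℂ × ℂ → Matrix (Fin 5) (Fin 5) ℂ}
    (hA : P.IsSymbolMatrix ρ A) : ∃ C, 0 ≤ C ∧ ∀ k ∈ P.paramSet ρ, ∀ i j, ‖A k i j‖ ≤ C := by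
  choose C hC hb using fun i j => (hA i j).exists_bound
  refine ⟨∑ i, ∑ j, C i j, Finset.sum_nonneg fun i _ => Finset.sum_nonneg fun j _ => hC i j,
    fun k hk i j => (hb i j k hk).trans ?_⟩
  exact (Finset.single_le_sum (fun j _ => hC i j) (Finset.mem_univ j)).trans
    (Finset.single_le_sum (f := fun i => ∑ j, C i j)
      (fun i _ => Finset.sum_nonneg fun j _ => hC i j) (Finset.mem_univ i))

lemma continuous_symEigen_div (hρ : P.Admissible ρ) (hL : Large ρ ζ h) (i : Fin 5) :
    Continuous fun s : ℝ => P.symEigen (P.q (max s 0), ζ⁻¹, h / ζ) i / (h / ζ) := by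
  have h1 := (isSymbol_symEigen hρ i).continuous_eval (X := Unit) (ω := fun _ => ζ⁻¹)
    (ε := fun _ => (h : ℂ) / ζ) continuous_const continuous_const
    (fun _ => hL.norm_inv_le hρ.pos) (fun _ => hL.norm_div_le hρ.pos)
  have h2 : Continuous fun s : ℝ => (s, ()) := by fun_prop
  exact (h1.comp h2).div_const _

lemma norm_exp_integral_le (hρ : P.Admissible ρ) (hL : Large ρ ζ h) (hx : 0 ≤ x) {a : ℝ}
    (ha : ∀ {y : ℝ}, 0 ≤ y → (P.symEigen (P.point ζ h y) 0 / (h / ζ)).re ≤ -a) :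
    ‖Complex.exp (∫ s in (0 : ℝ)..x, P.symEigen (P.q (max s 0), ζ⁻¹, h / ζ) 0 / (h / ζ))‖
      ≤ Real.exp (-a * x) := by
  have hc := continuous_symEigen_div hρ hL 0
  rw [Complex.norm_exp, Real.exp_le_exp]
  have hre := Complex.reCLM.intervalIntegral_comp_comm (μ := MeasureTheory.volume)
    (hc.intervalIntegrable 0 x)
  simp only [Complex.reCLM_apply] at hre
  rw [← hre]
  calc ∫ s in (0 : ℝ)..x, (P.symEigen (P.q (max s 0), ζ⁻¹, h / ζ) 0 / (h / ζ)).re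
      ≤ ∫ _s in (0 : ℝ)..x, -a :=
        intervalIntegral.integral_mono_on hx
          ((Complex.continuous_re.comp hc).intervalIntegrable _ _)
          (continuous_const.intervalIntegrable _ _) fun s hs => by
            rw [max_eq_left hs.1]; exact ha hs.1
    _ = -a * x := by rw [intervalIntegral.integral_const, smul_eq_mul]; ring

lemma Large.of_mem (ζ : zetaSet ρ) (h0 : 0 < h) (h1 : h ≤ 1) : Large ρ ζ h :=
  ⟨ζ.2.1, ζ.2.2, h0, h1⟩

/-- Solutions depending continuously on `ζ` that follow the decaying mode. -/
theorem exists_decaying_family (hρ : P.Admissible ρ) : ∃ a, 0 < a ∧ ∃ C, 0 ≤ C ∧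
    ∀ h : ℝ, 0 < h → h ≤ 1 → ∃ θ : ℝ → zetaSet ρ → C5,
      (∀ x, 0 ≤ x → Continuous (θ x)) ∧
      (∀ (ζ : zetaSet ρ) x, 0 ≤ x → HasDerivWithinAt (fun y => θ y ζ)
        (WithLp.toLp 2 ((P.systemMatrix ζ h x).mulVec (θ x ζ).ofLp)) (Ici 0) x) ∧
      (∀ ζ : zetaSet ρ, ∃ K, ∀ x, 0 ≤ x →
        ‖θ x ζ‖ ≤ K * Real.exp (-(a * (ζ : ℂ).re) * x)) ∧
      ∀ ζ : zetaSet ρ, ‖θ 0 ζ - P.T1 0 ζ‖ ≤ C * h := by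
  obtain ⟨a, ha, hdec⟩ := exists_decay_rate hρ
  obtain ⟨C, hC, hdom⟩ := P.exists_dominant_solution (ρ := ρ) (0 : Fin 5)
    (μ := fun i k => P.symEigen k i) (ν := P.symGapInv) (R := fun i j k => P.symR k i j)
    (isSymbol_symEigen hρ) (isSymbol_symGapInv hρ) (by funext k; simp [symGapInv])
    (fun i hi k hk => by
      rw [symGapInv, if_neg hi, mul_one_div_cancel (symEigen_sub_ne_zero hρ hk hi)])
    (isSymbol_symR hρ) (decaysAlong_symR hρ)
  obtain ⟨CQ, hCQ, hQ⟩ := (isSymbolMatrix_symQ hρ).exists_bound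
  obtain ⟨Cs, hCs, hs⟩ := (isSymbol_shearRatio hρ).exists_bound
  refine ⟨a, ha, 5 * (5 * CQ * C + Cs), by positivity, fun h h0 h1 => ?_⟩
  have hL : ∀ ζ : zetaSet ρ, Large ρ ζ h := fun ζ => Large.of_mem ζ h0 h1
  have hne : ∀ ζ : zetaSet ρ, (ζ : ℂ) ≠ 0 := fun ζ => (hL ζ).ne_zero hρ.pos
  have hh : (h : ℂ) ≠ 0 := Complex.ofReal_ne_zero.2 h0.ne'
  have hωc : Continuous fun ζ : zetaSet ρ => (ζ : ℂ)⁻¹ := continuous_subtype_val.inv₀ hne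
  have hεc : Continuous fun ζ : zetaSet ρ => (h : ℂ) / ζ :=
    continuous_const.div continuous_subtype_val hne
  obtain ⟨w, hwc, hwd, hwb, hw0⟩ := hdom (zetaSet ρ) (fun ζ => (ζ : ℂ)⁻¹) (fun ζ => (h : ℂ) / ζ)
    hωc hεc (fun ζ => (hL ζ).norm_inv_le hρ.pos) (fun ζ => (hL ζ).norm_div_le hρ.pos)
    (fun ζ => div_ne_zero hh (hne ζ)) (fun i x ζ hx => re_symEigen_sub_nonneg (hL ζ) hρ hx i)
  -- The factor `ζ` is the normalization: `T₁` is `ζ` times the first right eigenvector.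
  refine ⟨fun x ζ => WithLp.toLp 2 ((ζ : ℂ) • (P.symQ (P.point ζ h x)).mulVec (w x ζ)),
    fun x hx => ?_, fun ζ x hx => ?_, fun ζ => ?_, fun ζ => ?_⟩
  · refine (PiLp.continuous_toLp 2 _).comp (continuous_subtype_val.smul ?_)
    refine continuous_pi fun i => ?_
    simp only [Matrix.mulVec, dotProduct]
    refine continuous_finsetSum _ fun j _ => ?_
    refine Continuous.mul ?_ ((continuous_apply j).comp (hwc x hx))
    have := ((isSymbolMatrix_symQ hρ i j).continuous_eval hωc hεc
      (fun ζ => (hL ζ).norm_inv_le hρ.pos) (fun ζ => (hL ζ).norm_div_le hρ.pos)).comp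
      (continuous_const.prodMk continuous_id : Continuous fun ζ : zetaSet ρ => (x, ζ))
    refine this.congr fun ζ => ?_
    simp only [Function.comp_apply, max_eq_left hx, point]
  · rw [hasDerivWithinAt_C5]
    have hd := hasDerivWithinAt_symQ_mulVec hρ hx ((hL ζ).norm_inv_le hρ.pos)
      ((hL ζ).norm_div_le hρ.pos) (mul_inv_cancel₀ (hne ζ)) (div_mul_cancel₀ _ (hne ζ)) h0.ne'
      (w := fun y => w y ζ) (fun i => hwd i x ζ hx)
    refine (hd.const_smul (ζ : ℂ)).congr_deriv ?_
    rw [Matrix.mulVec_smul]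
    rfl
  · refine ⟨5 * (‖(ζ : ℂ)‖ * (5 * CQ * C)), fun x hx => ?_⟩
    have hk := (hL ζ).point_mem (P := P) hρ.pos hx
    refine (norm_toLp_le _).trans ?_
    rw [norm_smul, mul_assoc, mul_assoc]
    refine mul_le_mul_of_nonneg_left (mul_le_mul_of_nonneg_left ?_ (norm_nonneg _)) (by norm_num)
    refine (norm_mulVec_le hCQ (hQ _ hk) _).trans ?_
    rw [mul_assoc (5 * CQ) C]
    refine mul_le_mul_of_nonneg_left ((hwb x ζ hx).trans ?_) (by positivity)
    exact mul_le_mul_of_nonneg_left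
      (norm_exp_integral_le hρ (hL ζ) hx fun hy => hdec (hL ζ) hy) hC
  · have hk := (hL ζ).point_mem (P := P) hρ.pos le_rfl
    set k := P.point ζ h 0 with hkdef
    have hT := T1_eq hρ (hL ζ) (le_refl (0 : ℝ))
    rw [hT, ← WithLp.toLp_sub, ← smul_sub]
    refine (norm_toLp_le _).trans ?_
    have hεn : ‖(ζ : ℂ)‖ * ‖(h : ℂ) / ζ‖ = h := by
      rw [← norm_mul, mul_div_cancel₀ _ (hne ζ), Complex.norm_real, Real.norm_of_nonneg h0.le]
    -- Two errors of order `|ε|`: the deviation of `w(0)` from the unit vector, and the shear mixing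
    -- the last eigenvector into the first. Multiplication by `|ζ|` turns `|ε|` into `h`.
    have hsplit : (P.symQ k).mulVec (w 0 ζ) - (fun i => P.symRight k i 0)
        = (P.symQ k).mulVec (w 0 ζ - Pi.single 0 1)
          - fun i => if i = 4 then P.shearCoeff k 0 else 0 := by
      rw [Matrix.mulVec_sub]
      ext i
      simp only [Pi.sub_apply, symQ_mulVec_single]
      ring
    have hsh : ‖fun i : Fin 5 => if i = 4 then P.shearCoeff k 0 else 0‖ ≤ Cs * ‖(h : ℂ) / ζ‖ := by
      refine (pi_norm_le_iff_of_nonneg (by positivity)).2 fun i => ?_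
      split_ifs
      · rw [mul_comm]
        refine (norm_mul_le _ _).trans (mul_le_mul_of_nonneg_left (hs k hk) (norm_nonneg _))
      · rw [norm_zero]; positivity
    have hmain : ‖(P.symQ k).mulVec (w 0 ζ) - (fun i => P.symRight k i 0)‖
        ≤ (5 * CQ * C + Cs) * ‖(h : ℂ) / ζ‖ := by
      rw [hsplit]
      refine (norm_sub_le _ _).trans ?_
      have := (norm_mulVec_le hCQ (hQ k hk) (w 0 ζ - Pi.single 0 1)).trans
        (mul_le_mul_of_nonneg_left (hw0 ζ) (by positivity))
      linarith
    rw [norm_smul, mul_assoc]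
    refine mul_le_mul_of_nonneg_left ?_ (by norm_num)
    calc ‖(ζ : ℂ)‖ * _ ≤ ‖(ζ : ℂ)‖ * ((5 * CQ * C + Cs) * ‖(h : ℂ) / ζ‖) :=
          mul_le_mul_of_nonneg_left hmain (norm_nonneg _)
      _ = (5 * CQ * C + Cs) * (‖(ζ : ℂ)‖ * ‖(h : ℂ) / ζ‖) := by ring
      _ = _ := by rw [hεn]

end Profile

end ZND

/-! ### Proportionality of bounded solutions for `Re ζ > 0`. -/

namespace ZND

namespace Profile

variable {Z : Model} {P : Profile Z} {ρ h : ℝ} {ζ : ℂ}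

/-- For `Re ζ > 0` the bounded solutions are proportional. -/
theorem exists_smul_of_bounded (hρ : P.Admissible ρ) (hL : Large ρ ζ h) (hζ : 0 < ζ.re)
    {θ θ' : ℝ → C5}
    (hd : ∀ x, 0 ≤ x → HasDerivWithinAt θ
      (WithLp.toLp 2 ((P.systemMatrix ζ h x).mulVec (θ x).ofLp)) (Ici 0) x)
    (hd' : ∀ x, 0 ≤ x → HasDerivWithinAt θ'
      (WithLp.toLp 2 ((P.systemMatrix ζ h x).mulVec (θ' x).ofLp)) (Ici 0) x)
    (hb : ∃ K, ∀ x, 0 ≤ x → ‖θ x‖ ≤ K) (hb' : ∃ K, ∀ x, 0 ≤ x → ‖θ' x‖ ≤ K)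
    (hne : ∃ x, 0 ≤ x ∧ θ x ≠ 0) :
    ∃ c : ℂ, ∀ x, 0 ≤ x → θ' x = c • θ x := by
  have hζ0 := hL.ne_zero hρ.pos
  obtain ⟨C, hC, hR⟩ := exists_common_bound (P := P) (ρ := ρ)
    (F := fun p : Fin 5 × Fin 5 => fun k => P.symR k p.1 p.2)
    fun p => decaysAlong_symR hρ p.1 p.2
  obtain ⟨CL, hCL, hLb⟩ := (isSymbolMatrix_symL hρ).exists_bound
  have ha := P.decayRate_pos
  obtain ⟨x₀, hx₀, hsmall⟩ : ∃ x₀, 0 ≤ x₀ ∧ Fintype.card (Fin 5) * C / P.decayRate *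
      Real.exp (-P.decayRate * x₀) ≤ 1 / 2 := by
    have ht : Tendsto (fun x : ℝ => Fintype.card (Fin 5) * C / P.decayRate *
        Real.exp (-P.decayRate * x)) atTop (𝓝 (Fintype.card (Fin 5) * C / P.decayRate * 0)) :=
      ((Real.tendsto_exp_atBot.comp
        (tendsto_id.const_mul_atTop_of_neg (neg_neg_of_pos ha)))).const_mul _
    rw [mul_zero] at ht
    obtain ⟨x₀, h1, h2⟩ := ((ht.eventually (ge_mem_nhds (by norm_num : (0 : ℝ) < 1 / 2))).and
      (eventually_ge_atTop 0)).exists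
    exact ⟨x₀, h2, h1⟩
  -- The first diagonalized component at `x₀` is a linear functional that is injective on the
  -- bounded solutions, so these have dimension at most one.
  have hvanish : ∀ φ : ℝ → C5, (∀ x, 0 ≤ x → HasDerivWithinAt φ
      (WithLp.toLp 2 ((P.systemMatrix ζ h x).mulVec (φ x).ofLp)) (Ici 0) x) →
      (∃ K, ∀ x, 0 ≤ x → ‖φ x‖ ≤ K) →
      (P.symL (P.point ζ h x₀)).mulVec (φ x₀).ofLp 0 = 0 → ∀ x, 0 ≤ x → φ x = 0 := by
    rintro φ hφ ⟨K, hK⟩ h0 x hx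
    have hw := eq_zero_of_bounded_of_component_eq_zero (i₀ := (0 : Fin 5)) ha hC
      (mul_pos hρ.pos hζ) hx₀ hsmall
      (lam := fun i x => P.symEigen (P.q (max x 0), ζ⁻¹, h / ζ) i / (h / ζ))
      (R := fun i j x => P.symR (P.point ζ h x) i j)
      (continuous_symEigen_div hρ hL)
      (fun y hy => by
        obtain ⟨a, ha, hdec⟩ := exists_decay_rate hρ
        rw [max_eq_left hy]
        exact (hdec hL hy).trans (neg_nonpos.2 (mul_nonneg ha.le hζ.le)))
      (fun i hi y hy => by
        rw [max_eq_left hy]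
        exact le_re_symEigen hρ hL hy hi)
      (fun i j y hy => hR (i, j) y _ _ hy (hL.norm_inv_le hρ.pos) (hL.norm_div_le hρ.pos))
      (w := fun y => (P.symL (P.point ζ h y)).mulVec (φ y).ofLp)
      (fun i y hy => by
        rw [max_eq_left hy]
        exact hasDerivWithinAt_symL_mulVec hρ hy (hL.norm_inv_le hρ.pos)
          (hL.norm_div_le hρ.pos) (mul_inv_cancel₀ hζ0) (div_mul_cancel₀ _ hζ0) hL.pos.ne'
          (hasDerivWithinAt_C5.1 (hφ y hy)) i)
      (M := 5 * CL * K)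
      (fun y hy => (norm_mulVec_le hCL (hLb _ (hL.point_mem hρ.pos hy)) _).trans
        (mul_le_mul_of_nonneg_left ((norm_ofLp_le _).trans (hK y hy)) (by positivity)))
      h0 x hx
    have hQ := congrArg (P.symQ (P.point ζ h x)).mulVec hw
    rw [Matrix.mulVec_mulVec, symQ_mul_symL hρ (hL.point_mem hρ.pos hx), Matrix.one_mulVec,
      Matrix.mulVec_zero] at hQ
    exact WithLp.ofLp_injective 2 hQ
  set l : C5 → ℂ := fun v => (P.symL (P.point ζ h x₀)).mulVec v.ofLp 0 with hl
  have hl0 : l (θ x₀) ≠ 0 := fun h0 => by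
    obtain ⟨x, hx, hne⟩ := hne
    exact hne (hvanish θ hd hb h0 x hx)
  refine ⟨l (θ' x₀) / l (θ x₀), fun x hx => ?_⟩
  set c := l (θ' x₀) / l (θ x₀) with hc
  refine sub_eq_zero.1 (hvanish (fun y => θ' y - c • θ y) (fun y hy => ?_) ?_ ?_ x hx)
  · refine ((hd' y hy).sub ((hd y hy).const_smul c)).congr_deriv ?_
    rw [WithLp.ofLp_sub, WithLp.ofLp_smul, Matrix.mulVec_sub, Matrix.mulVec_smul,
      WithLp.toLp_sub, WithLp.toLp_smul]
  · obtain ⟨K, hK⟩ := hb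
    obtain ⟨K', hK'⟩ := hb'
    refine ⟨K' + ‖c‖ * K, fun y hy => (norm_sub_le _ _).trans (add_le_add (hK' y hy) ?_)⟩
    rw [norm_smul]
    exact mul_le_mul_of_nonneg_left (hK y hy) (norm_nonneg _)
  · rw [WithLp.ofLp_sub, WithLp.ofLp_smul, Matrix.mulVec_sub, Matrix.mulVec_smul]
    change l (θ' x₀) - c * l (θ x₀) = 0
    rw [hc, div_mul_cancel₀ _ hl0, sub_self]

end Profile

end ZND

/-! ### Conclusion, including the imaginary axis. -/

namespace ZND

namespace Profile

variable {Z : Model} {P : Profile Z} {ρ h : ℝ} {ζ : ℂ}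

/-- The second component of `T₁` already has this modulus. The growth with `|ζ|` turns the absolute
error `C h` into a relative one of order `h / |ζ|`. -/
lemma le_norm_T1 (P : Profile Z) (ζ : ℂ) : ‖ζ‖ / P.u 0 ≤ ‖P.T1 0 ζ‖ := by
  have h := PiLp.norm_apply_le (P.T1 0 ζ) 1
  have h1 : P.T1 0 ζ 1 = ζ / (P.u 0 : ℂ) := rfl
  rwa [h1, norm_div, Complex.norm_real, Real.norm_of_nonneg (P.u_pos le_rfl).le] at h

lemma DecaysExp.bounded {θ : ℝ → C5} (h : P.DecaysExp ζ h θ) : ∃ K, ∀ x, 0 ≤ x → ‖θ x‖ ≤ K := by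
  obtain ⟨-, C, a, ha, hC⟩ := h
  refine ⟨|C|, fun x hx => (hC x hx).trans ((mul_le_mul_of_nonneg_right (le_abs_self C)
    (Real.exp_pos _).le).trans (mul_le_of_le_one_right (abs_nonneg C) ?_))⟩
  exact Real.exp_le_one_iff.2 (by nlinarith)

lemma neBot_nhdsWithin_re_pos (hζ : ζ.re = 0) : (𝓝[{z : ℂ | 0 < z.re}] ζ).NeBot := by
  rw [← mem_closure_iff_nhdsWithin_neBot, Complex.closure_setOfPred_lt_re]
  exact hζ.ge

end Profile

end ZND

end

theorem propositionk1 (Z : ZND.Model) (P : ZND.Profile Z) :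
    ∃ M : ℝ, 0 < M ∧ ∃ C : ℝ, 0 < C ∧
      ∀ (ζ : ℂ) (h : ℝ), 0 ≤ ζ.re → M ≤ ‖ζ‖ → 0 < h → h ≤ 1 →
        ∃ θ : ℝ → ZND.C5,
          P.IsDecaying ζ h θ ∧
          (∀ θ' : ℝ → ZND.C5, P.IsDecaying ζ h θ' →
            ∃ c : ℂ, c ≠ 0 ∧ ∀ x, 0 ≤ x → θ' x = c • θ x) ∧
          ‖θ 0 - P.T1 0 ζ‖ ≤ C * (h / ‖ζ‖) * ‖P.T1 0 ζ‖ := by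
  obtain ⟨ρ, hρ⟩ := P.exists_admissible
  obtain ⟨a, ha, C, hC, hfam⟩ := ZND.Profile.exists_decaying_family hρ
  have hu := P.u_pos le_rfl
  have hρ0 := hρ.pos
  -- Beyond `ρ⁻¹` the construction applies; beyond `C u(0)` the error `C h ≤ C` is smaller than
  -- `|T₁(0)|`, so `θ` does not vanish at `0`. The added `1` makes these inequalities strict, hence
  -- stable in a neighbourhood of `ζ` when limits onto the axis are taken.
  refine ⟨max ρ⁻¹ (C * P.u 0) + 1, by positivity, C * P.u 0 + 1, by positivity,
    fun ζ h hζ hM h0 h1 => ?_⟩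
  obtain ⟨θ, hθc, hθd, hθb, hθ0⟩ := hfam h h0 h1
  have hlarge : ∀ z : ℂ, 0 ≤ z.re → max ρ⁻¹ (C * P.u 0) < ‖z‖ → z ∈ ZND.Profile.zetaSet ρ :=
    fun z hz hn => ⟨hz, ((le_max_left _ _).trans_lt hn).le⟩
  have hne : ∀ z : ZND.Profile.zetaSet ρ, max ρ⁻¹ (C * P.u 0) < ‖(z : ℂ)‖ → θ 0 z ≠ 0 := by
    intro z hz h00
    have h2 := hθ0 z
    rw [h00, zero_sub, norm_neg] at h2
    have h3 := (P.le_norm_T1 z).trans h2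
    rw [div_le_iff₀ hu] at h3
    have h4 : C * h * P.u 0 ≤ C * P.u 0 := by nlinarith [mul_nonneg hC hu.le]
    exact absurd ((le_max_right ρ⁻¹ (C * P.u 0)).trans_lt hz) (h3.trans h4).not_gt
  have hdec : ∀ z : ZND.Profile.zetaSet ρ, max ρ⁻¹ (C * P.u 0) < ‖(z : ℂ)‖ → 0 < (z : ℂ).re →
      P.DecaysExp z h fun x => θ x z := by
    intro z hz hre
    obtain ⟨K, hK⟩ := hθb z
    exact ⟨⟨hθd z, 0, le_rfl, hne z hz⟩, K, a * (z : ℂ).re, mul_pos ha hre, hK⟩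
  have hMlt : max ρ⁻¹ (C * P.u 0) < ‖ζ‖ := by linarith
  set ζ' : ZND.Profile.zetaSet ρ := ⟨ζ, hlarge ζ hζ hMlt⟩ with hζ'
  have hunique : ∀ z : ZND.Profile.zetaSet ρ, max ρ⁻¹ (C * P.u 0) < ‖(z : ℂ)‖ → 0 < (z : ℂ).re →
      ∀ θ', P.DecaysExp z h θ' → ∃ c : ℂ, ∀ x, 0 ≤ x → θ' x = c • θ x z := by
    intro z hz hre θ' hθ'
    exact ZND.Profile.exists_smul_of_bounded hρ (.of_mem z h0 h1) hre (hθd z) hθ'.1.1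
      (hdec z hz hre).bounded hθ'.bounded ⟨0, le_rfl, hne z hz⟩
  have hc0 : ∀ {c : ℂ} {θ' : ℝ → ZND.C5}, P.IsSolution ζ h θ' →
      (∀ x, 0 ≤ x → θ' x = c • θ x ζ') → c ≠ 0 := by
    rintro c θ' ⟨-, x, hx, hx0⟩ hc rfl
    exact hx0 (by rw [hc x hx, zero_smul])
  classical
  -- The value `0` outside the parameter set is never met: points near `ζ` with positive real part
  -- belong to it.
  set Θ : ℂ → ℝ → ZND.C5 := fun z x => if hz : z ∈ ZND.Profile.zetaSet ρ then θ x ⟨z, hz⟩ else 0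
    with hΘ
  have hev : ∀ᶠ z in 𝓝[{z : ℂ | 0 < z.re}] ζ, 0 < z.re ∧ max ρ⁻¹ (C * P.u 0) < ‖z‖ :=
    (eventually_mem_nhdsWithin).and
      (nhdsWithin_le_nhds ((continuous_norm.tendsto ζ).eventually (lt_mem_nhds hMlt)))
  have hΘeq : ∀ (z : ℂ) (hz : z ∈ ZND.Profile.zetaSet ρ) (x : ℝ), Θ z x = θ x ⟨z, hz⟩ :=
    fun z hz x => dif_pos hz
  have hΘlim : ∀ x, 0 ≤ x →
      Tendsto (fun z => Θ z x) (𝓝[{z : ℂ | 0 < z.re}] ζ) (𝓝 (θ x ζ')) := by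
    intro x hx
    have hon : ContinuousOn (fun z => Θ z x) (ZND.Profile.zetaSet ρ) := by
      rw [continuousOn_iff_continuous_domRestrict]
      exact (hθc x hx).congr fun z => (hΘeq z z.2 x).symm
    have ht := hon ζ ζ'.2
    rw [ContinuousWithinAt, hΘeq ζ ζ'.2 x] at ht
    exact ht.mono_left (nhdsWithin_le_of_mem
      (hev.mono fun z hz => hlarge z hz.1.le hz.2))
  refine ⟨fun x => θ x ζ', ?_, ?_, ?_⟩
  · rcases hζ.lt_or_eq with hpos | hzero
    · exact Or.inl ⟨hpos, hdec ζ' hMlt hpos⟩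
    · refine Or.inr ⟨hzero.symm, ⟨hθd ζ', 0, le_rfl, hne ζ' hMlt⟩, ?_, Θ, ?_, hΘlim⟩
      · obtain ⟨K, hK⟩ := hθb ζ'
        exact ⟨K, fun x hx => by simpa [hζ', ← hzero] using hK x hx⟩
      · filter_upwards [hev] with z hz
        have hmem := hlarge z hz.1.le hz.2
        have heq : Θ z = fun x => θ x ⟨z, hmem⟩ := funext (hΘeq z hmem)
        rw [heq]
        exact hdec ⟨z, hmem⟩ hz.2 hz.1
  · rintro θ' (⟨hpos, hθ'⟩ | ⟨hzero, hθ', -, Θ', hΘ', hΘ'lim⟩)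
    · obtain ⟨c, hc⟩ := hunique ζ' hMlt hpos θ' hθ'
      exact ⟨c, hc0 hθ'.1 hc, hc⟩
    · have := ZND.Profile.neBot_nhdsWithin_re_pos hzero
      -- On the axis, the proportionality factor for nearby `z` is a quotient of `i`-th components
      -- at `x = 0`. The denominator has a nonzero limit, so the factors converge and
      -- proportionality passes to the limit.
      obtain ⟨i, hi⟩ : ∃ i, θ 0 ζ' i ≠ 0 := by
        by_contra! hall
        exact hne ζ' hMlt (PiLp.ext hall)
      have happ : ∀ {F : ℂ → ZND.C5} {v : ZND.C5},
          Tendsto F (𝓝[{z : ℂ | 0 < z.re}] ζ) (𝓝 v) →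
          Tendsto (fun z => F z i) (𝓝[{z : ℂ | 0 < z.re}] ζ) (𝓝 (v i)) := fun h =>
        ((EuclideanSpace.proj (𝕜 := ℂ) i).continuous.tendsto _).comp h
      have hquot := (happ (hΘ'lim 0 le_rfl)).div (happ (hΘlim 0 le_rfl)) hi
      have hev' := (happ (hΘlim 0 le_rfl)).eventually_ne hi
      have hprop : ∀ x, 0 ≤ x → θ' x = (θ' 0 i / θ 0 ζ' i) • θ x ζ' := by
        intro x hx
        refine tendsto_nhds_unique ((hΘ'lim x hx).congr' ?_) (hquot.smul (hΘlim x hx))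
        filter_upwards [hev, hev', hΘ'] with z hz hz0 hz'
        have hmem := hlarge z hz.1.le hz.2
        obtain ⟨c, hc⟩ := hunique ⟨z, hmem⟩ hz.2 hz.1 _ hz'
        have hcx : ∀ y, 0 ≤ y → Θ' z y = c • Θ z y := fun y hy => by
          rw [hΘeq z hmem]; exact hc y hy
        have hci : Θ' z 0 i / Θ z 0 i = c := by
          rw [hcx 0 le_rfl, PiLp.smul_apply, smul_eq_mul, mul_div_cancel_right₀ _ hz0]
        rw [Pi.div_apply, hci, hcx x hx]
      exact ⟨_, hc0 hθ' hprop, hprop⟩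
  · have h2 : C * h ≤ C * P.u 0 * (h / ‖ζ‖) * (‖ζ‖ / P.u 0) := by
      have hζn : 0 < ‖ζ‖ := norm_pos_iff.2 ((ZND.Profile.Large.of_mem ζ' h0 h1).ne_zero hρ0)
      apply le_of_eq; field_simp
    calc ‖θ 0 ζ' - P.T1 0 ζ‖ ≤ C * h := hθ0 ζ'
      _ ≤ C * P.u 0 * (h / ‖ζ‖) * (‖ζ‖ / P.u 0) := h2
      _ ≤ C * P.u 0 * (h / ‖ζ‖) * ‖P.T1 0 ζ‖ :=
        mul_le_mul_of_nonneg_left (P.le_norm_T1 ζ) (by positivity)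
      _ ≤ _ := by gcongr; linarith
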